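/- **Setting.** Let $n,m\ge 0$ and let $M\subseteq\mathbb R^m$ be an embedded smooth submanifold (possibly with boundary), with tangent spaces $T_xM\subseteq\mathbb R^m$. Let $C_k(X)$ be the space of $k$-tuples of distinct points of $X$ (and similarly $C_I(X)$ for a finite index set $I$), and put $\underline n=\{1,\dots,n\}$. Let $$A_n[M]=M^{n}\times (S^{m-1})^{C_2(\underline n)}\times[0,\infty]^{C_3(\underline n)},$$ where $[0,\infty]$ carries the smooth structure given by the coordinate $t/(1+t)\in[0,1]$. Let $C_n[M]$ be the closure in $A_n[M]$ of the image of $C_n(M)$ under $$(x_i)\mapsto\Big((x_i),\ \big(\tfrac{x_i-x_j}{|x_i-x_j|}\big)_{(i,j)},\ \big(\tfrac{|x_i-x_j|}{|x_i-x_k|}\big)_{(i,j,k)}\Big).$$ **Trees.** An $f$-tree $T$ with $n$ leaves is a finite tree with a root $v_0$ in which no vertex other than the root has valence $2$, and whose univalent vertices other than the root (the leaves) are labelled bijectively by $\underline n$. Vertices that are neither the root nor a leaf are internal; they form the set $V^i(T)$. A vertex lies over the vertices on its path to the root. $E(v)$ is the set of edges at $v$ leading away from the root, $\#v=|E(v)|$,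 and, for a root edge $e\in E(v_0)$, $V(e)$ is the set of internal vertices lying over $e$ (including its upper endpoint, if that is internal). **Strata.** For $x=((x_i),(u_{ij}),(d_{ijk}))\in C_n[M]$ let $\mathcal P(x)$ be the collection of all sets $\{i\}\cup\{j : d_{ijk}=0\}$, with $i\neq k$ such that some such $j$ exists ($i,j,k$ distinct). Build a tree with a root, one vertex for each member of $\mathcal P(x)$ and $n$ labelled leaves: members are joined to the maximal members strictly contained in them, the root is joined to the maximal members, and the leaf $i$ is joined to the smallest member containing $i$, or to the root if there is none. Let $T(x)$ be this tree, except that when $n\ge2$ and all $x_i$ coincide a new root is added, joined by an edge to the old one. For an $f$-tree $T$ with $n$ leaves, $C_T(M)\subseteq C_n[M]$ is the subspace of all $x$ with $T(x)\cong T$ (as labelled rooted trees). **Infinitesimal configurations.** $IC_k(M)$ is the space of pairs $(x,(w_1,\dots,w_k))$ with $x\in M$ and $w_1,\dots,w_k$ distinct points of $T_xM$, modulo translations and positive scalings of $(w_1,\dots,w_k)$ in $T_xM$, with the quotient topology and smooth structure. For $e\in E(v_0)$, $IC_e(M)$ is the space of points $x\in M$ together with an element of $IC_{\#v}(M)$ over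 $x$ for each $v\in V(e)$ (so $IC_e(M)=M$ if $V(e)=\emptyset$). $D_T(M)\subseteq\prod_{e\in E(v_0)}IC_e(M)$ is the subspace of tuples whose underlying points $(x_e)_{e\in E(v_0)}$ are distinct. (At each $v$ the $\#v$ points are indexed by $E(v)$.) Let $\widetilde C_k(\mathbb R^m)$ be the quotient of $C_k(\mathbb R^m)$ by translations and positive scalings. **Theorem.** For every $f$-tree $T$ with $n$ leaves: 1. For every such $M$, $C_T(M)$, with the smooth structure it has as a subspace of $A_n[M]$, is diffeomorphic to $D_T(M)$. 2. For $M=\mathbb R^m$, the map sending an element of $D_T(\mathbb R^m)$ to its underlying points $(x_e)_{e\in E(v_0)}$ and, for each $v\in V^i(T)$, the class of its vectors at $v$ modulo translation and scaling, is a diffeomorphism $$D_T(\mathbb R^m)\;\cong\; C_{\#v_0}(\mathbb R^m)\times\prod_{v\in V^i(T)}\widetilde C_{\#v}(\mathbb R^m).$$ -/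

import Mathlib

open scoped ContDiff

/-! ### Smooth structures

A smooth structure on `X` is recorded by a family of Euclidean parameters: a relation
`Rep a x` ("the parameter `a` represents the point `x`") between a normed space and `X`, under
which each parameter represents at most one point and each point is represented.
A subset of a Euclidean space is parametrized by itself, a product by the product of the
parameters, a quotient by the parameters of the space it is a quotient of. -/

/-- A parametrization of the points of `X` by a subset of a real normed space. -/
class SmoothParam (X : Type) where
  Param : Type
  [normed : NormedAddCommGroup Param]
  [normedSpace : NormedSpace ℝ Param]
  Rep : Param → X → Prop
  rep_unique : ∀ {a x y}, Rep a x → Rep a y → x = y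
  rep_exists : ∀ x, ∃ a, Rep a x

attribute [instance, reducible] SmoothParam.normed SmoothParam.normedSpace

namespace SmoothParam

/-- A map is smooth if near each parameter it is induced by a `C^∞` map which is defined on a
neighbourhood in the ambient normed space. For subsets of Euclidean spaces this is the usual
notion (existence of local smooth extensions); for quotient manifolds (where the quotient map is
a submersion) it is smoothness with respect to the quotient manifold structure. -/
def IsSmooth {X Y : Type} [SmoothParam X] [SmoothParam Y] (f : X → Y) : Prop :=
  ∀ (x : X) (a : Param X), Rep a x →
    ∃ (U : Set (Param X)) (F : Param X → Param Y), IsOpen U ∧ a ∈ U ∧ ContDiffOn ℝ ∞ F U ∧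
      ∀ b ∈ U, ∀ y : X, Rep b y → Rep (F b) (f y)

/-- A diffeomorphism: a homeomorphism that is smooth in both directions. -/
def IsDiffeo {X Y : Type} [TopologicalSpace X] [TopologicalSpace Y]
    [SmoothParam X] [SmoothParam Y] (f : X ≃ₜ Y) : Prop :=
  IsSmooth f ∧ IsSmooth f.symm

/-- `X` and `Y` are diffeomorphic. -/
def Diffeomorphic (X Y : Type) [TopologicalSpace X] [TopologicalSpace Y]
    [SmoothParam X] [SmoothParam Y] : Prop :=
  ∃ f : X ≃ₜ Y, IsDiffeo f

/-- Euclidean space, parametrized by itself. -/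
noncomputable instance euclidean (m : ℕ) : SmoothParam (EuclideanSpace ℝ (Fin m)) where
  Param := EuclideanSpace ℝ (Fin m)
  Rep a x := a = x
  rep_unique h h' := h.symm.trans h'
  rep_exists x := ⟨x, rfl⟩

/-- The closed interval `[0, ∞]`, with the coordinate `t ↦ t / (1 + t)` that identifies it
with `[0, 1]`. -/
noncomputable instance ennreal : SmoothParam ENNReal where
  Param := ℝ
  Rep a t := a = (ENNReal.orderIsoUnitIntervalBirational t : ℝ)
  rep_unique h h' :=
    ENNReal.orderIsoUnitIntervalBirational.injective (Subtype.ext (h.symm.trans h'))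
  rep_exists _ := ⟨_, rfl⟩

/-- Subspaces. -/
noncomputable instance subtype {X : Type} [SmoothParam X] (p : X → Prop) : SmoothParam {x : X // p x} where
  Param := Param X
  Rep a x := Rep a x.1
  rep_unique h h' := Subtype.ext (rep_unique h h')
  rep_exists x := rep_exists x.1

/-- Binary products. -/
noncomputable instance prod {X Y : Type} [SmoothParam X] [SmoothParam Y] : SmoothParam (X × Y) where
  Param := Param X × Param Y
  Rep a x := Rep a.1 x.1 ∧ Rep a.2 x.2
  rep_unique h h' := Prod.ext (rep_unique h.1 h'.1) (rep_unique h.2 h'.2)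
  rep_exists x :=
    let ⟨a, ha⟩ := rep_exists x.1
    let ⟨b, hb⟩ := rep_exists x.2
    ⟨(a, b), ha, hb⟩

/-- Finite products. -/
noncomputable instance pi {ι : Type} [Finite ι] {X : ι → Type} [∀ i, SmoothParam (X i)] :
    SmoothParam (∀ i, X i) :=
  letI : Fintype ι := Fintype.ofFinite ι
  { Param := ∀ i, Param (X i)
    Rep := fun a x => ∀ i, Rep (a i) (x i)
    rep_unique := fun h h' => funext fun i => rep_unique (h i) (h' i)
    rep_exists := fun x => Classical.axiomOfChoice fun i => rep_exists (x i) }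

/-- Quotients. -/
noncomputable instance quotient {X : Type} [SmoothParam X] (s : Setoid X) : SmoothParam (Quotient s) where
  Param := Param X
  Rep a q := ∃ x : X, Quotient.mk s x = q ∧ Rep a x
  rep_unique := by
    rintro a _ _ ⟨x, rfl, hx⟩ ⟨y, rfl, hy⟩
    rw [rep_unique hx hy]
  rep_exists q := by
    obtain ⟨x, rfl⟩ := Quotient.exists_rep q
    obtain ⟨a, ha⟩ := rep_exists x
    exact ⟨a, x, rfl, ha⟩

end SmoothParam

/-! ### Submanifolds of Euclidean space -/

/-- Euclidean space `ℝ^m`. -/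
abbrev Euc (m : ℕ) : Type := EuclideanSpace ℝ (Fin m)

/-- `M` is an embedded smooth `d`-dimensional submanifold of `ℝ^m`, possibly with boundary: near
each of its points some diffeomorphism between open subsets of `ℝ^m` carries `M` to
`{y ∈ L | 0 ≤ ℓ y}`, with `L` a `d`-dimensional linear subspace. If `ℓ` vanishes on `L` this is
all of `L`, and otherwise it is a closed half-space of `L`. -/
def IsSmoothSubmanifold {m : ℕ} (d : ℕ) (M : Set (Euc m)) : Prop :=
  ∀ x ∈ M, ∃ (φ : OpenPartialHomeomorph (Euc m) (Euc m)) (L : Submodule ℝ (Euc m))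
    (ℓ : Euc m →ₗ[ℝ] ℝ),
    x ∈ φ.source ∧ ContDiffOn ℝ ∞ φ φ.source ∧ ContDiffOn ℝ ∞ φ.symm φ.target ∧
      Module.finrank ℝ L = d ∧ ∀ y ∈ φ.source, y ∈ M ↔ φ y ∈ L ∧ 0 ≤ ℓ (φ y)

/-- The tangent space of `M` at `x`, as a linear subspace of `ℝ^m`: the span of the limits of
rescaled secant vectors of `M` at `x`. -/
def tangentSpaceAt {m : ℕ} (M : Set (Euc m)) (x : Euc m) : Submodule ℝ (Euc m) :=
  Submodule.span ℝ (tangentConeAt ℝ M x)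

/-! ### Configuration spaces and the canonical compactification -/

/-- The space of configurations of distinct points of `X` indexed by `I`. -/
abbrev Conf (I X : Type) : Type := {x : I → X // Function.Injective x}

/-- `A_n[M] = M^n × (S^{m-1})^{C_2(n)} × [0,∞]^{C_3(n)}`. -/
abbrev CompactAmbient {m : ℕ} (n : ℕ) (M : Set (Euc m)) : Type :=
  (Fin n → M) × (Conf (Fin 2) (Fin n) → Metric.sphere (0 : Euc m) 1) ×
    (Conf (Fin 3) (Fin n) → ENNReal)

/-- The unit vector in the direction of `x - y`. -/
noncomputable def unitDir {m : ℕ} (x y : Euc m) (h : x ≠ y) : Metric.sphere (0 : Euc m) 1 :=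
  ⟨‖x - y‖⁻¹ • (x - y), by
    rw [mem_sphere_zero_iff_norm, norm_smul, norm_inv, norm_norm,
      inv_mul_cancel₀ (norm_ne_zero_iff.mpr (sub_ne_zero.mpr h))]⟩

/-- The map `α_n : C_n(M) → A_n[M]`, with components the inclusion, the directions
`π_ij = (x_i - x_j)/|x_i - x_j|` and the ratios `s_ijk = |x_i - x_j|/|x_i - x_k|`. -/
noncomputable def confEmbed {m : ℕ} (n : ℕ) (M : Set (Euc m)) (x : Conf (Fin n) M) :
    CompactAmbient n M :=
  (x.1,
   fun p => unitDir (x.1 (p.1 0)) (x.1 (p.1 1)) fun h =>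
     zero_ne_one (p.2 (x.2 (Subtype.ext h))),
   fun t => edist (x.1 (t.1 0)) (x.1 (t.1 1)) / edist (x.1 (t.1 0)) (x.1 (t.1 2)))

/-- The canonical compactification `C_n[M]`, the closure of the image of `α_n` in `A_n[M]`. -/
def canonicalCompactification {m : ℕ} (n : ℕ) (M : Set (Euc m)) : Set (CompactAmbient n M) :=
  closure (Set.range (confEmbed n M))

/-! ### Trees -/

/-- A finite graph with a root vertex and with `n` vertices labelled by `Fin n`. -/
structure RootedGraph (n : ℕ) where
  V : Type
  [finite : Finite V]
  graph : SimpleGraph V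
  root : V
  leaf : Fin n → V

attribute [instance] RootedGraph.finite

namespace RootedGraph

variable {n : ℕ}

/-- The number of edges at `v`. -/
noncomputable def valence (T : RootedGraph n) (v : T.V) : ℕ :=
  (T.graph.neighborSet v).ncard

/-- `T` is an `f`-tree with `n` leaves: a tree in which no vertex other than the root is
bivalent, and whose leaves (the univalent vertices other than the root) are labelled bijectively
by `Fin n`. -/
structure IsFTree (T : RootedGraph n) : Prop where
  isTree : T.graph.IsTree
  leaf_injective : Function.Injective T.leaf
  mem_range_leaf : ∀ v, v ∈ Set.range T.leaf ↔ v ≠ T.root ∧ T.valence v = 1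
  not_bivalent : ∀ v, v ≠ T.root → T.valence v ≠ 2

/-- Isomorphism of labelled rooted graphs. -/
def Iso (T T' : RootedGraph n) : Prop :=
  ∃ e : T.graph ≃g T'.graph, e T.root = T'.root ∧ ∀ i, e (T.leaf i) = T'.leaf i

/-- `v` lies over `w` if `w` is on the path from `v` to the root (in particular `v` lies over
itself). -/
def LiesOver (T : RootedGraph n) (v w : T.V) : Prop :=
  ∃ p : T.graph.Walk v T.root, p.IsPath ∧ w ∈ p.support

/-- The set `E(v)` of edges with initial vertex `v`, an edge being named by its terminal
vertex. -/
abbrev EdgesAt (T : RootedGraph n) (v : T.V) : Type :=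
  {c : T.V // T.graph.Adj v c ∧ T.LiesOver c v}

/-- Internal vertices are the vertices that are neither the root nor a leaf. -/
def IsInternal (T : RootedGraph n) (v : T.V) : Prop :=
  v ≠ T.root ∧ v ∉ Set.range T.leaf

/-- The set `V^i(T)` of internal vertices. -/
abbrev Internal (T : RootedGraph n) : Type := {v : T.V // T.IsInternal v}

/-- The set `V(e)` of internal vertices that lie over a root edge `e`. -/
abbrev InternalOver (T : RootedGraph n) (e : T.EdgesAt T.root) : Type :=
  {v : T.V // T.IsInternal v ∧ T.LiesOver v e.1}

/-- The tree of a parenthesization `P`: the vertices are a root (`none`), one vertex for each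
member of `P`, and `n` leaves. There is an edge from `B` to `A` if `A` is maximal among the
members of `P` strictly contained in `B`, from the root to each maximal member, and to the leaf
`i` from the smallest member containing `i`, or from the root if there is none. -/
def ofParenthesization (P : Set (Set (Fin n))) : RootedGraph n where
  V := Option (P ⊕ Fin n)
  graph := SimpleGraph.fromRel fun a b => match a, b with
    | none, some (Sum.inl A) => ∀ B ∈ P, A.1 ⊆ B → B = A.1
    | some (Sum.inl B), some (Sum.inl A) => A.1 ⊂ B.1 ∧ ¬∃ C ∈ P, A.1 ⊂ C ∧ C ⊂ B.1
    | none, some (Sum.inr i) => ∀ A ∈ P, i ∉ A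
    | some (Sum.inl A), some (Sum.inr i) => i ∈ A.1 ∧ ∀ B ∈ P, i ∈ B → A.1 ⊆ B
    | _, _ => False
  root := none
  leaf i := some (Sum.inr i)

/-- The parenthesization of an exclusion relation `R` (where `R i j k` says that `i` and `j`
exclude `k`): its members are the sets consisting of `i` and all `j` with `R i j k`, for those
`i` and `k` for which there is such a `j`. -/
def parenthesization (R : Fin n → Fin n → Fin n → Prop) : Set (Set (Fin n)) :=
  {A | ∃ i k, (∃ j, R i j k) ∧ A = insert i {j | R i j k}}

/-- The tree of an exclusion relation. -/
def ofExclusion (R : Fin n → Fin n → Fin n → Prop) : RootedGraph n :=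
  ofParenthesization (parenthesization R)

/-- Add a new root, joined by an edge to the old one. -/
def addRoot (T : RootedGraph n) : RootedGraph n where
  V := Option T.V
  graph := SimpleGraph.fromRel fun a b => match a, b with
    | none, some v => v = T.root
    | some v, some w => T.graph.Adj v w
    | _, _ => False
  root := none
  leaf i := some (T.leaf i)

end RootedGraph

/-! ### The strata `C_T(M)` -/

section Strata

variable {m n : ℕ} {M : Set (Euc m)}

/-- The exclusion relation of a point of `A_n[M]`: `(i, j), k` is in it if `d_ijk = 0`. -/
def exclusionOf (x : CompactAmbient n M) (i j k : Fin n) : Prop :=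
  ∃ h : Function.Injective ![i, j, k], x.2.2 ⟨![i, j, k], h⟩ = 0

open Classical in
/-- The tree `T(x)`. A new root is added when all the (at least two) points `x_i` coincide. -/
noncomputable def treeOf (x : CompactAmbient n M) : RootedGraph n :=
  if 2 ≤ n ∧ ∀ i j, x.1 i = x.1 j then (RootedGraph.ofExclusion (exclusionOf x)).addRoot
  else RootedGraph.ofExclusion (exclusionOf x)

/-- The stratum `C_T(M)`, the subspace of those `x` in `C_n[M]` with `T(x) = T`. -/
abbrev Stratum (T : RootedGraph n) (M : Set (Euc m)) : Type :=
  {x : CompactAmbient n M // x ∈ canonicalCompactification n M ∧ (treeOf x).Iso T}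

end Strata

/-! ### Infinitesimal configurations and `D_T(M)` -/

section InfinitesimalConfigurations

variable {m : ℕ}

/-- Configurations, indexed by `I`, of distinct points lying in one fiber of `TM`. -/
abbrev TangentConf (M : Set (Euc m)) (I : Type) : Type :=
  {p : M × (I → Euc m) // Function.Injective p.2 ∧ ∀ i, p.2 i ∈ tangentSpaceAt M p.1}

/-- The relation on `TangentConf M I` of lying in the same fiber and differing there by a
translation and a positive scaling. -/
def tangentConfSetoid (M : Set (Euc m)) (I : Type) : Setoid (TangentConf M I) where
  r p q := p.1.1 = q.1.1 ∧ ∃ s : ℝ, 0 < s ∧ ∃ w ∈ tangentSpaceAt M p.1.1,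
    ∀ i, q.1.2 i = s • p.1.2 i + w
  iseqv :=
    { refl := fun p => ⟨rfl, 1, one_pos, 0, Submodule.zero_mem _, fun i => by simp⟩
      symm := by
        rintro p q ⟨h, s, hs, w, hw, e⟩
        refine ⟨h.symm, s⁻¹, inv_pos.mpr hs, -(s⁻¹ • w), ?_, fun i => ?_⟩
        · rw [← h]
          exact Submodule.neg_mem _ (Submodule.smul_mem _ _ hw)
        · rw [e i, smul_add, smul_smul, inv_mul_cancel₀ hs.ne', one_smul, add_neg_cancel_right]
      trans := by
        rintro p q r ⟨h, s, hs, w, hw, e⟩ ⟨h', s', hs', w', hw', e'⟩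
        refine ⟨h.trans h', s' * s, mul_pos hs' hs, s' • w + w', ?_, fun i => ?_⟩
        · rw [← h] at hw'
          exact Submodule.add_mem _ (Submodule.smul_mem _ _ hw) hw'
        · rw [e' i, e i, smul_add, smul_smul, add_assoc] }

/-- The space `IC_I(M)` of infinitesimal configurations of points of `M` indexed by `I`. -/
abbrev InfConf (M : Set (Euc m)) (I : Type) : Type := Quotient (tangentConfSetoid M I)

/-- The projection of `IC_I(M)` onto `M`. -/
def InfConf.base {M : Set (Euc m)} {I : Type} (c : InfConf M I) : M :=
  Quotient.lift (s := tangentConfSetoid M I) (fun p : TangentConf M I => p.1.1)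
    (fun _ _ h => h.1) c

/-- The relation on configurations in `ℝ^m` of differing by a translation and a positive
scaling. -/
def confSetoid (m : ℕ) (I : Type) : Setoid (Conf I (Euc m)) where
  r x y := ∃ s : ℝ, 0 < s ∧ ∃ w : Euc m, ∀ i, y.1 i = s • x.1 i + w
  iseqv :=
    { refl := fun p => ⟨1, one_pos, 0, fun i => by simp⟩
      symm := by
        rintro p q ⟨s, hs, w, e⟩
        refine ⟨s⁻¹, inv_pos.mpr hs, -(s⁻¹ • w), fun i => ?_⟩
        rw [e i, smul_add, smul_smul, inv_mul_cancel₀ hs.ne', one_smul, add_neg_cancel_right]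
      trans := by
        rintro p q r ⟨s, hs, w, e⟩ ⟨s', hs', w', e'⟩
        refine ⟨s' * s, mul_pos hs' hs, s' • w + w', fun i => ?_⟩
        rw [e' i, e i, smul_add, smul_smul, add_assoc] }

/-- The space of configurations in `ℝ^m` modulo translation and scaling. -/
abbrev ConfModSim (m : ℕ) (I : Type) : Type := Quotient (confSetoid m I)

/-- The class modulo translation and scaling of the vectors in `ℝ^m` that make up an
infinitesimal configuration. -/
def InfConf.toConfModSim {M : Set (Euc m)} {I : Type} (c : InfConf M I) : ConfModSim m I :=
  Quotient.lift (s := tangentConfSetoid M I)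
    (fun p : TangentConf M I => Quotient.mk (confSetoid m I) ⟨p.1.2, p.2.1⟩)
    (fun _ _ h => Quotient.sound (s := confSetoid m I)
      (let ⟨_, s, hs, w, _, e⟩ := h; ⟨s, hs, w, e⟩)) c

variable {n : ℕ}

/-- The space `IC_e(M)` of points of `M` together with an infinitesimal configuration at that
point for each internal vertex lying over the root edge `e`. -/
abbrev InfConfOver (T : RootedGraph n) (M : Set (Euc m)) (e : T.EdgesAt T.root) : Type :=
  {p : M × (∀ v : T.InternalOver e, InfConf M (T.EdgesAt v.1)) // ∀ v, (p.2 v).base = p.1}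

/-- The space `D_T(M)`: a tuple of elements of the `IC_e(M)`, for the root edges `e` of `T`, that
sit over distinct points of `M`. -/
abbrev InfStratum (T : RootedGraph n) (M : Set (Euc m)) : Type :=
  {p : ∀ e : T.EdgesAt T.root, InfConfOver T M e //
    Function.Injective fun e => (p e).1.1}

end InfinitesimalConfigurations

/-! Let configurations approach a point of `C_T(M)`. The points `x_i` coincide exactly for leaves
over the same root edge. Over an internal vertex `v`, differences of points that branch at `v` all
have the same order of magnitude, while those branching strictly over `v` are negligible. Rescaled,
the cluster over `v` therefore converges to a tuple of distinct vectors indexed by `E(v)`. They are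
limits of rescaled secants, hence tangent to `M`, and are defined up to translation and scaling:
this is an element of `D_T(M)`.

The relation `InfData.IsLimit` ("these configurations converge to these data") carries the
bijection. Four facts are needed. Configurations converging to valid data converge in `A_n[M]` to a
point written explicitly in terms of the data (`IsLimit.tendsto_confEmbed`). All valid data are
limits of configurations (`InfData.exists_isLimit`): place the leaf `i` at the sum of the vectors
met on the way to it, the vector at `c` scaled by `ε` to the depth of `c`, and push the result into
`M` by a chart. Conversely, normalized data can be read off the coordinates of a point of `C_T(M)`:
differences from a base leaf in units of the distance to a scale leaf (`dataOf`). They are valid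
(`isValid_dataOf`), and configurations approaching the point converge to them (`isLimit_dataOf`).
Uniqueness of limits then makes the two constructions mutually inverse, modulo similarity.

The combinatorial condition `T(x) ≅ T` enters only through `treeOf_iso_iff`, which turns it into
conditions on coordinates: `d_ijk = 0` exactly when some vertex of `T` lies under `i` and `j` but
not `k`, and `x_i = x_j` exactly when some non-root vertex lies under both. To prove it, `d_ijk = 0`
is read as a little-o relation between differences of points. The calculus of o and O gives the
axioms of an exclusion relation, whose parenthesization is laminar, and an `f`-tree is recovered
from the leaf sets of its vertices.

Both maps are smooth because they are explicit: the ratios used for normalization stay away from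
`∞`, where the coordinate `t / (1 + t)` inverts smoothly, and the differences whose norms are taken
never vanish. Continuity follows from smoothness, because the topologies are determined by the
parameters (`IsTopological`). For quotients this requires the quotient maps to be open, and for
`IC_k(M)` that in turn requires extending tangent vectors to nearby fibers. Over `ℝ^m` all tangent
spaces are the whole space, so base points and vectors separate, which gives the second statement.
-/

open Filter Topology

/-! ### Topologies determined by parameters -/

namespace SmoothParam

/-- The topology of `X` is the one coinduced by its parameters, through an open map. -/
class IsTopological (X : Type) [TopologicalSpace X] [SmoothParam X] : Prop where
  mem_nhds_iff : ∀ {x : X} {a : Param X}, Rep a x → ∀ {s : Set X},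
    s ∈ 𝓝 x ↔ ∀ᶠ b in 𝓝 a, ∀ y : X, Rep b y → y ∈ s

/-- A local extension on parameters is continuous, and neighbourhoods in source and target are both
detected on parameters. -/
theorem IsSmooth.continuous {X Y : Type} [TopologicalSpace X] [TopologicalSpace Y]
    [SmoothParam X] [SmoothParam Y] [IsTopological X] [IsTopological Y] {f : X → Y}
    (hf : IsSmooth f) : Continuous f := by
  rw [continuous_iff_continuousAt]
  intro x s hs
  obtain ⟨a, ha⟩ := rep_exists x
  obtain ⟨U, F, hU, haU, hF, hrep⟩ := hf x a ha
  rw [IsTopological.mem_nhds_iff (hrep a haU x ha)] at hs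
  have hFa : ContinuousAt F a := hF.continuousOn.continuousAt (hU.mem_nhds haU)
  refine (IsTopological.mem_nhds_iff ha).2 ?_
  filter_upwards [hFa.eventually hs, hU.mem_nhds haU] with b hb hbU y hy
  exact hb _ (hrep b hbU y hy)

/-- A smooth bijection with smooth inverse is a diffeomorphism. -/
theorem exists_isDiffeo_of_equiv {X Y : Type} [TopologicalSpace X] [TopologicalSpace Y]
    [SmoothParam X] [SmoothParam Y] [IsTopological X] [IsTopological Y] (f : X ≃ Y)
    (hf : IsSmooth f) (hf' : IsSmooth f.symm) : ∃ g : X ≃ₜ Y, IsDiffeo g ∧ ∀ x, g x = f x :=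
  ⟨⟨f, hf.continuous, hf'.continuous⟩, ⟨hf, hf'⟩, fun _ => rfl⟩

instance (m : ℕ) : IsTopological (EuclideanSpace ℝ (Fin m)) where
  mem_nhds_iff := by
    rintro x a rfl s
    refine ⟨fun h => ?_, fun h => ?_⟩
    · filter_upwards [h] with b hb y hy
      exact (show b = y from hy) ▸ hb
    · filter_upwards [h] with b hb
      exact hb b rfl

instance : IsTopological ENNReal where
  mem_nhds_iff := by
    rintro x a rfl s
    have he : IsEmbedding fun t : ENNReal => (ENNReal.orderIsoUnitIntervalBirational t : ℝ) :=
      IsEmbedding.subtypeVal.comp ENNReal.orderIsoUnitIntervalBirational.toHomeomorph.isEmbedding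
    rw [he.nhds_eq_comap, mem_comap]
    constructor
    · rintro ⟨t, ht, hts⟩
      filter_upwards [ht] with b hb y hy
      obtain rfl : b = _ := hy
      exact hts hb
    · intro h
      exact ⟨_, h, fun y hy => hy y rfl⟩

instance {X : Type} [TopologicalSpace X] [SmoothParam X] [IsTopological X] (p : X → Prop) :
    IsTopological {x : X // p x} where
  mem_nhds_iff := by
    rintro x a ha s
    have ha' : Rep (X := X) a x.1 := ha
    rw [IsEmbedding.subtypeVal.nhds_eq_comap, mem_comap]
    constructor
    · rintro ⟨t, ht, hts⟩
      filter_upwards [(IsTopological.mem_nhds_iff ha').1 ht] with b hb y hy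
      exact hts (hb y.1 hy)
    · intro h
      refine ⟨{y | ∀ hy : p y, ⟨y, hy⟩ ∈ s}, (IsTopological.mem_nhds_iff ha').2 ?_, fun y hy => hy y.2⟩
      filter_upwards [h] with b hb y hy hpy
      exact hb ⟨y, hpy⟩ hy

instance {X Y : Type} [TopologicalSpace X] [TopologicalSpace Y] [SmoothParam X] [SmoothParam Y]
    [IsTopological X] [IsTopological Y] : IsTopological (X × Y) where
  mem_nhds_iff := by
    rintro ⟨x, y⟩ ⟨a, b⟩ ⟨ha, hb⟩ s
    rw [mem_nhds_prod_iff]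
    constructor
    · rintro ⟨u, hu, v, hv, huv⟩
      have h1 := (IsTopological.mem_nhds_iff ha).1 hu
      have h2 := (IsTopological.mem_nhds_iff hb).1 hv
      have h3 := h1.prod_nhds h2
      refine Filter.Eventually.mono h3 ?_
      rintro ⟨c, d⟩ hcd ⟨z, w⟩ hzw
      exact huv ⟨hcd.1 z hzw.1, hcd.2 w hzw.2⟩
    · intro h
      obtain ⟨U, hU, V, hV, hUV⟩ := mem_nhds_prod_iff.1 (show _ ∈ 𝓝 (a, b) from h)
      refine ⟨{z | ∃ c ∈ U, Rep c z}, (IsTopological.mem_nhds_iff ha).2 ?_,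
        {z | ∃ c ∈ V, Rep c z}, (IsTopological.mem_nhds_iff hb).2 ?_, ?_⟩
      · filter_upwards [hU] with c hc z hz using ⟨c, hc, hz⟩
      · filter_upwards [hV] with c hc z hz using ⟨c, hc, hz⟩
      · rintro ⟨z, w⟩ ⟨⟨c, hc, hz⟩, ⟨d, hd, hw⟩⟩
        exact hUV (Set.mk_mem_prod hc hd) (z, w) ⟨hz, hw⟩

instance {ι : Type} [Finite ι] {X : ι → Type} [∀ i, TopologicalSpace (X i)]
    [∀ i, SmoothParam (X i)] [∀ i, IsTopological (X i)] : IsTopological (∀ i, X i) where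
  mem_nhds_iff := by
    intro x a ha s
    have ha' : ∀ i, Rep (a i) (x i) := ha
    rw [nhds_pi, mem_pi']
    constructor
    · rintro ⟨I, t, ht, hts⟩
      have h : ∀ i, ∀ᶠ b : Param (∀ i, X i) in 𝓝 a, ∀ y : X i, Rep (b i) y → y ∈ t i := fun i =>
        (continuous_apply (A := fun i => Param (X i)) i).continuousAt.eventually
          ((IsTopological.mem_nhds_iff (ha' i)).1 (ht i))
      filter_upwards [eventually_all.2 h] with b hb y hy
      exact hts fun i _ => hb i (y i) (hy i)
    · intro h
      have h' : {b : Param (∀ i, X i) | ∀ y : ∀ i, X i, Rep b y → y ∈ s} ∈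
        Filter.pi fun i => 𝓝 (a i) := by rw [← nhds_pi]; exact h
      obtain ⟨I, t, ht, hts⟩ := mem_pi'.1 h'
      refine ⟨I, fun i => {z | ∃ c ∈ t i, Rep c z}, fun i =>
        (IsTopological.mem_nhds_iff (ha' i)).2 ?_, ?_⟩
      · filter_upwards [ht i] with c hc z hz using ⟨c, hc, hz⟩
      · intro y hy
        choose! c hc hcy using hy
        classical
        choose d hd using fun i => rep_exists (y i)
        -- The basic neighbourhood constrains only the indices in `I`; elsewhere any parameter of
        -- the coordinate will do.
        refine hts (a := fun i => if i ∈ I then c i else d i) (fun i hi => ?_) y fun i => ?_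
        · simpa [Finset.mem_coe.1 hi] using hc i hi
        · by_cases hi : i ∈ I
          · simpa [hi] using hcy i hi
          · simpa [hi] using hd i

/-- Openness makes the neighbourhood filter of a class the image of that of a representative, so the
criterion descends from `X`. -/
theorem isTopological_quotient {X : Type} [TopologicalSpace X] [SmoothParam X] [IsTopological X]
    (s : Setoid X) (hs : IsOpenMap (Quotient.mk s)) : IsTopological (Quotient s) where
  mem_nhds_iff := by
    rintro _ a ⟨x, rfl, ha⟩ t
    have h : 𝓝 (Quotient.mk s x) = map (Quotient.mk s) (𝓝 x) :=
      (hs.nhds_le x).antisymm continuous_quotient_mk'.continuousAt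
    rw [h, mem_map, IsTopological.mem_nhds_iff ha]
    refine eventually_congr (Eventually.of_forall fun b => ⟨?_, ?_⟩)
    · rintro hb _ ⟨y, rfl, hy⟩
      exact hb y hy
    · exact fun hb y hy => hb _ ⟨y, rfl, hy⟩

end SmoothParam

/-! ### The order on the vertices of a tree -/

namespace RootedGraph

variable {n : ℕ} {T : RootedGraph n}

section Tree

variable (hT : T.graph.IsTree)
include hT

theorem exists_isPath_root (v : T.V) : ∃ p : T.graph.Walk v T.root, p.IsPath :=
  (hT.existsUnique_path v T.root).exists

theorem liesOver_iff_mem_support {v w : T.V} {p : T.graph.Walk v T.root} (hp : p.IsPath) :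
    T.LiesOver v w ↔ w ∈ p.support := by
  refine ⟨?_, fun h => ⟨p, hp, h⟩⟩
  rintro ⟨q, hq, h⟩
  rwa [(hT.existsUnique_path v T.root).unique hp hq]

theorem liesOver_refl (v : T.V) : T.LiesOver v v := by
  obtain ⟨p, hp⟩ := exists_isPath_root hT v
  exact ⟨p, hp, p.start_mem_support⟩

theorem liesOver_root (v : T.V) : T.LiesOver v T.root := by
  obtain ⟨p, hp⟩ := exists_isPath_root hT v
  exact ⟨p, hp, p.end_mem_support⟩

theorem LiesOver.trans {u v w : T.V} (huv : T.LiesOver u v) (hvw : T.LiesOver v w) :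
    T.LiesOver u w := by
  classical
  obtain ⟨p, hp, hv⟩ := huv
  rw [liesOver_iff_mem_support hT (hp.dropUntil hv)] at hvw
  exact ⟨p, hp, p.support_dropUntil_subset_support hv hvw⟩

/-- Otherwise `u` would occur twice on its own path to the root. -/
theorem LiesOver.antisymm {u v : T.V} (huv : T.LiesOver u v) (hvu : T.LiesOver v u) : u = v := by
  classical
  obtain ⟨p, hp, hv⟩ := huv
  rw [liesOver_iff_mem_support hT (hp.dropUntil hv)] at hvu
  by_contra hne
  have h1 : u ∈ (p.dropUntil v hv).support.tail := by
    rw [SimpleGraph.Walk.mem_support_iff] at hvu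
    exact hvu.resolve_left hne
  have h2 := hp.support_nodup
  rw [← p.take_spec hv, SimpleGraph.Walk.support_append, List.nodup_append] at h2
  exact h2.2.2 u (p.takeUntil v hv).start_mem_support u h1 rfl

/-- The vertices under `u` all lie on one path, so they form a chain. -/
theorem LiesOver.total {u v w : T.V} (huv : T.LiesOver u v) (huw : T.LiesOver u w) :
    T.LiesOver v w ∨ T.LiesOver w v := by
  classical
  obtain ⟨p, hp, hv⟩ := huv
  rw [liesOver_iff_mem_support hT hp, ← p.take_spec hv, SimpleGraph.Walk.mem_support_append_iff]
    at huw
  rcases huw with h | h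
  · right
    have hw : w ∈ p.support := p.support_takeUntil_subset_support hv h
    rw [liesOver_iff_mem_support hT (hp.dropUntil hw)]
    have h3 : ((p.takeUntil v hv).dropUntil w h).append (p.dropUntil v hv) = p.dropUntil w hw := by
      refine (hT.existsUnique_path w T.root).unique ?_ (hp.dropUntil hw)
      have h4 : (((p.takeUntil v hv).takeUntil w h).append
          (((p.takeUntil v hv).dropUntil w h).append (p.dropUntil v hv))).IsPath := by
        rw [SimpleGraph.Walk.append_assoc, SimpleGraph.Walk.take_spec, SimpleGraph.Walk.take_spec]
        exact hp
      exact h4.of_append_right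
    rw [← h3]
    exact (SimpleGraph.Walk.mem_support_append_iff _ _).2 (Or.inr (SimpleGraph.Walk.start_mem_support _))
  · exact Or.inl ⟨_, hp.dropUntil hv, h⟩

end Tree

/-- `c` is a child of `v`: it is the terminal vertex of an edge with initial vertex `v`. -/
def Child (T : RootedGraph n) (v c : T.V) : Prop := T.graph.Adj v c ∧ T.LiesOver c v

theorem Child.ne {v c : T.V} (h : T.Child v c) : v ≠ c := h.1.ne

section Tree

variable (hT : T.graph.IsTree)
include hT

theorem child_or_child_of_adj {v c : T.V} (h : T.graph.Adj v c) : T.Child v c ∨ T.Child c v := by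
  classical
  obtain ⟨p, hp⟩ := exists_isPath_root hT v
  by_cases hc : c ∈ p.support
  · exact Or.inr ⟨h.symm, p, hp, hc⟩
  · exact Or.inl ⟨h, p.cons h.symm, hp.cons hc, by simp⟩

theorem Child.liesOver_iff {v c : T.V} (h : T.Child v c) {u : T.V} :
    T.LiesOver c u ↔ u = c ∨ T.LiesOver v u := by
  obtain ⟨p, hp⟩ := exists_isPath_root hT v
  have hc : c ∉ p.support := fun hc => h.ne (LiesOver.antisymm hT ⟨p, hp, hc⟩ h.2)
  rw [liesOver_iff_mem_support hT (hp.cons hc (h := h.1.symm)), liesOver_iff_mem_support hT hp]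
  simp

theorem exists_parent {v : T.V} (hv : v ≠ T.root) : ∃ u, T.Child u v := by
  obtain ⟨p, hp⟩ := exists_isPath_root hT v
  cases p with
  | nil => exact absurd rfl hv
  | cons h q => exact ⟨_, h.symm, _, hp, by simp⟩

theorem exists_child_of_liesOver {u v : T.V} (h : T.LiesOver u v) (hne : u ≠ v) :
    ∃ c, T.Child v c ∧ T.LiesOver u c := by
  obtain ⟨p, hp, hv⟩ := h
  generalize hr : T.root = r at p
  induction p with
  | nil => simp at hv; exact absurd hv.symm hne
  | @cons a b c hab q ih =>
    subst hr
    have hba : T.Child b a := ⟨hab.symm, _, hp, by simp⟩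
    rw [SimpleGraph.Walk.support_cons, List.mem_cons] at hv
    by_cases hbv : b = v
    · exact ⟨a, hbv ▸ hba, liesOver_refl hT a⟩
    · obtain ⟨c, hc, hbc⟩ := ih hbv rfl hp.of_cons (hv.resolve_left (Ne.symm hne))
      exact ⟨c, hc, hba.2.trans hT hbc⟩

theorem Child.eq_of_liesOver {u v c c' : T.V} (h : T.Child v c) (h' : T.Child v c')
    (hc : T.LiesOver u c) (hc' : T.LiesOver u c') : c = c' := by
  rcases hc.total hT hc' with hcc | hcc
  · rcases (h.liesOver_iff hT).1 hcc with e | e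
    · exact e.symm
    · exact absurd (e.antisymm hT h'.2) h'.ne
  · rcases (h'.liesOver_iff hT).1 hcc with e | e
    · exact e
    · exact absurd (e.antisymm hT h.2) h.ne

theorem Child.parent_unique {u v c : T.V} (hu : T.Child u c) (hv : T.Child v c) : u = v := by
  have h1 := ((hu.liesOver_iff hT).1 hv.2).resolve_left hv.ne
  have h2 := ((hv.liesOver_iff hT).1 hu.2).resolve_left hu.ne
  exact h1.antisymm hT h2

theorem Child.ne_root {v c : T.V} (h : T.Child v c) : c ≠ T.root := by
  rintro rfl
  exact h.ne ((liesOver_root hT v).antisymm hT h.2)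

/-- Edges are the covering pairs of the order. Adjacency can thus be checked on the order alone,
which for `f`-trees is inclusion of leaf sets. -/
theorem child_iff_covers {v c : T.V} : T.Child v c ↔ T.LiesOver c v ∧ c ≠ v ∧
    ∀ u, T.LiesOver c u → T.LiesOver u v → u = c ∨ u = v := by
  constructor
  · intro h
    refine ⟨h.2, h.ne.symm, fun u hcu huv => ?_⟩
    rcases (h.liesOver_iff hT).1 hcu with e | e
    · exact Or.inl e
    · exact Or.inr (huv.antisymm hT e)
  · rintro ⟨h, hne, hcov⟩
    obtain ⟨d, hd, hcd⟩ := exists_child_of_liesOver hT h hne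
    rcases hcov d hcd hd.2 with e | e
    · exact e ▸ hd
    · exact absurd e hd.ne.symm

/-- Every nonempty set of vertices has a member over which no other member lies. -/
theorem exists_highest {P : T.V → Prop} {v : T.V} (hv : P v) :
    ∃ u, P u ∧ ∀ w, P w → T.LiesOver w u → w = u := by
  let _ : PartialOrder T.V :=
    { le := fun u v => T.LiesOver u v
      le_refl := liesOver_refl hT
      le_trans := fun _ _ _ h h' => h.trans hT h'
      le_antisymm := fun _ _ h h' => h.antisymm hT h' }
  obtain ⟨u, hu⟩ := (Set.toFinite {u | P u}).exists_minimal ⟨v, hv⟩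
  exact ⟨u, hu.1, fun w hw hwu => hwu.antisymm hT (hu.2 hw hwu)⟩

end Tree

section FTree

variable (hT : T.IsFTree)
include hT

theorem neighborSet_eq_insert {u v : T.V} (h : T.Child u v) :
    T.graph.neighborSet v = insert u {c | T.Child v c} := by
  ext c
  rw [SimpleGraph.mem_neighborSet, Set.mem_insert_iff, Set.mem_ofPred_eq]
  constructor
  · intro hc
    rcases child_or_child_of_adj hT.isTree hc with e | e
    · exact Or.inr e
    · exact Or.inl (e.parent_unique hT.isTree h)
  · rintro (rfl | e)
    · exact h.1.symm
    · exact e.1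

theorem valence_eq_ncard_child {u v : T.V} (h : T.Child u v) :
    T.valence v = {c | T.Child v c}.ncard + 1 := by
  rw [valence, neighborSet_eq_insert hT h, Set.ncard_insert_of_notMem]
  exact fun h' => h.ne (LiesOver.antisymm hT.isTree h'.2 h.2)

theorem leaf_ne_root (i : Fin n) : T.leaf i ≠ T.root :=
  ((hT.mem_range_leaf _).1 ⟨i, rfl⟩).1

/-- The edge to the parent already accounts for the valence one of a leaf. -/
theorem not_child_leaf (i : Fin n) (c : T.V) : ¬T.Child (T.leaf i) c := by
  intro h
  obtain ⟨u, hu⟩ := exists_parent hT.isTree (leaf_ne_root hT i)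
  have h1 := ((hT.mem_range_leaf _).1 ⟨i, rfl⟩).2
  rw [valence_eq_ncard_child hT hu, Nat.add_eq_right, Set.ncard_eq_zero] at h1
  exact (h1 ▸ h : c ∈ (∅ : Set T.V))

theorem liesOver_leaf_iff {i : Fin n} {v : T.V} : T.LiesOver v (T.leaf i) ↔ v = T.leaf i := by
  constructor
  · intro h
    by_contra hne
    obtain ⟨c, hc, -⟩ := exists_child_of_liesOver hT.isTree h hne
    exact not_child_leaf hT i c hc
  · rintro rfl
    exact liesOver_refl hT.isTree _

/-- A highest vertex over `v` has no children, so it is univalent and hence a leaf. -/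
theorem exists_leaf_liesOver {v : T.V} (hv : v ≠ T.root) : ∃ i, T.LiesOver (T.leaf i) v := by
  obtain ⟨u, huv, hu⟩ := exists_highest hT.isTree (P := fun u => T.LiesOver u v)
    (liesOver_refl hT.isTree v)
  have hur : u ≠ T.root := by
    rintro rfl
    exact hv ((liesOver_root hT.isTree v).antisymm hT.isTree huv)
  obtain ⟨w, hw⟩ := exists_parent hT.isTree hur
  have h : {c | T.Child u c} = ∅ := by
    ext c
    simp only [Set.mem_ofPred_eq, Set.mem_empty_iff_false, iff_false]
    intro hc
    exact hc.ne (hu c (hc.2.trans hT.isTree huv) hc.2).symm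
  obtain ⟨i, hi⟩ := (hT.mem_range_leaf u).2 ⟨hur, by rw [valence_eq_ncard_child hT hw, h]; simp⟩
  exact ⟨i, hi ▸ huv⟩

/-- The valence is neither one nor two, and only one edge leads to the parent. -/
theorem exists_children_of_isInternal {v : T.V} (hv : T.IsInternal v) :
    ∃ c c', T.Child v c ∧ T.Child v c' ∧ c ≠ c' := by
  obtain ⟨u, hu⟩ := exists_parent hT.isTree hv.1
  have h1 := valence_eq_ncard_child hT hu
  have h2 := hT.not_bivalent v hv.1
  have h3 : T.valence v ≠ 1 := fun h => hv.2 ((hT.mem_range_leaf v).2 ⟨hv.1, h⟩)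
  have h4 : 1 < {c | T.Child v c}.ncard := by omega
  obtain ⟨a, b, ha, hb, hab⟩ := (Set.one_lt_ncard_iff (Set.toFinite _)).1 h4
  exact ⟨a, b, ha, hb, hab⟩

theorem Child.root_or_isInternal {v c : T.V} (h : T.Child v c) : v = T.root ∨ T.IsInternal v := by
  by_cases hv : v = T.root
  · exact Or.inl hv
  · refine Or.inr ⟨hv, ?_⟩
    rintro ⟨i, rfl⟩
    exact not_child_leaf hT i c h

/-- The branching point is the highest vertex under both leaves; a common next vertex would be
higher. -/
theorem exists_split {i j : Fin n} (hij : i ≠ j) : ∃ v c c', T.Child v c ∧ T.Child v c' ∧ c ≠ c' ∧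
    T.LiesOver (T.leaf i) c ∧ T.LiesOver (T.leaf j) c' := by
  obtain ⟨v, ⟨hi, hj⟩, hv⟩ := exists_highest hT.isTree
    (P := fun u => T.LiesOver (T.leaf i) u ∧ T.LiesOver (T.leaf j) u)
    ⟨liesOver_root hT.isTree _, liesOver_root hT.isTree _⟩
  have hne : ∀ k, v ≠ T.leaf k := by
    rintro k rfl
    exact hij (hT.leaf_injective (((liesOver_leaf_iff hT).1 hi).trans ((liesOver_leaf_iff hT).1 hj).symm))
  obtain ⟨c, hc, hic⟩ := exists_child_of_liesOver hT.isTree hi (hne i).symm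
  obtain ⟨c', hc', hjc⟩ := exists_child_of_liesOver hT.isTree hj (hne j).symm
  refine ⟨v, c, c', hc, hc', ?_, hic, hjc⟩
  rintro rfl
  exact hc.ne (hv c ⟨hic, hjc⟩ hc.2).symm

/-- Two branching points are comparable, being under the leaf `i`. If one were strictly higher, both
leaves would leave the lower one through the same child. -/
theorem split_unique {i j : Fin n} {v c c' w d d' : T.V} (hc : T.Child v c) (hc' : T.Child v c')
    (hne : c ≠ c') (hic : T.LiesOver (T.leaf i) c) (hjc : T.LiesOver (T.leaf j) c')
    (hd : T.Child w d) (hd' : T.Child w d') (hne' : d ≠ d')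
    (hid : T.LiesOver (T.leaf i) d) (hjd : T.LiesOver (T.leaf j) d') : v = w ∧ c = d ∧ c' = d' := by
  have key : ∀ {v c c' w d d' : T.V}, T.Child v c → T.Child v c' → c ≠ c' →
      T.LiesOver (T.leaf i) c → T.LiesOver (T.leaf j) c' → T.Child w d → T.Child w d' → d ≠ d' →
      T.LiesOver (T.leaf i) d → T.LiesOver (T.leaf j) d' → T.LiesOver v w → v = w := by
    intro v c c' w d d' hc hc' _ hic hjc hd hd' hne' hid hjd hvw
    by_contra h
    obtain ⟨e, he, hve⟩ := exists_child_of_liesOver hT.isTree hvw h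
    have h1 := he.eq_of_liesOver hT.isTree hd
      ((hic.trans hT.isTree hc.2).trans hT.isTree hve) hid
    have h2 := he.eq_of_liesOver hT.isTree hd'
      ((hjc.trans hT.isTree hc'.2).trans hT.isTree hve) hjd
    exact hne' (h1.symm.trans h2)
  have hvw : v = w := by
    rcases (hic.trans hT.isTree hc.2).total hT.isTree (hid.trans hT.isTree hd.2) with h | h
    · exact key hc hc' hne hic hjc hd hd' hne' hid hjd h
    · exact (key hd hd' hne' hid hjd hc hc' hne hic hjc h).symm
  subst hvw
  exact ⟨rfl, hc.eq_of_liesOver hT.isTree hd hic hid, hc'.eq_of_liesOver hT.isTree hd' hjc hjd⟩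

end FTree

/-! ### Branching of leaves -/

open Classical in
/-- For distinct `i` and `j`, the vertex next to the branching point of the leaves `i` and `j`, on
the way to `i`. -/
noncomputable def branch (T : RootedGraph n) (i j : Fin n) : T.V :=
  if h : ∃ c v c', T.Child v c ∧ T.Child v c' ∧ c ≠ c' ∧ T.LiesOver (T.leaf i) c ∧
    T.LiesOver (T.leaf j) c' then h.choose else T.root

/-- Some vertex lies under the leaves `i` and `j` and not under the leaf `k`. -/
def Near (T : RootedGraph n) (i j k : Fin n) : Prop :=
  ∃ v, T.LiesOver (T.leaf i) v ∧ T.LiesOver (T.leaf j) v ∧ ¬T.LiesOver (T.leaf k) v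

section FTree

variable (hT : T.IsFTree)
include hT

theorem branch_eq {i j : Fin n} {v c c' : T.V} (hc : T.Child v c) (hc' : T.Child v c')
    (hne : c ≠ c') (hic : T.LiesOver (T.leaf i) c) (hjc : T.LiesOver (T.leaf j) c') :
    T.branch i j = c := by
  have h : ∃ c v c', T.Child v c ∧ T.Child v c' ∧ c ≠ c' ∧ T.LiesOver (T.leaf i) c ∧
    T.LiesOver (T.leaf j) c' := ⟨c, v, c', hc, hc', hne, hic, hjc⟩
  rw [branch, dif_pos h]
  obtain ⟨w, d', h1, h2, h3, h4, h5⟩ := h.choose_spec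
  exact (split_unique hT h1 h2 h3 h4 h5 hc hc' hne hic hjc).2.1

theorem exists_branch {i j : Fin n} (hij : i ≠ j) : ∃ v, T.Child v (T.branch i j) ∧
    T.Child v (T.branch j i) ∧ T.branch i j ≠ T.branch j i ∧
    T.LiesOver (T.leaf i) (T.branch i j) ∧ T.LiesOver (T.leaf j) (T.branch j i) := by
  obtain ⟨v, c, c', hc, hc', hne, hic, hjc⟩ := exists_split hT hij
  rw [branch_eq hT hc hc' hne hic hjc, branch_eq hT hc' hc hne.symm hjc hic]
  exact ⟨v, hc, hc', hne, hic, hjc⟩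

theorem Child.not_liesOver {v c c' u : T.V} (hc : T.Child v c) (hc' : T.Child v c') (hne : c ≠ c')
    (hu : T.LiesOver u c) : ¬T.LiesOver u c' :=
  fun h => hne (hc.eq_of_liesOver hT.isTree hc' hu h)

/-- Vertices under `i` form a chain, and those not under `k` are the ones over `branch i k`; hence
this lowest one is the only witness that has to be tested. -/
theorem near_iff_liesOver_branch {i j k : Fin n} (hik : i ≠ k) :
    T.Near i j k ↔ T.LiesOver (T.leaf j) (T.branch i k) := by
  obtain ⟨v, h1, h2, h3, h4, h5⟩ := exists_branch hT hik
  constructor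
  · rintro ⟨w, hi, hj, hk⟩
    rcases hi.total hT.isTree (h4.trans hT.isTree h1.2) with h | h
    · by_cases hwv : w = v
      · subst hwv
        exact absurd (h5.trans hT.isTree h2.2) hk
      · obtain ⟨c, hc, hwc⟩ := exists_child_of_liesOver hT.isTree h hwv
        rw [h1.eq_of_liesOver hT.isTree hc h4 (hi.trans hT.isTree hwc)]
        exact hj.trans hT.isTree hwc
    · exact absurd ((h5.trans hT.isTree h2.2).trans hT.isTree h) hk
  · exact fun h => ⟨_, h4, h, h2.not_liesOver hT h1 h3.symm h5⟩

/-- Either the branching points of `i` with `j` and `k` are the same or one is over the other. -/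
theorem branch_eq_or_near {i j k : Fin n} (hij : i ≠ j) (hik : i ≠ k) :
    T.branch i j = T.branch i k ∨ T.Near i j k ∨ T.Near i k j := by
  obtain ⟨v, h1, h2, h3, h4, h5⟩ := exists_branch hT hij
  obtain ⟨w, g1, g2, g3, g4, g5⟩ := exists_branch hT hik
  by_cases hvw : v = w
  · subst hvw
    exact Or.inl (h1.eq_of_liesOver hT.isTree g1 h4 g4)
  · right
    rcases (h4.trans hT.isTree h1.2).total hT.isTree (g4.trans hT.isTree g1.2) with h | h
    · left
      obtain ⟨c, hc, hvc⟩ := exists_child_of_liesOver hT.isTree h hvw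
      rw [near_iff_liesOver_branch hT hik, ← hc.eq_of_liesOver hT.isTree g1
        ((h4.trans hT.isTree h1.2).trans hT.isTree hvc) g4]
      exact (h5.trans hT.isTree h2.2).trans hT.isTree hvc
    · right
      obtain ⟨c, hc, hwc⟩ := exists_child_of_liesOver hT.isTree h (Ne.symm hvw)
      rw [near_iff_liesOver_branch hT hij, ← hc.eq_of_liesOver hT.isTree h1
        ((g4.trans hT.isTree g1.2).trans hT.isTree hwc) h4]
      exact (g5.trans hT.isTree g2.2).trans hT.isTree hwc

theorem not_near_of_branch_eq {i j k : Fin n} (hij : i ≠ j) (hik : i ≠ k)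
    (h : T.branch i j = T.branch i k) : ¬T.Near i j k := by
  rw [near_iff_liesOver_branch hT hik, ← h]
  obtain ⟨v, h1, h2, h3, h4, h5⟩ := exists_branch hT hij
  exact h2.not_liesOver hT h1 h3.symm h5

/-- The two witnesses are comparable, and the leaf over the higher one would also lie over the lower
one. -/
theorem Near.not_near {i j k : Fin n} (h : T.Near i j k) : ¬T.Near i k j := by
  rintro ⟨w, hi, hk, hj⟩
  obtain ⟨v, hi', hj', hk'⟩ := h
  rcases hi.total hT.isTree hi' with h | h
  · exact hk' (hk.trans hT.isTree h)
  · exact hj (hj'.trans hT.isTree h)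

end FTree

end RootedGraph

/-! ### Exclusion relations and their trees -/

/-- Axioms of an exclusion relation, with `R i j k` read as "`i` and `j` are much closer to each
other than `i` and `k`". -/
structure IsExclusion {n : ℕ} (R : Fin n → Fin n → Fin n → Prop) : Prop where
  ne : ∀ {i j k}, R i j k → i ≠ j ∧ i ≠ k ∧ j ≠ k
  symm : ∀ {i j k}, R i j k → R j i k
  left : ∀ {i j k l}, R i j k → R i l k → l ≠ j → R j l k
  trans : ∀ {i j k l}, R i j k → R i k l → R i j l
  of_not : ∀ {i j k l}, R i j k → ¬R i l k → l ≠ i → R i j l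

namespace RootedGraph

variable {n : ℕ} {R : Fin n → Fin n → Fin n → Prop}

section Exclusion

variable (hR : IsExclusion R)
include hR

/-- By `symm` and `left` any element of a member can take the place of `i`, with the same `k`. This
puts intersecting members on a common center. -/
theorem exists_center_of_mem {A : Set (Fin n)} (hA : A ∈ parenthesization R) {c : Fin n}
    (hc : c ∈ A) : ∃ k, A = insert c {j | R c j k} := by
  obtain ⟨a, k, -, rfl⟩ := hA
  refine ⟨k, ?_⟩
  rcases hc with rfl | hc
  · rfl
  have hc : R a c k := hc
  have hca := hR.symm hc
  ext j
  constructor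
  · rintro (rfl | hj)
    · exact Or.inr hca
    · by_cases h : j = c
      · exact Or.inl h
      · exact Or.inr (hR.left hc hj h)
  · rintro (rfl | hj)
    · exact Or.inr hc
    · by_cases h : j = a
      · exact Or.inl h
      · exact Or.inr (hR.left hca hj h)

/-- With a common center `c`, take `j` in `A` only and `m` in `B` only. Then `m` is closer to `c`
than `j` by `of_not`, so by `trans` it belongs to `A`. -/
theorem parenthesization_laminar {A B : Set (Fin n)} (hA : A ∈ parenthesization R)
    (hB : B ∈ parenthesization R) {c : Fin n} (hcA : c ∈ A) (hcB : c ∈ B) : A ⊆ B ∨ B ⊆ A := by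
  obtain ⟨k, rfl⟩ := exists_center_of_mem hR hA hcA
  obtain ⟨l, rfl⟩ := exists_center_of_mem hR hB hcB
  by_contra! h
  obtain ⟨j, hj, hj'⟩ := Set.not_subset.1 h.1
  obtain ⟨m, hm, hm'⟩ := Set.not_subset.1 h.2
  have hjc : j ≠ c := by
    rintro rfl
    exact hj' (Or.inl rfl)
  have hmc : m ≠ c := by
    rintro rfl
    exact hm' (Or.inl rfl)
  have h1 : R c j k := hj.resolve_left hjc
  have h2 : R c m l := hm.resolve_left hmc
  have h3 : R c m j := hR.of_not h2 (fun h => hj' (Or.inr h)) hjc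
  exact hm' (Or.inr (hR.trans h3 h1))

omit hR in
theorem parenthesization_nonempty {A : Set (Fin n)} (hA : A ∈ parenthesization R) : A.Nonempty := by
  obtain ⟨a, k, -, rfl⟩ := hA
  exact ⟨a, Or.inl rfl⟩

/-- No information is lost in passing to the parenthesization; this is how the coordinates are
recovered from the tree. -/
theorem exclusion_iff_exists {i j k : Fin n} (hij : i ≠ j) :
    R i j k ↔ ∃ A ∈ parenthesization R, i ∈ A ∧ j ∈ A ∧ k ∉ A := by
  constructor
  · intro h
    refine ⟨_, ⟨i, k, ⟨j, h⟩, rfl⟩, Or.inl rfl, Or.inr h, ?_⟩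
    rintro (hk | hk)
    · exact (hR.ne h).2.1 hk.symm
    · exact (hR.ne hk).2.2 rfl
  · rintro ⟨A, hA, hi, hj, hk⟩
    obtain ⟨l, rfl⟩ := exists_center_of_mem hR hA hi
    have hj' : R i j l := hj.resolve_left hij.symm
    exact hR.of_not hj' (fun h => hk (Or.inr h)) (fun h => hk (Or.inl h))

end Exclusion

/-- The vertex of the tree of an exclusion relation that belongs to a member of its
parenthesization. -/
def memberVertex (A : parenthesization R) : (ofExclusion R).V := some (Sum.inl A)

/-- The relation "`b` is a child of `a`" by which the tree of an exclusion relation is defined. -/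
def ParenRel (R : Fin n → Fin n → Fin n → Prop) (a b : (ofExclusion R).V) : Prop :=
  match (show Option (parenthesization R ⊕ Fin n) from a),
    (show Option (parenthesization R ⊕ Fin n) from b) with
  | none, some (Sum.inl A) => ∀ B ∈ parenthesization R, A.1 ⊆ B → B = A.1
  | some (Sum.inl B), some (Sum.inl A) => A.1 ⊂ B.1 ∧ ¬∃ C ∈ parenthesization R, A.1 ⊂ C ∧ C ⊂ B.1
  | none, some (Sum.inr i) => ∀ A ∈ parenthesization R, i ∉ A
  | some (Sum.inl A), some (Sum.inr i) => i ∈ A.1 ∧ ∀ B ∈ parenthesization R, i ∈ B → A.1 ⊆ B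
  | _, _ => False

theorem ofExclusion_adj {a b : (ofExclusion R).V} :
    (ofExclusion R).graph.Adj a b ↔ a ≠ b ∧ (ParenRel R a b ∨ ParenRel R b a) := by
  match a, b with
  | none, none => exact SimpleGraph.fromRel_adj _ _ _
  | none, some (Sum.inl _) => exact SimpleGraph.fromRel_adj _ _ _
  | none, some (Sum.inr _) => exact SimpleGraph.fromRel_adj _ _ _
  | some (Sum.inl _), none => exact SimpleGraph.fromRel_adj _ _ _
  | some (Sum.inl _), some (Sum.inl _) => exact SimpleGraph.fromRel_adj _ _ _
  | some (Sum.inl _), some (Sum.inr _) => exact SimpleGraph.fromRel_adj _ _ _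
  | some (Sum.inr _), none => exact SimpleGraph.fromRel_adj _ _ _
  | some (Sum.inr _), some (Sum.inl _) => exact SimpleGraph.fromRel_adj _ _ _
  | some (Sum.inr _), some (Sum.inr _) => exact SimpleGraph.fromRel_adj _ _ _

theorem ofExclusion_cases (a : (ofExclusion R).V) :
    a = (ofExclusion R).root ∨ (∃ A, a = memberVertex A) ∨ ∃ i, a = (ofExclusion R).leaf i := by
  match a with
  | none => exact Or.inl rfl
  | some (Sum.inl A) => exact Or.inr (Or.inl ⟨A, rfl⟩)
  | some (Sum.inr i) => exact Or.inr (Or.inr ⟨i, rfl⟩)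

theorem memberVertex_inj {A B : parenthesization R} :
    memberVertex A = memberVertex B ↔ A.1 = B.1 := by
  refine ⟨fun h => ?_, fun h => congrArg memberVertex (Subtype.ext h)⟩
  have := Sum.inl.inj (Option.some.inj h)
  rw [this]

theorem memberVertex_ne_root (A : parenthesization R) : memberVertex A ≠ (ofExclusion R).root :=
  fun h => Option.some_ne_none _ h

theorem ofExclusion_leaf_ne_root (i : Fin n) : (ofExclusion R).leaf i ≠ (ofExclusion R).root :=
  fun h => Option.some_ne_none _ h

theorem memberVertex_ne_leaf (A : parenthesization R) (i : Fin n) :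
    memberVertex A ≠ (ofExclusion R).leaf i :=
  fun h => Sum.inl_ne_inr (Option.some.inj h)

section Exclusion

variable (hR : IsExclusion R)
include hR

/-- The path to the root from a member of a parenthesization. -/
theorem exists_path_of_mem (A : Set (Fin n)) (hA : A ∈ parenthesization R) :
    ∃ p : (ofExclusion R).graph.Walk (memberVertex ⟨A, hA⟩) (ofExclusion R).root, p.IsPath ∧
      (∀ B : parenthesization R, memberVertex B ∈ p.support ↔ A ⊆ B.1) ∧
      ∀ i : Fin n, (ofExclusion R).leaf i ∉ p.support := by
  by_cases h : ∀ B ∈ parenthesization R, A ⊆ B → B = A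
  · have hadj : (ofExclusion R).graph.Adj (memberVertex ⟨A, hA⟩) (ofExclusion R).root :=
      ofExclusion_adj.2 ⟨memberVertex_ne_root _, Or.inr h⟩
    refine ⟨SimpleGraph.Walk.nil.cons hadj, ?_, fun B => ?_, fun i => ?_⟩
    · simpa using memberVertex_ne_root _
    · simp only [SimpleGraph.Walk.support_cons, SimpleGraph.Walk.support_nil, List.mem_cons,
        memberVertex_inj, memberVertex_ne_root, List.not_mem_nil, or_false]
      exact ⟨fun e => e ▸ subset_rfl, fun e => h _ B.2 e⟩
    · simp [(memberVertex_ne_leaf _ i).symm, ofExclusion_leaf_ne_root]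
  · push Not at h
    -- The path continues with the smallest member strictly containing `A`; laminarity makes every
    -- other such member contain `B`. The sizes increase and are at most `n`, so the recursion ends.
    obtain ⟨B, ⟨hB, hAB⟩, hmin⟩ := (Set.toFinite
      {B | B ∈ parenthesization R ∧ A ⊂ B}).exists_minimal
        (let ⟨B, hB, hAB, hne⟩ := h; ⟨B, hB, hAB.ssubset_of_ne hne.symm⟩)
    obtain ⟨p, hp, h1, h2⟩ := exists_path_of_mem B hB
    have hadj : (ofExclusion R).graph.Adj (memberVertex ⟨A, hA⟩) (memberVertex ⟨B, hB⟩) := by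
      refine ofExclusion_adj.2 ⟨fun e => hAB.ne (memberVertex_inj.1 e), Or.inr ⟨hAB, ?_⟩⟩
      rintro ⟨C, hC, hAC, hCB⟩
      exact hCB.not_subset (hmin ⟨hC, hAC⟩ hCB.subset)
    refine ⟨p.cons hadj, hp.cons fun h3 => hAB.not_subset ((h1 _).1 h3), fun C => ?_, fun i => ?_⟩
    · rw [SimpleGraph.Walk.support_cons, List.mem_cons, h1 C, memberVertex_inj]
      constructor
      · rintro (e | e)
        · exact e ▸ subset_rfl
        · exact hAB.subset.trans e
      · intro hAC
        by_cases hCA : C.1 = A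
        · exact Or.inl hCA
        right
        obtain ⟨a, ha⟩ := parenthesization_nonempty hA
        rcases parenthesization_laminar hR hB C.2 (hAB.subset ha) (hAC ha) with e | e
        · exact e
        · exact hmin ⟨C.2, hAC.ssubset_of_ne (Ne.symm hCA)⟩ e
    · simp [h2 i, (memberVertex_ne_leaf _ i).symm]
termination_by n - A.ncard
decreasing_by
  have h3 := Set.ncard_lt_ncard hAB (Set.toFinite B)
  have h4 := Set.ncard_le_ncard (Set.subset_univ B) (Set.toFinite _)
  rw [Set.ncard_univ, Nat.card_eq_fintype_card, Fintype.card_fin] at h4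
  omega

/-- The path to the root from a leaf, in the tree of an exclusion relation. -/
theorem exists_path_of_leaf (i : Fin n) :
    ∃ p : (ofExclusion R).graph.Walk ((ofExclusion R).leaf i) (ofExclusion R).root, p.IsPath ∧
      ∀ B : parenthesization R, memberVertex B ∈ p.support ↔ i ∈ B.1 := by
  by_cases h : ∀ A ∈ parenthesization R, i ∉ A
  · have hadj : (ofExclusion R).graph.Adj ((ofExclusion R).leaf i) (ofExclusion R).root :=
      ofExclusion_adj.2 ⟨ofExclusion_leaf_ne_root _, Or.inr h⟩
    refine ⟨SimpleGraph.Walk.nil.cons hadj, ?_, fun B => ?_⟩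
    · simpa using ofExclusion_leaf_ne_root _
    · simpa [memberVertex_ne_leaf, memberVertex_ne_root] using h B.1 B.2
  · push Not at h
    obtain ⟨B, ⟨hB, hiB⟩, hmin⟩ := (Set.toFinite
      {B | B ∈ parenthesization R ∧ i ∈ B}).exists_minimal h
    have hmin' : ∀ C ∈ parenthesization R, i ∈ C → B ⊆ C := fun C hC hiC =>
      (parenthesization_laminar hR hB hC hiB hiC).elim id fun e => hmin ⟨hC, hiC⟩ e
    obtain ⟨p, hp, h1, h2⟩ := exists_path_of_mem hR B hB
    have hadj : (ofExclusion R).graph.Adj ((ofExclusion R).leaf i) (memberVertex ⟨B, hB⟩) :=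
      ofExclusion_adj.2 ⟨(memberVertex_ne_leaf _ i).symm, Or.inr ⟨hiB, hmin'⟩⟩
    refine ⟨p.cons hadj, hp.cons (h2 i), fun C => ?_⟩
    rw [SimpleGraph.Walk.support_cons, List.mem_cons, h1 C]
    simp only [memberVertex_ne_leaf, false_or]
    exact ⟨fun e => e hiB, hmin' C.1 C.2⟩

end Exclusion

/-- The inclusion of a rooted graph into the one with a new root. -/
def inclAddRoot {G : RootedGraph n} (v : G.V) : G.addRoot.V := some v

theorem addRoot_adj_incl {G : RootedGraph n} {v w : G.V} :
    G.addRoot.graph.Adj (inclAddRoot v) (inclAddRoot w) ↔ G.graph.Adj v w := by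
  refine (SimpleGraph.fromRel_adj _ _ _).trans ⟨?_, fun h => ⟨fun e => ?_, Or.inl h⟩⟩
  · rintro ⟨-, h | h⟩
    · exact h
    · exact SimpleGraph.Adj.symm h
  · exact h.ne (Option.some.inj e)

theorem addRoot_adj_root {G : RootedGraph n} {v : G.V} :
    G.addRoot.graph.Adj G.addRoot.root (inclAddRoot v) ↔ v = G.root := by
  refine (SimpleGraph.fromRel_adj _ _ _).trans ⟨?_, fun h => ⟨fun e => ?_, Or.inl h⟩⟩
  · rintro ⟨-, h | h⟩
    · exact h
    · exact absurd h id
  · exact Option.some_ne_none _ e.symm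

theorem inclAddRoot_injective {G : RootedGraph n} :
    Function.Injective (inclAddRoot : G.V → G.addRoot.V) :=
  Option.some_injective _

theorem inclAddRoot_ne_root {G : RootedGraph n} (v : G.V) : inclAddRoot v ≠ G.addRoot.root :=
  Option.some_ne_none v

theorem addRoot_cases {G : RootedGraph n} (a : G.addRoot.V) :
    a = G.addRoot.root ∨ ∃ v, a = inclAddRoot v := by
  match a with
  | none => exact Or.inl rfl
  | some v => exact Or.inr ⟨v, rfl⟩

theorem exists_path_addRoot {G : RootedGraph n} {a : G.V} (p : G.graph.Walk a G.root)
    (hp : p.IsPath) : ∃ q : G.addRoot.graph.Walk (inclAddRoot a) G.addRoot.root, q.IsPath ∧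
      ∀ b : G.V, inclAddRoot b ∈ q.support ↔ b ∈ p.support := by
  have hadj : G.addRoot.graph.Adj (inclAddRoot G.root) G.addRoot.root :=
    (addRoot_adj_root.2 rfl).symm
  let φ : G.graph →g G.addRoot.graph := ⟨inclAddRoot, addRoot_adj_incl.2⟩
  have hφ : ∀ v, φ v = inclAddRoot v := fun _ => rfl
  have hinj : Function.Injective φ := inclAddRoot_injective
  refine ⟨(p.map φ).concat hadj, ?_, fun b => ?_⟩
  · refine SimpleGraph.Walk.IsPath.concat (hp.map hinj) ?_ hadj
    simp [hφ, inclAddRoot_ne_root]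
  · simp [SimpleGraph.Walk.support_concat, SimpleGraph.Walk.support_map, hφ,
      inclAddRoot_injective.eq_iff, inclAddRoot_ne_root]

theorem liesOver_iso {T T' : RootedGraph n} (hT : T.graph.IsTree) (e : T'.graph ≃g T.graph)
    (hroot : e T'.root = T.root) {v w : T'.V} {p : T'.graph.Walk v T'.root} (hp : p.IsPath) :
    T.LiesOver (e v) (e w) ↔ w ∈ p.support := by
  have hq : ((p.map e.toHom).copy rfl hroot).IsPath := by
    rw [SimpleGraph.Walk.isPath_copy]
    exact hp.map e.injective
  change T.LiesOver (e.toHom v) (e w) ↔ _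
  rw [liesOver_iff_mem_support hT hq]
  simp only [SimpleGraph.Walk.support_copy, SimpleGraph.Walk.support_map, List.mem_map]
  constructor
  · rintro ⟨u, hu, h⟩
    exact e.injective h ▸ hu
  · exact fun h => ⟨w, h, rfl⟩

/-- The set of leaves over a vertex. -/
def leafSet (T : RootedGraph n) (v : T.V) : Set (Fin n) := {i | T.LiesOver (T.leaf i) v}

theorem leafSet_leaf {T : RootedGraph n} (hT : T.IsFTree) (i : Fin n) :
    T.leafSet (T.leaf i) = {i} := by
  ext j
  rw [leafSet, Set.mem_ofPred_eq, liesOver_leaf_iff hT, hT.leaf_injective.eq_iff,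
    Set.mem_singleton_iff]

/-- The sets of leaves over the vertices of the tree of an exclusion relation. -/
theorem exists_leafSet_iff_of_iso {T : RootedGraph n} (hT : T.IsFTree) (hR : IsExclusion R)
    (h : (ofExclusion R).Iso T) {Q : Set (Fin n) → Prop} (hQ : ∀ i, ¬Q {i}) :
    (∃ v, v ≠ T.root ∧ Q (T.leafSet v)) ↔ ∃ A ∈ parenthesization R, Q A := by
  obtain ⟨e, hroot, hleaf⟩ := h
  have key : ∀ B : parenthesization R, T.leafSet (e (memberVertex B)) = B.1 := by
    intro B
    ext i
    obtain ⟨p, hp, hpB⟩ := exists_path_of_leaf hR i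
    rw [← hpB B, ← liesOver_iso hT.isTree e hroot hp, hleaf]
    rfl
  constructor
  · rintro ⟨v, hv, hQv⟩
    obtain ⟨a, rfl⟩ := e.surjective v
    rcases ofExclusion_cases a with rfl | ⟨B, rfl⟩ | ⟨i, rfl⟩
    · exact absurd hroot hv
    · exact ⟨B.1, B.2, key B ▸ hQv⟩
    -- Leaves have singleton leaf sets, which need not be members of the parenthesization; `hQ`
    -- discards them.
    · rw [hleaf, leafSet_leaf hT] at hQv
      exact absurd hQv (hQ i)
  · rintro ⟨A, hA, hQA⟩
    refine ⟨e (memberVertex ⟨A, hA⟩), ?_, (key ⟨A, hA⟩).symm ▸ hQA⟩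
    rw [← hroot, e.injective.ne_iff]
    exact memberVertex_ne_root _

/-- The old root has become a non-root vertex, and it contributes the full set of leaves. -/
theorem exists_leafSet_iff_of_iso_addRoot {T : RootedGraph n} (hT : T.IsFTree)
    (hR : IsExclusion R) (h : (ofExclusion R).addRoot.Iso T) {Q : Set (Fin n) → Prop}
    (hQ : ∀ i, ¬Q {i}) :
    (∃ v, v ≠ T.root ∧ Q (T.leafSet v)) ↔ Q Set.univ ∨ ∃ A ∈ parenthesization R, Q A := by
  obtain ⟨e, hroot, hleaf⟩ := h
  have hleaf' : ∀ i, e (inclAddRoot ((ofExclusion R).leaf i)) = T.leaf i := hleaf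
  have key : ∀ B : parenthesization R, T.leafSet (e (inclAddRoot (memberVertex B))) = B.1 := by
    intro B
    ext i
    obtain ⟨p, hp, hpB⟩ := exists_path_of_leaf hR i
    obtain ⟨q, hq, hqp⟩ := exists_path_addRoot p hp
    rw [← hpB B, ← hqp, ← liesOver_iso hT.isTree e hroot hq, hleaf']
    rfl
  have key' : T.leafSet (e (inclAddRoot (ofExclusion R).root)) = Set.univ := by
    refine Set.eq_univ_of_forall fun i => ?_
    obtain ⟨p, hp, hpB⟩ := exists_path_of_leaf hR i
    obtain ⟨q, hq, hqp⟩ := exists_path_addRoot p hp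
    have h1 := (liesOver_iso hT.isTree e hroot hq).2 ((hqp _).2 p.end_mem_support)
    rwa [hleaf'] at h1
  have hne : ∀ a, e (inclAddRoot a) ≠ T.root := by
    intro a
    rw [← hroot, e.injective.ne_iff]
    exact inclAddRoot_ne_root a
  constructor
  · rintro ⟨v, hv, hQv⟩
    obtain ⟨a, rfl⟩ := e.surjective v
    rcases addRoot_cases a with rfl | ⟨a, rfl⟩
    · exact absurd hroot hv
    rcases ofExclusion_cases a with rfl | ⟨B, rfl⟩ | ⟨i, rfl⟩
    · exact Or.inl (key' ▸ hQv)
    · exact Or.inr ⟨B.1, B.2, key B ▸ hQv⟩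
    · rw [hleaf', leafSet_leaf hT] at hQv
      exact absurd hQv (hQ i)
  · rintro (hQA | ⟨A, hA, hQA⟩)
    · exact ⟨_, hne _, key'.symm ▸ hQA⟩
    · exact ⟨_, hne _, (congrArg Q (key ⟨A, hA⟩)).mpr hQA⟩

end RootedGraph

/-! ### Reconstruction of an `f`-tree from its leaf sets -/

namespace RootedGraph

variable {n : ℕ} {R : Fin n → Fin n → Fin n → Prop} {T : RootedGraph n}

theorem exists_ne_leafSet (hT : T.IsFTree) {v : T.V} (hv : T.IsInternal v) :
    ∃ i j, i ≠ j ∧ i ∈ T.leafSet v ∧ j ∈ T.leafSet v := by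
  obtain ⟨c, c', hc, hc', hne⟩ := exists_children_of_isInternal hT hv
  obtain ⟨i, hi⟩ := exists_leaf_liesOver hT (hc.ne_root hT.isTree)
  obtain ⟨j, hj⟩ := exists_leaf_liesOver hT (hc'.ne_root hT.isTree)
  refine ⟨i, j, ?_, hi.trans hT.isTree hc.2, hj.trans hT.isTree hc'.2⟩
  rintro rfl
  exact hc.not_liesOver hT hc' hne hi hj

/-- If `w` were strictly over `v` with no fewer leaves, all leaves over `v` would pass through one
child of `v`. But `v` has two children, as it is not bivalent. -/
theorem liesOver_iff_leafSet_subset (hT : T.IsFTree) {v w : T.V} (hv : v ≠ T.root) :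
    T.LiesOver v w ↔ T.leafSet v ⊆ T.leafSet w := by
  refine ⟨fun h i hi => LiesOver.trans hT.isTree hi h, fun h => ?_⟩
  obtain ⟨i, hi⟩ := exists_leaf_liesOver hT hv
  rcases hi.total hT.isTree (h hi) with e | e
  · exact e
  by_cases hwv : w = v
  · exact hwv ▸ e
  obtain ⟨c, hc, hwc⟩ := exists_child_of_liesOver hT.isTree e hwv
  obtain ⟨c₁, c₂, h₁, h₂, hne⟩ := exists_children_of_isInternal hT
    ((hc.root_or_isInternal hT).resolve_left hv)
  have key : ∀ {c'}, T.Child v c' → c' = c := by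
    intro c' hc'
    obtain ⟨j, hj⟩ := exists_leaf_liesOver hT (hc'.ne_root hT.isTree)
    exact hc'.eq_of_liesOver hT.isTree hc hj
      (LiesOver.trans hT.isTree (h (hj.trans hT.isTree hc'.2)) hwc)
  exact absurd ((key h₁).trans (key h₂).symm) hne

theorem leafSet_inj (hT : T.IsFTree) {v w : T.V} (hv : v ≠ T.root) (hw : w ≠ T.root) :
    T.leafSet v = T.leafSet w ↔ v = w :=
  ⟨fun h => LiesOver.antisymm hT.isTree ((liesOver_iff_leafSet_subset hT hv).2 h.subset)
    ((liesOver_iff_leafSet_subset hT hw).2 h.symm.subset), fun h => h ▸ rfl⟩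

/-- The set formed by `i` and the leaves nearer to it than `k` is the leaf set of the child towards
`i` at the branching point of `i` and `k`. Full leaf sets do not arise, as `k` is always left out.
-/
theorem parenthesization_near (hT : T.IsFTree)
    (h : ∀ i j k, R i j k ↔ (i ≠ j ∧ i ≠ k ∧ j ≠ k) ∧ T.Near i j k) (A : Set (Fin n)) :
    A ∈ parenthesization R ↔ ∃ v, T.IsInternal v ∧ T.leafSet v = A ∧ A ≠ Set.univ := by
  have key : ∀ {v c c' : T.V} {i k : Fin n}, T.Child v c → T.Child v c' → c ≠ c' →
      T.LiesOver (T.leaf i) c → T.LiesOver (T.leaf k) c' →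
      insert i {j | R i j k} = T.leafSet c := by
    intro v c c' i k hc hc' hne hic hkc
    have hik : i ≠ k := by
      rintro rfl
      exact hc.not_liesOver hT hc' hne hic hkc
    ext j
    simp only [Set.mem_insert_iff, Set.mem_ofPred_eq, leafSet, h, near_iff_liesOver_branch hT hik,
      branch_eq hT hc hc' hne hic hkc]
    constructor
    · rintro (rfl | h)
      · exact hic
      · exact h.2
    · intro hj
      by_cases hji : j = i
      · exact Or.inl hji
      · refine Or.inr ⟨⟨Ne.symm hji, hik, ?_⟩, hj⟩
        rintro rfl
        exact hc.not_liesOver hT hc' hne hj hkc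
  constructor
  · rintro ⟨i, k, ⟨j, hj⟩, rfl⟩
    obtain ⟨⟨hij, hik, hjk⟩, hnear⟩ := (h i j k).1 hj
    obtain ⟨v, h1, h2, h3, h4, h5⟩ := exists_branch hT hik
    refine ⟨T.branch i k, ⟨h1.ne_root hT.isTree, ?_⟩, (key h1 h2 h3 h4 h5).symm, ?_⟩
    · rintro ⟨l, hl⟩
      rw [near_iff_liesOver_branch hT hik, ← hl, liesOver_leaf_iff hT] at hnear
      rw [← hl, liesOver_leaf_iff hT] at h4
      exact hij (hT.leaf_injective (h4.trans hnear.symm))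
    · rw [key h1 h2 h3 h4 h5]
      intro e
      exact h2.not_liesOver hT h1 h3.symm h5 (e.symm ▸ Set.mem_univ k : k ∈ T.leafSet _)
  · rintro ⟨v, hv, rfl, hne⟩
    obtain ⟨u, hu⟩ := exists_parent hT.isTree hv.1
    obtain ⟨i, j, hij, hi, hj⟩ := exists_ne_leafSet hT hv
    -- A sibling exists: an only child of the root would carry all leaves, and an internal parent
    -- has two children. Any leaf over the sibling serves as `k`.
    obtain ⟨v', hv', hvv'⟩ : ∃ v', T.Child u v' ∧ v ≠ v' := by
      by_contra! hcon
      rcases hu.root_or_isInternal hT with rfl | hu'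
      · refine hne (Set.eq_univ_of_forall fun k => ?_)
        obtain ⟨c, hc, hkc⟩ := exists_child_of_liesOver hT.isTree
          (liesOver_root hT.isTree (T.leaf k)) (leaf_ne_root hT k)
        exact hcon c hc ▸ hkc
      · obtain ⟨c, c', hc, hc', hcc⟩ := exists_children_of_isInternal hT hu'
        exact hcc ((hcon c hc).symm.trans (hcon c' hc'))
    obtain ⟨k, hk⟩ := exists_leaf_liesOver hT (hv'.ne_root hT.isTree)
    have hset := key hu hv' hvv' hi hk
    refine ⟨i, k, ⟨j, ?_⟩, hset.symm⟩
    rw [← hset] at hj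
    exact hj.resolve_left hij.symm

theorem ofExclusion_forall {p : (ofExclusion R).V → Prop} : (∀ a, p a) ↔
    p (ofExclusion R).root ∧ (∀ A, p (memberVertex A)) ∧ ∀ i, p ((ofExclusion R).leaf i) := by
  refine ⟨fun h => ⟨h _, fun _ => h _, fun _ => h _⟩, fun h a => ?_⟩
  rcases ofExclusion_cases a with rfl | ⟨A, rfl⟩ | ⟨i, rfl⟩
  exacts [h.1, h.2.1 A, h.2.2 i]

/-- The part of an `f`-tree over a vertex `r` is the tree of the family of leaf sets of the
internal vertices over `r`. -/
theorem exists_equiv_ofExclusion (hT : T.IsFTree) (hR : IsExclusion R) {r : T.V}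
    (hr : ∀ v, v ≠ T.root → T.LiesOver v r) (hr' : r ∉ Set.range T.leaf)
    (hP : ∀ A, A ∈ parenthesization R ↔ ∃ v, (T.IsInternal v ∧ v ≠ r) ∧ T.leafSet v = A) :
    ∃ g : (ofExclusion R).V → T.V, Function.Injective g ∧ Set.range g = {v | T.LiesOver v r} ∧
      g (ofExclusion R).root = r ∧ (∀ i, g ((ofExclusion R).leaf i) = T.leaf i) ∧
      ∀ a b, T.graph.Adj (g a) (g b) ↔ (ofExclusion R).graph.Adj a b := by
  obtain ⟨g, hg1, hg2, hg3⟩ : ∃ g : (ofExclusion R).V → T.V, g (ofExclusion R).root = r ∧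
      (∀ A : parenthesization R, (T.IsInternal (g (memberVertex A)) ∧ g (memberVertex A) ≠ r) ∧
        T.leafSet (g (memberVertex A)) = A.1) ∧
      ∀ i, g ((ofExclusion R).leaf i) = T.leaf i := by
    choose f hf using fun A : parenthesization R => (hP A.1).1 A.2
    exact ⟨fun a => match a with
      | none => r
      | some (Sum.inl A) => f A
      | some (Sum.inr i) => T.leaf i, rfl, hf, fun _ => rfl⟩
  have hT' := hT.isTree
  have m1 : ∀ A, g (memberVertex A) ≠ r := fun A => (hg2 A).1.2
  have m2 : ∀ A, g (memberVertex A) ≠ T.root := fun A => (hg2 A).1.1.1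
  have m3 : ∀ A i, g (memberVertex A) ≠ T.leaf i := fun A i e => (hg2 A).1.1.2 ⟨i, e.symm⟩
  have m4 : ∀ i, T.leaf i ≠ r := fun i e => hr' ⟨i, e⟩
  have m5 : ∀ A B, g (memberVertex A) = g (memberVertex B) ↔ A.1 = B.1 := fun A B => by
    rw [← leafSet_inj hT (m2 A) (m2 B), (hg2 A).2, (hg2 B).2]
  have o1 : ∀ A, T.LiesOver (g (memberVertex A)) r := fun A => hr _ (m2 A)
  have o2 : ∀ i, T.LiesOver (T.leaf i) r := fun i => hr _ (leaf_ne_root hT i)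
  have o3 : ∀ A, ¬T.LiesOver r (g (memberVertex A)) := fun A h => m1 A ((o1 A).antisymm hT' h)
  have o4 : ∀ i, ¬T.LiesOver r (T.leaf i) := fun i h => m4 i ((o2 i).antisymm hT' h)
  have o5 : ∀ A B, T.LiesOver (g (memberVertex A)) (g (memberVertex B)) ↔ A.1 ⊆ B.1 := fun A B => by
    rw [liesOver_iff_leafSet_subset hT (m2 A), (hg2 A).2, (hg2 B).2]
  have o6 : ∀ i A, T.LiesOver (T.leaf i) (g (memberVertex A)) ↔ i ∈ A.1 := fun i A => by
    rw [← (hg2 A).2]; rfl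
  have o7 : ∀ A i, ¬T.LiesOver (g (memberVertex A)) (T.leaf i) := fun A i h =>
    m3 A i ((liesOver_leaf_iff hT).1 h)
  have hrange : Set.range g = {v | T.LiesOver v r} := by
    ext v
    constructor
    · rintro ⟨a, rfl⟩
      rcases ofExclusion_cases a with rfl | ⟨A, rfl⟩ | ⟨i, rfl⟩
      · rw [hg1]; exact liesOver_refl hT' r
      · exact o1 A
      · rw [hg3]; exact o2 i
    · intro hv
      by_cases h1 : v = r
      · exact ⟨_, hg1.trans h1.symm⟩
      by_cases h2 : v ∈ Set.range T.leaf
      · obtain ⟨i, rfl⟩ := h2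
        exact ⟨_, hg3 i⟩
      have h3 : v ≠ T.root := by
        rintro rfl
        exact h1 (LiesOver.antisymm hT' hv (liesOver_root hT' r))
      have h4 : T.leafSet v ∈ parenthesization R := (hP _).2 ⟨v, ⟨⟨h3, h2⟩, h1⟩, rfl⟩
      exact ⟨memberVertex ⟨_, h4⟩, (leafSet_inj hT (m2 _) h3).1 (hg2 _).2⟩
  have hinj : Function.Injective g := by
    intro a b h
    rcases ofExclusion_cases a with rfl | ⟨A, rfl⟩ | ⟨i, rfl⟩ <;>
    rcases ofExclusion_cases b with rfl | ⟨B, rfl⟩ | ⟨j, rfl⟩ <;>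
    try simp only [hg1, hg3] at h
    · rfl
    · exact absurd h.symm (m1 B)
    · exact absurd h.symm (m4 j)
    · exact absurd h (m1 A)
    · exact memberVertex_inj.2 ((m5 A B).1 h)
    · exact absurd h (m3 A j)
    · exact absurd h (m4 i)
    · exact absurd h.symm (m3 B i)
    · rw [hT.leaf_injective h]
  -- Intermediate vertices need only be sought in the range of `g`, which contains everything over
  -- `r`.
  have hcov : ∀ a b, T.Child (g a) (g b) ↔ T.LiesOver (g b) (g a) ∧ g b ≠ g a ∧
      ∀ u, T.LiesOver (g b) (g u) → T.LiesOver (g u) (g a) → g u = g b ∨ g u = g a := by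
    intro a b
    rw [child_iff_covers hT']
    refine and_congr_right fun _ => and_congr_right fun _ => ⟨fun h u => h (g u), fun h u hbu hua => ?_⟩
    have hur : T.LiesOver u r :=
      hua.trans hT' (hrange.subset (Set.mem_range_self a))
    obtain ⟨u', rfl⟩ := hrange.superset hur
    exact h u' hbu hua
  -- The order statements above translate the covering condition into inclusion and membership, case
  -- by case for root, members and leaves.
  have hrel : ∀ a b, ParenRel R a b ↔ T.Child (g a) (g b) := by
    intro a b
    rcases ofExclusion_cases a with rfl | ⟨A, rfl⟩ | ⟨i, rfl⟩ <;>
    rcases ofExclusion_cases b with rfl | ⟨B, rfl⟩ | ⟨j, rfl⟩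
    · exact iff_of_false id fun h => h.ne rfl
    · refine Iff.trans (b := ∀ C ∈ parenthesization R, B.1 ⊆ C → C = B.1) Iff.rfl ?_
      rw [hcov, ofExclusion_forall]
      simp only [ne_eq, hg1, hg3, o1, m1, o5, o7, m5, true_and, not_false_eq_true,
        forall_true_left, or_false, or_true, implies_true, false_imp_iff, and_true, Subtype.forall]
    · refine Iff.trans (b := ∀ C ∈ parenthesization R, j ∉ C) Iff.rfl ?_
      rw [hcov, ofExclusion_forall]
      simp only [ne_eq, hg1, hg3, o1, o2, m1, m3, m4, o6, true_and, not_false_eq_true, or_false,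
        or_true, implies_true, liesOver_leaf_iff hT, hT.leaf_injective.eq_iff, Subtype.forall,
        true_imp_iff, imp_false]
      simp +contextual
    · refine iff_of_false id fun h => o3 A (hg1 ▸ h.2)
    · refine Iff.trans (b := B.1 ⊂ A.1 ∧ ¬∃ C ∈ parenthesization R, B.1 ⊂ C ∧ C ⊂ A.1) Iff.rfl ?_
      rw [hcov, ofExclusion_forall]
      simp only [ne_eq, hg1, hg3, o1, o3, o5, o7, m5, false_imp_iff,
        imp_true_iff, true_and, and_true, Subtype.forall]
      constructor
      · rintro ⟨h1, h2⟩
        refine ⟨h1.subset, h1.ne, fun C hC hBC hCA => ?_⟩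
        by_contra! h3
        exact h2 ⟨C, hC, hBC.ssubset_of_ne h3.1.symm, hCA.ssubset_of_ne h3.2⟩
      · rintro ⟨h1, h2, h3⟩
        refine ⟨h1.ssubset_of_ne h2, ?_⟩
        rintro ⟨C, hC, hBC, hCA⟩
        rcases h3 C hC hBC.subset hCA.subset with e | e
        · exact hBC.ne e.symm
        · exact hCA.ne e
    · refine Iff.trans (b := j ∈ A.1 ∧ ∀ C ∈ parenthesization R, j ∈ C → A.1 ⊆ C) Iff.rfl ?_
      rw [hcov, ofExclusion_forall]
      simp only [ne_eq, hg1, hg3, o2, o3, m3, o5, o6, m5, false_imp_iff,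
        imp_true_iff, true_and, liesOver_leaf_iff hT, hT.leaf_injective.eq_iff, Subtype.forall,
        false_or, or_false, (m3 A _).symm, not_false_eq_true]
      constructor
      · rintro ⟨h1, h2⟩
        exact ⟨h1, fun C hC hjC hCA => hCA.antisymm (h2 C hC hjC), fun i e _ => e.symm⟩
      · rintro ⟨h1, h2, -⟩
        refine ⟨h1, fun C hC hjC => ?_⟩
        rcases parenthesization_laminar hR A.2 hC h1 hjC with e | e
        · exact e
        · exact (h2 C hC hjC e).symm.subset
    · exact iff_of_false id fun h => not_child_leaf hT i _ (hg3 i ▸ h)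
    · exact iff_of_false id fun h => not_child_leaf hT i _ (hg3 i ▸ h)
    · exact iff_of_false id fun h => not_child_leaf hT i _ (hg3 i ▸ h)
  refine ⟨g, hinj, hrange, hg1, hg3, fun a b => ?_⟩
  rw [ofExclusion_adj, hrel, hrel]
  constructor
  · intro h
    exact ⟨fun e => h.ne (congrArg g e), child_or_child_of_adj hT' h⟩
  · rintro ⟨-, h | h⟩
    · exact h.1
    · exact h.1.symm

/-- Every internal vertex has a proper leaf set, so none is missing from the parenthesization and
`r` can be the root. -/
theorem iso_ofExclusion (hT : T.IsFTree) (hR : IsExclusion R)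
    (h : ∀ i j k, R i j k ↔ (i ≠ j ∧ i ≠ k ∧ j ≠ k) ∧ T.Near i j k)
    (hne : ∀ v, T.IsInternal v → T.leafSet v ≠ Set.univ) : (ofExclusion R).Iso T := by
  have hP : ∀ A, A ∈ parenthesization R ↔
      ∃ v, (T.IsInternal v ∧ v ≠ T.root) ∧ T.leafSet v = A := by
    intro A
    rw [parenthesization_near hT h]
    constructor
    · rintro ⟨v, hv, hA, -⟩
      exact ⟨v, ⟨hv, hv.1⟩, hA⟩
    · rintro ⟨v, hv, rfl⟩
      exact ⟨v, hv.1, rfl, hne v hv.1⟩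
  obtain ⟨g, hinj, hrange, hroot, hleaf, hadj⟩ := exists_equiv_ofExclusion hT hR
    (r := T.root) (fun v _ => liesOver_root hT.isTree v)
    (fun ⟨i, hi⟩ => leaf_ne_root hT i hi) hP
  have hsurj : Function.Surjective g := fun v => hrange.superset (liesOver_root hT.isTree v)
  exact ⟨⟨Equiv.ofBijective g ⟨hinj, hsurj⟩, hadj _ _⟩, hroot, hleaf⟩

/-- The vertex `r` carries all leaves, so it is the one internal vertex missing from the
parenthesization. It becomes the old root, and the root of `T`, whose only neighbour is `r`, becomes
the new one. -/
theorem iso_addRoot_ofExclusion (hT : T.IsFTree) (hR : IsExclusion R)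
    (h : ∀ i j k, R i j k ↔ (i ≠ j ∧ i ≠ k ∧ j ≠ k) ∧ T.Near i j k) {r : T.V}
    (hr : T.IsInternal r) (hr' : ∀ v, v ≠ T.root → T.LiesOver v r) :
    (ofExclusion R).addRoot.Iso T := by
  have hT' := hT.isTree
  have huniv : T.leafSet r = Set.univ :=
    Set.eq_univ_of_forall fun i => hr' _ (leaf_ne_root hT i)
  have hP : ∀ A, A ∈ parenthesization R ↔ ∃ v, (T.IsInternal v ∧ v ≠ r) ∧ T.leafSet v = A := by
    intro A
    rw [parenthesization_near hT h]
    constructor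
    · rintro ⟨v, hv, rfl, hA⟩
      exact ⟨v, ⟨hv, fun e => hA (e ▸ huniv)⟩, rfl⟩
    · rintro ⟨v, hv, rfl⟩
      refine ⟨v, hv.1, rfl, fun e => hv.2 ?_⟩
      exact (leafSet_inj hT hv.1.1 hr.1).1 (e.trans huniv.symm)
  obtain ⟨g, hinj, hrange, hroot, hleaf, hadj⟩ := exists_equiv_ofExclusion hT hR hr' hr.2 hP
  have hnr : ∀ a, g a ≠ T.root := by
    intro a e
    have h1 : T.LiesOver (g a) r := hrange.subset (Set.mem_range_self a)
    rw [e] at h1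
    exact hr.1 (LiesOver.antisymm hT' (liesOver_root hT' r) h1)
  have hchild : ∀ v, T.graph.Adj T.root v ↔ v = r := by
    intro v
    constructor
    · intro hv
      have hv' : T.Child T.root v := ⟨hv, liesOver_root hT' v⟩
      have h1 := hr' v (hv'.ne_root hT')
      rcases (hv'.liesOver_iff hT').1 h1 with e | e
      · exact e.symm
      · exact absurd (LiesOver.antisymm hT' (liesOver_root hT' r) e) hr.1
    · rintro rfl
      obtain ⟨u, hu⟩ := exists_parent hT' hr.1
      have : u = T.root := by
        by_contra hne
        exact hu.ne ((hr' u hne).antisymm hT' hu.2)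
      exact this ▸ hu.1
  obtain ⟨f, hf1, hf2⟩ : ∃ f : (ofExclusion R).addRoot.V → T.V,
      f (ofExclusion R).addRoot.root = T.root ∧ ∀ a, f (inclAddRoot a) = g a :=
    ⟨fun a => match a with
      | none => T.root
      | some a => g a, rfl, fun _ => rfl⟩
  have hfinj : Function.Injective f := by
    intro a b e
    rcases addRoot_cases a with rfl | ⟨a, rfl⟩ <;> rcases addRoot_cases b with rfl | ⟨b, rfl⟩ <;>
    simp only [hf1, hf2] at e
    · rfl
    · exact absurd e.symm (hnr b)
    · exact absurd e (hnr a)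
    · rw [hinj e]
  have hfsurj : Function.Surjective f := by
    intro v
    by_cases hv : v = T.root
    · exact ⟨_, hf1.trans hv.symm⟩
    · obtain ⟨a, ha⟩ := hrange.superset (hr' v hv)
      exact ⟨inclAddRoot a, (hf2 a).trans ha⟩
  refine ⟨⟨Equiv.ofBijective f ⟨hfinj, hfsurj⟩, ?_⟩, hf1, fun i => (hf2 _).trans (hleaf i)⟩
  intro a b
  change T.graph.Adj (f a) (f b) ↔ _
  rcases addRoot_cases a with rfl | ⟨a, rfl⟩ <;> rcases addRoot_cases b with rfl | ⟨b, rfl⟩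
  · simp
  · rw [hf1, hf2, hchild, addRoot_adj_root, ← hroot, hinj.eq_iff]
  · rw [hf1, hf2, SimpleGraph.adj_comm, hchild, SimpleGraph.adj_comm, addRoot_adj_root, ← hroot,
      hinj.eq_iff]
  · rw [hf2, hf2, hadj, addRoot_adj_incl]

end RootedGraph

/-! ### The tree of a point in terms of its coordinates -/

section Strata

open RootedGraph

variable {m n : ℕ} {M : Set (Euc m)} {T : RootedGraph n}

/-- The isomorphism class of the tree of a point, in terms of its coordinates. -/
theorem treeOf_iso_iff (hT : T.IsFTree) {x : CompactAmbient n M} (hR : IsExclusion (exclusionOf x))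
    (hx : ∀ i j k, x.1 i ≠ x.1 k → x.1 i = x.1 j → i ≠ j → exclusionOf x i j k)
    (hx' : ∀ i j k, exclusionOf x i j k → x.1 i = x.1 j) :
    (treeOf x).Iso T ↔
      (∀ i j k, exclusionOf x i j k ↔ (i ≠ j ∧ i ≠ k ∧ j ≠ k) ∧ T.Near i j k) ∧
      ∀ i j, i ≠ j → (x.1 i = x.1 j ↔ ∃ v, v ≠ T.root ∧ i ∈ T.leafSet v ∧ j ∈ T.leafSet v) := by
  have hnear : ∀ i j k, T.Near i j k ↔
      ∃ v, v ≠ T.root ∧ (i ∈ T.leafSet v ∧ j ∈ T.leafSet v ∧ k ∉ T.leafSet v) := by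
    intro i j k
    refine exists_congr fun v => ⟨?_, fun h => h.2⟩
    rintro h
    refine ⟨?_, h⟩
    rintro rfl
    exact h.2.2 (liesOver_root hT.isTree _)
  by_cases hc : 2 ≤ n ∧ ∀ i j, x.1 i = x.1 j
  · rw [treeOf, if_pos hc]
    constructor
    · intro h
      refine ⟨fun i j k => ?_, fun i j hij => iff_of_true (hc.2 i j) ?_⟩
      · have h1 : i ≠ j → (exclusionOf x i j k ↔ T.Near i j k) := by
          intro hij
          rw [exclusion_iff_exists hR hij, hnear, exists_leafSet_iff_of_iso_addRoot hT hR h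
            (Q := fun S => i ∈ S ∧ j ∈ S ∧ k ∉ S)]
          · simp
          · rintro l ⟨rfl, hl, -⟩
            exact hij hl.symm
        constructor
        · exact fun h2 => ⟨hR.ne h2, (h1 (hR.ne h2).1).1 h2⟩
        · exact fun h2 => (h1 h2.1.1).2 h2.2
      · rw [exists_leafSet_iff_of_iso_addRoot hT hR h (Q := fun S => i ∈ S ∧ j ∈ S)]
        · simp
        · rintro l ⟨rfl, hl⟩
          exact hij hl.symm
    · rintro ⟨h1, h2⟩
      have h01 : (⟨0, by omega⟩ : Fin n) ≠ ⟨1, by omega⟩ := by simp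
      set i₀ : Fin n := ⟨0, by omega⟩
      obtain ⟨r, hr, hir⟩ := exists_child_of_liesOver hT.isTree
          (liesOver_root hT.isTree (T.leaf i₀)) (leaf_ne_root hT i₀)
      -- All points coincide, so each leaf shares a non-root vertex with `i₀` and hence its root
      -- edge.
      have hall : ∀ j, T.LiesOver (T.leaf j) r := by
        intro j
        by_cases hj : i₀ = j
        · exact hj ▸ hir
        obtain ⟨v, hv, h3, h4⟩ := (h2 i₀ j hj).1 (hc.2 _ _)
        obtain ⟨c, hcr, hvc⟩ := exists_child_of_liesOver hT.isTree (liesOver_root hT.isTree v) hv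
        rw [hr.eq_of_liesOver hT.isTree hcr hir (LiesOver.trans hT.isTree h3 hvc)]
        exact LiesOver.trans hT.isTree h4 hvc
      refine iso_addRoot_ofExclusion hT hR h1 (r := r) ⟨hr.ne_root hT.isTree, ?_⟩ fun v hv => ?_
      · rintro ⟨l, rfl⟩
        have h3 := hT.leaf_injective ((liesOver_leaf_iff hT).1 (hall i₀))
        have h4 := hT.leaf_injective ((liesOver_leaf_iff hT).1 (hall ⟨1, by omega⟩))
        exact h01 (h3.trans h4.symm)
      · exact (liesOver_iff_leafSet_subset hT hv).2 fun j _ => hall j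
  · rw [treeOf, if_neg hc]
    constructor
    · intro h
      refine ⟨fun i j k => ?_, fun i j hij => ?_⟩
      · have h1 : i ≠ j → (exclusionOf x i j k ↔ T.Near i j k) := by
          intro hij
          rw [exclusion_iff_exists hR hij, hnear, exists_leafSet_iff_of_iso hT hR h
            (Q := fun S => i ∈ S ∧ j ∈ S ∧ k ∉ S)]
          rintro l ⟨rfl, hl, -⟩
          exact hij hl.symm
        constructor
        · exact fun h2 => ⟨hR.ne h2, (h1 (hR.ne h2).1).1 h2⟩
        · exact fun h2 => (h1 h2.1.1).2 h2.2
      · rw [exists_leafSet_iff_of_iso hT hR h (Q := fun S => i ∈ S ∧ j ∈ S)]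
        · constructor
          · intro hxx
            -- Not all points coincide here: since `i ≠ j` forces `2 ≤ n`, that would be the
            -- excluded case.
            obtain ⟨k, hk⟩ : ∃ k, x.1 i ≠ x.1 k := by
              by_contra! hcon
              refine hc ⟨?_, fun a b => (hcon a).symm.trans (hcon b)⟩
              have := i.2
              have := j.2
              have : i.1 ≠ j.1 := fun e => hij (Fin.ext e)
              omega
            obtain ⟨A, hA, h3, h4, -⟩ := (exclusion_iff_exists hR hij).1 (hx i j k hk hxx hij)
            exact ⟨A, hA, h3, h4⟩
          · rintro ⟨A, hA, h3, h4⟩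
            obtain ⟨l, rfl⟩ := exists_center_of_mem hR hA h3
            exact hx' i j l (h4.resolve_left hij.symm)
        · rintro l ⟨rfl, hl⟩
          exact hij hl.symm
    · rintro ⟨h1, h2⟩
      refine iso_ofExclusion hT hR h1 fun v hv huniv => hc ⟨?_, fun i j => ?_⟩
      · obtain ⟨i, j, hij, -, -⟩ := exists_ne_leafSet hT hv
        have := i.2
        have := j.2
        have : i.1 ≠ j.1 := fun e => hij (Fin.ext e)
        omega
      · by_cases hij : i = j
        · rw [hij]
        · exact (h2 i j hij).2 ⟨v, hv.1, by simp [huniv], by simp [huniv]⟩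

end Strata

/-! ### Charts, tangent spaces and curves in a submanifold -/

/-- A strictly differentiable map carries limits of rescaled secants to limits of rescaled
secants. -/
theorem HasStrictFDerivAt.tendsto_smul_sub {E F α : Type*} [NormedAddCommGroup E] [NormedSpace ℝ E]
    [NormedAddCommGroup F] [NormedSpace ℝ F] {f : E → F} {f' : E →L[ℝ] F} {a : E}
    (hf : HasStrictFDerivAt f f' a) {l : Filter α} {u v : α → E} {r : α → ℝ} {w : E}
    (hu : Tendsto u l (𝓝 a)) (hv : Tendsto v l (𝓝 a))
    (hw : Tendsto (fun t => r t • (u t - v t)) l (𝓝 w)) :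
    Tendsto (fun t => r t • (f (u t) - f (v t))) l (𝓝 (f' w)) := by
  have h1 : (fun t => f (u t) - f (v t) - f' (u t - v t)) =o[l] fun t => u t - v t :=
    hf.isLittleO.comp_tendsto (hu.prodMk_nhds hv)
  have h2 : (fun t => r t • (f (u t) - f (v t) - f' (u t - v t))) =o[l] fun _ => (1 : ℝ) :=
    ((Asymptotics.isBigO_refl r l).smul_isLittleO h1).trans_isBigO (hw.isBigO_one ℝ)
  have h3 := (Asymptotics.isLittleO_one_iff ℝ).1 h2
  have h4 := h3.add ((f'.continuous.tendsto w).comp hw)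
  rw [zero_add] at h4
  refine h4.congr fun t => ?_
  simp only [Function.comp_apply, map_smul, ← smul_add, sub_add_cancel]

section Manifold

variable {m d : ℕ} {M : Set (Euc m)}

/-- `φ` is a chart of `ℝ^m` that carries `M` to `{y ∈ L | 0 ≤ ℓ y}`. -/
structure IsSubmanifoldChart (M : Set (Euc m)) (φ : OpenPartialHomeomorph (Euc m) (Euc m))
    (L : Submodule ℝ (Euc m)) (ℓ : Euc m →ₗ[ℝ] ℝ) : Prop where
  contDiffOn : ContDiffOn ℝ ∞ φ φ.source
  contDiffOn_symm : ContDiffOn ℝ ∞ φ.symm φ.target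
  mem_iff : ∀ y ∈ φ.source, y ∈ M ↔ φ y ∈ L ∧ 0 ≤ ℓ (φ y)

namespace IsSubmanifoldChart

variable {φ : OpenPartialHomeomorph (Euc m) (Euc m)} {L : Submodule ℝ (Euc m)}
  {ℓ : Euc m →ₗ[ℝ] ℝ} (hφ : IsSubmanifoldChart M φ L ℓ) {x : Euc m}
include hφ

theorem hasStrictFDerivAt (hx : x ∈ φ.source) : HasStrictFDerivAt φ (fderiv ℝ φ x) x :=
  (hφ.contDiffOn.contDiffAt (φ.open_source.mem_nhds hx)).hasStrictFDerivAt (by simp)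

theorem hasStrictFDerivAt_symm (hx : x ∈ φ.source) :
    HasStrictFDerivAt φ.symm (fderiv ℝ φ.symm (φ x)) (φ x) :=
  (hφ.contDiffOn_symm.contDiffAt
    (φ.open_target.mem_nhds (φ.map_source hx))).hasStrictFDerivAt (by simp)

theorem fderiv_symm_fderiv (hx : x ∈ φ.source) (w : Euc m) :
    fderiv ℝ φ.symm (φ x) (fderiv ℝ φ x w) = w := by
  have h1 := (hφ.hasStrictFDerivAt_symm hx).hasFDerivAt.comp x (hφ.hasStrictFDerivAt hx).hasFDerivAt
  have h2 : HasFDerivAt (φ.symm ∘ φ) (ContinuousLinearMap.id ℝ _) x := by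
    refine (hasFDerivAt_id x).congr_of_eventuallyEq ?_
    filter_upwards [φ.open_source.mem_nhds hx] with y hy using φ.left_inv hy
  exact congrArg (fun f : Euc m →L[ℝ] Euc m => f w) (h1.unique h2)

theorem fderiv_fderiv_symm (hx : x ∈ φ.source) (w : Euc m) :
    fderiv ℝ φ x (fderiv ℝ φ.symm (φ x) w) = w := by
  have hx' := (φ.left_inv hx).symm
  have h0 := (hφ.hasStrictFDerivAt hx).hasFDerivAt
  have h1 : HasFDerivAt (φ ∘ φ.symm) ((fderiv ℝ φ x).comp (fderiv ℝ φ.symm (φ x))) (φ x) := by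
    refine HasFDerivAt.comp (φ x) ?_ (hφ.hasStrictFDerivAt_symm hx).hasFDerivAt
    rwa [φ.left_inv hx]
  have h2 : HasFDerivAt (φ ∘ φ.symm) (ContinuousLinearMap.id ℝ _) (φ x) := by
    refine (hasFDerivAt_id (φ x)).congr_of_eventuallyEq ?_
    filter_upwards [φ.open_target.mem_nhds (φ.map_source hx)] with y hy using φ.right_inv hy
  exact congrArg (fun f : Euc m →L[ℝ] Euc m => f w) (h1.unique h2)

/-- In the chart, differences of points of `M` lie in the closed subspace `L`. Strict
differentiability is what allows both ends of the secant to move. -/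
theorem fderiv_mem_of_secant (hx : x ∈ φ.source) {α : Type*} {l : Filter α} [l.NeBot]
    {u v : α → Euc m} {r : α → ℝ} {w : Euc m} (hu : Tendsto u l (𝓝 x)) (hv : Tendsto v l (𝓝 x))
    (huM : ∃ᶠ t in l, u t ∈ M ∧ v t ∈ M) (hw : Tendsto (fun t => r t • (u t - v t)) l (𝓝 w)) :
    fderiv ℝ φ x w ∈ L := by
  have h1 := (hφ.hasStrictFDerivAt hx).tendsto_smul_sub hu hv hw
  have hs := φ.open_source.mem_nhds hx
  refine L.closed_of_finiteDimensional.mem_of_frequently_of_tendsto ?_ h1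
  refine (huM.and_eventually ((hu.eventually hs).and (hv.eventually hs))).mono ?_
  rintro t ⟨⟨h2, h3⟩, h4, h5⟩
  exact L.smul_mem _ (L.sub_mem ((hφ.mem_iff _ h4).1 h2).1 ((hφ.mem_iff _ h5).1 h3).1)

/-- The tangent space of `M` in terms of a chart. -/
theorem mem_tangentSpaceAt_iff (hx : x ∈ φ.source) (hxM : x ∈ M) {w : Euc m} :
    w ∈ tangentSpaceAt M x ↔ fderiv ℝ φ x w ∈ L := by
  constructor
  · intro hw
    have h1 : tangentSpaceAt M x ≤ L.comap (fderiv ℝ φ x).toLinearMap := by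
      refine Submodule.span_le.2 fun w hw => ?_
      obtain ⟨α, l, hl, c, δ, hδ, hmem, hlim⟩ := exists_fun_of_mem_tangentConeAt hw
      refine hφ.fderiv_mem_of_secant hx (l := l) (u := fun t => x + δ t) (v := fun _ => x)
        (r := c) ?_ tendsto_const_nhds (hmem.frequently.mono fun t ht => ⟨ht, hxM⟩) ?_
      · simpa using tendsto_const_nhds.add hδ
      · simpa using hlim
    exact h1 hw
  -- A vector pointing into the half-space is the velocity of a curve in `M`, straight in the chart.
  -- At a boundary point the others are reached by negation, hence the span in the definition.
  · have key : ∀ w, fderiv ℝ φ x w ∈ L → 0 ≤ ℓ (fderiv ℝ φ x w) → w ∈ tangentConeAt ℝ M x := by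
      intro w hw hℓ
      have hxL := (hφ.mem_iff x hx).1 hxM
      let γ : ℝ → Euc m := fun t => φ x + t • fderiv ℝ φ x w
      have hγ : Tendsto γ (𝓝[>] 0) (𝓝 (φ x)) := by
        have : Continuous γ := by fun_prop
        simpa [γ] using (this.continuousWithinAt (s := Set.Ioi 0) (x := 0)).tendsto
      have hγt := hγ.eventually (φ.open_target.mem_nhds (φ.map_source hx))
      have hψ := hφ.hasStrictFDerivAt_symm hx
      have h1 : Tendsto (fun t => φ.symm (γ t) - x) (𝓝[>] 0) (𝓝 0) := by
        have := (hψ.continuousAt.tendsto.comp hγ).sub_const x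
        simpa [φ.left_inv hx] using this
      have h2 := hψ.tendsto_smul_sub (r := fun t => t⁻¹) (w := fderiv ℝ φ x w) hγ
        (tendsto_const_nhds (x := φ x)) (by
          refine tendsto_const_nhds.congr' ?_
          filter_upwards [self_mem_nhdsWithin] with t ht
          have ht : 0 < t := ht
          simp [γ, smul_smul, ht.ne'])
      rw [hφ.fderiv_symm_fderiv hx, φ.left_inv hx] at h2
      refine mem_tangentConeAt_of_seq (𝓝[>] (0 : ℝ)) (fun t => t⁻¹) _ h1 ?_ h2
      filter_upwards [hγt, self_mem_nhdsWithin] with t ht ht0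
      have ht0 : 0 < t := ht0
      rw [add_sub_cancel, hφ.mem_iff _ (φ.map_target ht), φ.right_inv ht]
      refine ⟨L.add_mem hxL.1 (L.smul_mem _ hw), ?_⟩
      simp only [γ, map_add, map_smul, smul_eq_mul]
      exact add_nonneg hxL.2 (mul_nonneg ht0.le hℓ)
    intro hw
    rcases le_total 0 (ℓ (fderiv ℝ φ x w)) with h | h
    · exact Submodule.subset_span (key w hw h)
    · rw [← neg_neg w]
      refine Submodule.neg_mem _ (Submodule.subset_span (key _ ?_ ?_))
      · rw [map_neg]; exact L.neg_mem hw
      · rw [map_neg, map_neg]; linarith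

end IsSubmanifoldChart

theorem IsSmoothSubmanifold.exists_chart (hM : IsSmoothSubmanifold d M) {x : Euc m} (hx : x ∈ M) :
    ∃ (φ : OpenPartialHomeomorph (Euc m) (Euc m)) (L : Submodule ℝ (Euc m)) (ℓ : Euc m →ₗ[ℝ] ℝ),
      IsSubmanifoldChart M φ L ℓ ∧ x ∈ φ.source := by
  obtain ⟨φ, L, ℓ, h1, h2, h3, -, h4⟩ := hM x hx
  exact ⟨φ, L, ℓ, ⟨h2, h3, h4⟩, h1⟩

/-- Limits of rescaled secants of a submanifold are tangent vectors. -/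
theorem IsSmoothSubmanifold.mem_tangentSpaceAt_of_secant (hM : IsSmoothSubmanifold d M) {x : Euc m}
    (hx : x ∈ M) {α : Type*} {l : Filter α} [l.NeBot] {u v : α → Euc m} {r : α → ℝ} {w : Euc m}
    (hu : Tendsto u l (𝓝 x)) (hv : Tendsto v l (𝓝 x)) (huM : ∀ t, u t ∈ M) (hvM : ∀ t, v t ∈ M)
    (hw : Tendsto (fun t => r t • (u t - v t)) l (𝓝 w)) : w ∈ tangentSpaceAt M x := by
  obtain ⟨φ, L, ℓ, hφ, hxs⟩ := hM.exists_chart hx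
  exact (hφ.mem_tangentSpaceAt_iff hxs hx).2 (hφ.fderiv_mem_of_secant hxs hu hv
    (Frequently.of_forall fun t => ⟨huM t, hvM t⟩) hw)

/-- A tangent vector at `x` extends to a continuous family of tangent vectors at nearby points. -/
theorem IsSmoothSubmanifold.exists_tangent_extension (hM : IsSmoothSubmanifold d M) {x : Euc m}
    (hx : x ∈ M) {w : Euc m} (hw : w ∈ tangentSpaceAt M x) :
    ∃ W : Euc m → Euc m, ContinuousAt W x ∧ W x = w ∧
      ∀ᶠ y in 𝓝 x, y ∈ M → W y ∈ tangentSpaceAt M y := by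
  obtain ⟨φ, L, ℓ, hφ, hxs⟩ := hM.exists_chart hx
  refine ⟨fun y => fderiv ℝ φ.symm (φ y) (fderiv ℝ φ x w), ?_, hφ.fderiv_symm_fderiv hxs w, ?_⟩
  · have h1 : ContinuousAt (fderiv ℝ φ.symm) (φ x) :=
      (hφ.contDiffOn_symm.continuousOn_fderiv_of_isOpen φ.open_target (by simp)).continuousAt
        (φ.open_target.mem_nhds (φ.map_source hxs))
    have h2 : ContinuousAt (fun y => fderiv ℝ φ.symm (φ y)) x :=
      ContinuousAt.comp (f := φ) h1 (φ.continuousAt hxs)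
    exact h2.clm_apply continuousAt_const
  · filter_upwards [φ.open_source.mem_nhds hxs] with y hy hyM
    rw [hφ.mem_tangentSpaceAt_iff hy hyM, hφ.fderiv_fderiv_symm hy]
    exact (hφ.mem_tangentSpaceAt_iff hxs hx).1 hw

/-- Small tangential displacements at a point of a submanifold are realized by points of the
submanifold, up to errors that are small relative to the differences of the displacements. -/
theorem IsSmoothSubmanifold.exists_curves (hM : IsSmoothSubmanifold d M) {x : Euc m} (hx : x ∈ M)
    {ι : Type*} (σ : ι → ℝ → Euc m) (hσ : ∀ i ε, σ i ε ∈ tangentSpaceAt M x)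
    (ho : ∀ i, σ i =o[𝓝[>] 0] fun ε : ℝ => ε) :
    ∃ y : ι → ℝ → Euc m, (∀ i, ∀ᶠ ε in 𝓝[>] 0, y i ε ∈ M) ∧
      (∀ i, Tendsto (y i) (𝓝[>] 0) (𝓝 x)) ∧
      ∀ (i j : ι) (r : ℝ → ℝ) (w : Euc m),
        Tendsto (fun ε => r ε • (σ i ε - σ j ε)) (𝓝[>] 0) (𝓝 w) →
        Tendsto (fun ε => r ε • (y i ε - y j ε)) (𝓝[>] 0) (𝓝 w) := by
  obtain ⟨φ, L, ℓ, hφ, hxs⟩ := hM.exists_chart hx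
  have hxL := (hφ.mem_iff x hxs).1 hx
  have hid : Tendsto (fun ε : ℝ => ε) (𝓝[>] 0) (𝓝 0) := tendsto_id.mono_left nhdsWithin_le_nhds
  -- An inward direction of the half-space, needed only if `ℓ` does not vanish on `L`.
  obtain ⟨N, hNL, hN⟩ : ∃ N ∈ L, (∀ v ∈ L, ℓ v = 0) ∨ ℓ N = 1 := by
    by_cases h : ∀ v ∈ L, ℓ v = 0
    · exact ⟨0, L.zero_mem, Or.inl h⟩
    · push Not at h
      obtain ⟨v, hv, hne⟩ := h
      exact ⟨(ℓ v)⁻¹ • v, L.smul_mem _ hv, Or.inr (by simp [hne])⟩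
  let B := fderiv ℝ φ x
  have hB : ∀ i ε, B (σ i ε) ∈ L := fun i ε => (hφ.mem_tangentSpaceAt_iff hxs hx).1 (hσ i ε)
  -- The push `ε • N` dominates the displacements, which are `o(ε)`, and so keeps the points in the
  -- half-space. It is common to all of them and drops out of differences.
  let z : ι → ℝ → Euc m := fun i ε => φ x + (ε • N + B (σ i ε))
  have hzL : ∀ i ε, z i ε ∈ L := fun i ε =>
    L.add_mem hxL.1 (L.add_mem (L.smul_mem _ hNL) (hB i ε))
  have hBo : ∀ i, (fun ε => B (σ i ε)) =o[𝓝[>] 0] fun ε : ℝ => ε := fun i =>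
    (B.isBigO_comp _ _).trans_isLittleO (ho i)
  have hz : ∀ i, Tendsto (z i) (𝓝[>] 0) (𝓝 (φ x)) := by
    intro i
    have h1 : Tendsto (fun ε => B (σ i ε)) (𝓝[>] 0) (𝓝 0) := (hBo i).trans_tendsto hid
    have h2 : Tendsto (fun ε : ℝ => ε • N) (𝓝[>] 0) (𝓝 0) := by simpa using hid.smul_const N
    simpa using (h2.add h1).const_add (φ x)
  have hzt : ∀ i, ∀ᶠ ε in 𝓝[>] 0, z i ε ∈ φ.target := fun i =>
    (hz i).eventually (φ.open_target.mem_nhds (φ.map_source hxs))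
  have hψ := hφ.hasStrictFDerivAt_symm hxs
  refine ⟨fun i ε => φ.symm (z i ε), fun i => ?_, fun i => ?_, fun i j r w h => ?_⟩
  · have hpos : ∀ᶠ ε in 𝓝[>] (0 : ℝ), 0 ≤ ℓ (z i ε) := by
      rcases hN with hN | hN
      · exact Eventually.of_forall fun ε => (hN _ (hzL i ε)).ge
      · have h1 : (fun ε => ℓ (B (σ i ε))) =o[𝓝[>] 0] fun ε : ℝ => ε :=
          ((LinearMap.toContinuousLinearMap ℓ).isBigO_comp _ _).trans_isLittleO (hBo i)
        filter_upwards [h1.bound one_pos, self_mem_nhdsWithin] with ε hε hε0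
        have hε0 : 0 < ε := hε0
        rw [one_mul, Real.norm_eq_abs, Real.norm_eq_abs, abs_of_pos hε0] at hε
        have h2 := neg_le_of_abs_le hε
        simp only [z, map_add, map_smul, hN, smul_eq_mul, mul_one]
        linarith [hxL.2]
    filter_upwards [hpos, hzt i] with ε h1 h2
    rw [hφ.mem_iff _ (φ.map_target h2), φ.right_inv h2]
    exact ⟨hzL i ε, h1⟩
  · have := hψ.continuousAt.tendsto.comp (hz i)
    rwa [φ.left_inv hxs] at this
  · have h1 := hψ.tendsto_smul_sub (r := r) (w := B w) (hz i) (hz j) (by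
      refine ((B.continuous.tendsto w).comp h).congr fun ε => ?_
      simp [z])
    rwa [hφ.fderiv_symm_fderiv hxs] at h1

end Manifold

/-! ### Openness of the quotient maps -/

theorem isOpenMap_confSetoid_mk (m : ℕ) (I : Type) : IsOpenMap (Quotient.mk (confSetoid m I)) := by
  intro U hU
  refine isOpen_coinduced.2 (isOpen_iff_mem_nhds.2 ?_)
  rintro q ⟨p, hp, hpq⟩
  obtain ⟨s, hs, w, e⟩ := (confSetoid m I).symm (Quotient.exact hpq)
  -- The similarity that carries `q` to `p` carries configurations near `q` into `U`.
  let f : Conf I (Euc m) → Conf I (Euc m) := fun q => ⟨fun i => s • q.1 i + w, fun i j h =>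
    q.2 (smul_right_injective _ hs.ne' (add_right_cancel h))⟩
  have hf : Continuous f := by
    refine Continuous.subtype_mk (continuous_pi fun i => ?_) _
    have h1 : Continuous fun q : Conf I (Euc m) => q.1 i :=
      (continuous_apply i).comp continuous_subtype_val
    exact (h1.const_smul s).add_const w
  have hfq : f q = p := Subtype.ext (funext fun i => (e i).symm)
  have : f ⁻¹' U ∈ 𝓝 q := hf.continuousAt.preimage_mem_nhds (hU.mem_nhds (hfq ▸ hp))
  filter_upwards [this] with q' hq'
  exact ⟨f q', hq', Quotient.sound ((confSetoid m I).symm ⟨s, hs, w, fun i => rfl⟩)⟩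

instance (m : ℕ) (I : Type) [Finite I] : SmoothParam.IsTopological (ConfModSim m I) :=
  SmoothParam.isTopological_quotient _ (isOpenMap_confSetoid_mk m I)

/-- As in Euclidean space, except that the translation vector is tangent at one point only; over
nearby points it is replaced by the value of a continuous tangent extension `W`. -/
theorem IsSmoothSubmanifold.isOpenMap_tangentConfSetoid_mk {m d : ℕ} {M : Set (Euc m)}
    (hM : IsSmoothSubmanifold d M) (I : Type) : IsOpenMap (Quotient.mk (tangentConfSetoid M I)) := by
  intro U hU
  refine isOpen_coinduced.2 (isOpen_iff_mem_nhds.2 ?_)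
  rintro q ⟨p, hp, hpq⟩
  obtain ⟨hpb, s, hs, w, hw, e⟩ := (tangentConfSetoid M I).symm (Quotient.exact hpq)
  obtain ⟨W, hW, hWw, hWT⟩ := hM.exists_tangent_extension q.1.1.2 hw
  obtain ⟨U', hU', rfl⟩ := isOpen_induced_iff.1 hU
  have hbase : Tendsto (fun q : TangentConf M I => (q.1.1 : Euc m)) (𝓝 q) (𝓝 q.1.1) :=
    (continuous_subtype_val.comp (continuous_fst.comp continuous_subtype_val)).continuousAt
  let f : TangentConf M I → M × (I → Euc m) := fun q => (q.1.1, fun i => s • q.1.2 i + W q.1.1)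
  have hf : Tendsto f (𝓝 q) (𝓝 (f q)) := by
    refine Tendsto.prodMk_nhds ?_ (tendsto_pi_nhds.2 fun i => ?_)
    · exact (continuous_fst.comp continuous_subtype_val).continuousAt
    · have h1 : Continuous fun q : TangentConf M I => q.1.2 i :=
        (continuous_apply i).comp (continuous_snd.comp continuous_subtype_val)
      exact (h1.const_smul s).continuousAt.add (hW.tendsto.comp hbase)
  have hfq : f q = p.1 := by
    refine Prod.ext hpb (funext fun i => ?_)
    simp only [f, hWw]
    exact (e i).symm
  have h1 := hf.eventually (hU'.mem_nhds (hfq ▸ hp : f q ∈ U'))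
  filter_upwards [h1, hbase.eventually hWT] with q' hq' hq'T
  have hT := hq'T q'.1.1.2
  refine ⟨⟨f q', fun i j h => q'.2.1 (smul_right_injective _ hs.ne' (add_right_cancel h)),
    fun i => Submodule.add_mem _ (Submodule.smul_mem _ _ (q'.2.2 i)) hT⟩, hq', ?_⟩
  exact Quotient.sound ((tangentConfSetoid M I).symm ⟨rfl, s, hs, _, hT, fun i => rfl⟩)

theorem IsSmoothSubmanifold.isTopological_infConf {m d : ℕ} {M : Set (Euc m)}
    (hM : IsSmoothSubmanifold d M) (I : Type) [Finite I] :
    SmoothParam.IsTopological (InfConf M I) :=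
  SmoothParam.isTopological_quotient _ (hM.isOpenMap_tangentConfSetoid_mk I)

theorem IsSmoothSubmanifold.isTopological_infStratum {m n d : ℕ} {M : Set (Euc m)}
    (hM : IsSmoothSubmanifold d M) (T : RootedGraph n) :
    SmoothParam.IsTopological (InfStratum T M) := by
  have := fun I [Finite I] => hM.isTopological_infConf I
  infer_instance

/-! ### Smooth maps between parameter spaces -/

theorem SmoothParam.isSmooth_of_contDiff {X Y : Type} [SmoothParam X] [SmoothParam Y] {f : X → Y}
    (F : Param X → Param Y) (hF : ContDiff ℝ ∞ F) (h : ∀ b y, Rep b y → Rep (F b) (f y)) :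
    IsSmooth f :=
  fun _ _ _ => ⟨Set.univ, F, isOpen_univ, trivial, hF.contDiffOn, fun b _ y hy => h b y hy⟩

/-- The norm on the parameters of a finite product is built from `Fintype.ofFinite`; the proof
supplies the same instance. -/
theorem SmoothParam.contDiff_param_apply {ι : Type} [Finite ι] {X : ι → Type} [∀ i, SmoothParam (X i)]
    (i : ι) : @ContDiff ℝ _ (Param (∀ i, X i)) _ _ (Param (X i)) _ _ ∞ fun b => b i := by
  let _ := Fintype.ofFinite ι
  exact (ContinuousLinearMap.proj (R := ℝ) (φ := fun i => Param (X i)) i).contDiff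

theorem SmoothParam.contDiffOn_param_pi {ι : Type} [Finite ι] {X : ι → Type} [∀ i, SmoothParam (X i)]
    {E : Type*} [NormedAddCommGroup E] [NormedSpace ℝ E] {U : Set E} {F : E → ∀ i, Param (X i)}
    (h : ∀ i, ContDiffOn ℝ ∞ (fun b => F b i) U) :
    @ContDiffOn ℝ _ E _ _ (Param (∀ i, X i)) _ _ ∞ F U := by
  let _ := Fintype.ofFinite ι
  exact contDiffOn_pi.2 h

theorem SmoothParam.contDiff_param_pi {ι : Type} [Finite ι] {X : ι → Type} [∀ i, SmoothParam (X i)]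
    {E : Type*} [NormedAddCommGroup E] [NormedSpace ℝ E] {F : E → ∀ i, Param (X i)}
    (h : ∀ i, ContDiff ℝ ∞ fun b => F b i) :
    @ContDiff ℝ _ E _ _ (Param (∀ i, X i)) _ _ ∞ F := by
  let _ := Fintype.ofFinite ι
  exact contDiff_pi.2 h

theorem SmoothParam.contDiff_param_fst {X Y : Type} [SmoothParam X] [SmoothParam Y] :
    @ContDiff ℝ _ (Param (X × Y)) _ _ (Param X) _ _ ∞ fun b => b.1 :=
  contDiff_fst

theorem SmoothParam.contDiff_param_snd {X Y : Type} [SmoothParam X] [SmoothParam Y] :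
    @ContDiff ℝ _ (Param (X × Y)) _ _ (Param Y) _ _ ∞ fun b => b.2 :=
  contDiff_snd

/-! ### Root edges and the Euclidean case -/

namespace RootedGraph

variable {n : ℕ} {T : RootedGraph n}

theorem exists_rootEdge (hT : T.graph.IsTree) {v : T.V} (hv : v ≠ T.root) :
    ∃ e : T.EdgesAt T.root, T.LiesOver v e.1 := by
  obtain ⟨c, hc, h⟩ := exists_child_of_liesOver hT (liesOver_root hT v) hv
  exact ⟨⟨c, hc⟩, h⟩

/-- The root edge under a vertex. -/
noncomputable def rootEdge (hT : T.graph.IsTree) (v : T.V) (hv : v ≠ T.root) : T.EdgesAt T.root :=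
  (exists_rootEdge hT hv).choose

theorem liesOver_rootEdge (hT : T.graph.IsTree) {v : T.V} (hv : v ≠ T.root) :
    T.LiesOver v (rootEdge hT v hv).1 :=
  (exists_rootEdge hT hv).choose_spec

theorem rootEdge_eq (hT : T.graph.IsTree) {v : T.V} (hv : v ≠ T.root) {e : T.EdgesAt T.root}
    (h : T.LiesOver v e.1) : rootEdge hT v hv = e :=
  Subtype.ext (Child.eq_of_liesOver hT (rootEdge hT v hv).2 e.2 (liesOver_rootEdge hT hv) h)

end RootedGraph

section Euclidean

open RootedGraph SmoothParam

variable {m n : ℕ} {T : RootedGraph n}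

/-- The parameters of `D_T(M)`: a point for each root edge, and for each internal vertex a point
and a family of vectors. -/
abbrev InfData (T : RootedGraph n) (m : ℕ) : Type :=
  ∀ e : T.EdgesAt T.root, Euc m × ∀ v : T.InternalOver e, Euc m × (T.EdgesAt v.1 → Euc m)

theorem contDiff_infData_base {M : Set (Euc m)} (e : T.EdgesAt T.root) :
    @ContDiff ℝ _ (Param (InfStratum T M)) _ _ (Euc m) _ _ ∞ fun b : InfData T m => (b e).1 :=
  (contDiff_param_fst (X := M) (Y := ∀ v : T.InternalOver e, InfConf M (T.EdgesAt v.1))).comp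
    (contDiff_param_apply (X := fun e => InfConfOver T M e) e)

theorem contDiff_infData_vec {M : Set (Euc m)} (e : T.EdgesAt T.root) (v : T.InternalOver e)
    (c : T.EdgesAt v.1) : @ContDiff ℝ _ (Param (InfStratum T M)) _ _ (Euc m) _ _ ∞
      fun b : InfData T m => ((b e).2 v).2 c :=
  (contDiff_param_apply (X := fun _ : T.EdgesAt v.1 => Euc m) c).comp
    ((contDiff_param_snd (X := M) (Y := T.EdgesAt v.1 → Euc m)).comp
      ((contDiff_param_apply (X := fun v : T.InternalOver e => InfConf M (T.EdgesAt v.1)) v).comp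
        ((contDiff_param_snd (X := M) (Y := ∀ v : T.InternalOver e, InfConf M (T.EdgesAt v.1))).comp
          (contDiff_param_apply (X := fun e => InfConfOver T M e) e))))

theorem tangentSpaceAt_univ (x : Euc m) : tangentSpaceAt (Set.univ : Set (Euc m)) x = ⊤ := by
  rw [tangentSpaceAt, tangentConeAt_univ, Submodule.span_univ]

theorem isSmoothSubmanifold_univ (m : ℕ) :
    IsSmoothSubmanifold m (Set.univ : Set (Euc m)) := fun x _ =>
  ⟨OpenPartialHomeomorph.refl _, ⊤, 0, trivial, contDiffOn_id, contDiffOn_id, by simp, by simp⟩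

/-- The infinitesimal configuration at a point of `ℝ^m` given by vectors modulo translation and
scaling. -/
def ConfModSim.toInfConf {I : Type} (x : (Set.univ : Set (Euc m))) (c : ConfModSim m I) :
    InfConf (Set.univ : Set (Euc m)) I :=
  Quotient.lift (s := confSetoid m I)
    (fun q => Quotient.mk (tangentConfSetoid Set.univ I)
      ⟨(x, q.1), q.2, fun _ => by rw [tangentSpaceAt_univ]; trivial⟩)
    (fun _ _ ⟨s, hs, w, e⟩ => Quotient.sound (s := tangentConfSetoid Set.univ I)
      ⟨rfl, s, hs, w, by rw [tangentSpaceAt_univ]; trivial, e⟩) c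

theorem ConfModSim.base_toInfConf {I : Type} (x : (Set.univ : Set (Euc m))) (c : ConfModSim m I) :
    (c.toInfConf x).base = x := by
  induction c using Quotient.inductionOn
  rfl

theorem ConfModSim.toConfModSim_toInfConf {I : Type} (x : (Set.univ : Set (Euc m)))
    (c : ConfModSim m I) : (c.toInfConf x).toConfModSim = c := by
  induction c using Quotient.inductionOn
  rfl

theorem InfConf.toInfConf_toConfModSim {I : Type} (c : InfConf (Set.univ : Set (Euc m)) I) :
    ConfModSim.toInfConf c.base c.toConfModSim = c := by
  induction c using Quotient.inductionOn
  rfl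

/-- The root edge chosen by `rootEdge` is only propositionally equal to the given one, and the types
depend on it. -/
theorem infStratum_heq (p : InfStratum T (Set.univ : Set (Euc m))) {e e' : T.EdgesAt T.root}
    (h : e' = e) (v : T.InternalOver e) (hv : T.IsInternal v.1 ∧ T.LiesOver v.1 e'.1) :
    ((p.1 e').1.2 ⟨v.1, hv⟩).toConfModSim = ((p.1 e).1.2 v).toConfModSim := by
  subst h
  rfl

/-- The points and the classes of vectors that make up an element of `D_T(ℝ^m)`. -/
noncomputable def infStratumUnivEquiv (hT : T.IsFTree) :
    InfStratum T (Set.univ : Set (Euc m)) ≃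
      Conf (T.EdgesAt T.root) (Euc m) × (∀ v : T.Internal, ConfModSim m (T.EdgesAt v.1)) where
  toFun p := (⟨fun e => (p.1 e).1.1, fun _ _ h => p.2 (Subtype.ext h)⟩, fun v =>
    ((p.1 (rootEdge hT.isTree v.1 v.2.1)).1.2
      ⟨v.1, v.2, liesOver_rootEdge hT.isTree v.2.1⟩).toConfModSim)
  invFun q := ⟨fun e => ⟨(⟨q.1.1 e, trivial⟩, fun v =>
    ConfModSim.toInfConf ⟨q.1.1 e, trivial⟩ (q.2 ⟨v.1, v.2.1⟩)),
      fun _ => ConfModSim.base_toInfConf _ _⟩, fun _ _ h => q.1.2 (Subtype.ext_iff.1 h)⟩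
  left_inv p := by
    refine Subtype.ext (funext fun e => Subtype.ext (Prod.ext rfl (funext fun v => ?_)))
    refine Eq.trans ?_ (InfConf.toInfConf_toConfModSim _)
    rw [(p.1 e).2 v]
    exact congrArg (ConfModSim.toInfConf _)
      (infStratum_heq p (rootEdge_eq hT.isTree v.2.1.1 v.2.2) v _)
  right_inv q := Prod.ext rfl (funext fun v => ConfModSim.toConfModSim_toInfConf _ _)

theorem infStratumUnivEquiv_snd (hT : T.IsFTree) (p : InfStratum T (Set.univ : Set (Euc m)))
    (e : T.EdgesAt T.root) (v : T.InternalOver e) :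
    (infStratumUnivEquiv hT p).2 ⟨v.1, v.2.1⟩ = ((p.1 e).1.2 v).toConfModSim :=
  infStratum_heq p (rootEdge_eq hT.isTree v.2.1.1 v.2.2) v _

theorem isSmooth_infStratumUnivEquiv (hT : T.IsFTree) :
    IsSmooth (infStratumUnivEquiv (m := m) hT) := by
  refine isSmooth_of_contDiff (fun b : InfData T m => (fun e => (b e).1, fun v : T.Internal =>
        ((b (rootEdge hT.isTree v.1 v.2.1)).2
          ⟨v.1, v.2, liesOver_rootEdge hT.isTree v.2.1⟩).2)) ?_ fun b y hy => ?_
  · exact ContDiff.prodMk (SmoothParam.contDiff_param_pi (X := fun _ : T.EdgesAt T.root => Euc m)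
      fun e => contDiff_infData_base e)
      (SmoothParam.contDiff_param_pi (X := fun v : T.Internal => ConfModSim m (T.EdgesAt v.1)) fun v =>
        SmoothParam.contDiff_param_pi (X := fun _ : T.EdgesAt v.1 => Euc m) fun c =>
          contDiff_infData_vec (rootEdge hT.isTree v.1 v.2.1)
            ⟨v.1, v.2, liesOver_rootEdge hT.isTree v.2.1⟩ c)
  · refine ⟨fun e => (hy e).1, fun v => ?_⟩
    obtain ⟨q, hq, hq'⟩ := (hy (rootEdge hT.isTree v.1 v.2.1)).2
      ⟨v.1, v.2, liesOver_rootEdge hT.isTree v.2.1⟩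
    exact ⟨⟨q.1.2, q.2.1⟩, congrArg InfConf.toConfModSim hq, hq'.2⟩

theorem isSmooth_infStratumUnivEquiv_symm (hT : T.IsFTree) :
    IsSmooth (infStratumUnivEquiv (m := m) hT).symm := by
  refine isSmooth_of_contDiff (fun b : (T.EdgesAt T.root → Euc m) ×
      ∀ v : T.Internal, T.EdgesAt v.1 → Euc m => fun e => (b.1 e, fun v : T.InternalOver e =>
        (b.1 e, b.2 ⟨v.1, v.2.1⟩))) ?_ ?_
  · have h1 : ∀ e, ContDiff ℝ ∞ fun b : Param (Conf (T.EdgesAt T.root) (Euc m) ×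
        (∀ v : T.Internal, ConfModSim m (T.EdgesAt v.1))) => (b.1 : T.EdgesAt T.root → Euc m) e :=
      fun e => (SmoothParam.contDiff_param_apply (X := fun _ : T.EdgesAt T.root => Euc m) e).comp
        (contDiff_param_fst (X := Conf (T.EdgesAt T.root) (Euc m))
          (Y := ∀ v : T.Internal, ConfModSim m (T.EdgesAt v.1)))
    refine SmoothParam.contDiff_param_pi (X := fun e => InfConfOver T (Set.univ : Set (Euc m)) e)
      fun e => ContDiff.prodMk (h1 e) (SmoothParam.contDiff_param_pi
        (X := fun v : T.InternalOver e => InfConf (Set.univ : Set (Euc m)) (T.EdgesAt v.1))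
          fun v => ContDiff.prodMk (h1 e) ?_)
    exact (SmoothParam.contDiff_param_apply (X := fun v : T.Internal => ConfModSim m (T.EdgesAt v.1))
      ⟨v.1, v.2.1⟩).comp (contDiff_param_snd (X := Conf (T.EdgesAt T.root) (Euc m))
        (Y := ∀ v : T.Internal, ConfModSim m (T.EdgesAt v.1)))
  · rintro b y ⟨hy, hy'⟩ e
    refine ⟨hy e, fun v => ?_⟩
    obtain ⟨q, hq, hq'⟩ := hy' ⟨v.1, v.2.1⟩
    exact ⟨⟨(⟨y.1.1 e, trivial⟩, q.1), q.2, fun _ => by rw [tangentSpaceAt_univ]; trivial⟩,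
      congrArg (ConfModSim.toInfConf _) hq, hy e, hq'⟩

/-- In Euclidean space, an element of `D_T` amounts to its points and its classes of vectors. -/
theorem exists_isDiffeo_infStratum_univ (hT : T.IsFTree) (m : ℕ) :
    ∃ Φ : InfStratum T (Set.univ : Set (Euc m)) ≃ₜ
        Conf (T.EdgesAt T.root) (Euc m) × (∀ v : T.Internal, ConfModSim m (T.EdgesAt v.1)),
      SmoothParam.IsDiffeo Φ ∧
      ∀ (p : InfStratum T (Set.univ : Set (Euc m))) (e : T.EdgesAt T.root),
        (Φ p).1.1 e = ((p.1 e).1.1 : Euc m) ∧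
        ∀ v : T.InternalOver e, (Φ p).2 ⟨v.1, v.2.1⟩ = ((p.1 e).1.2 v).toConfModSim := by
  have := (isSmoothSubmanifold_univ m).isTopological_infStratum T
  obtain ⟨g, hg, hgf⟩ := exists_isDiffeo_of_equiv (infStratumUnivEquiv (m := m) hT)
    (isSmooth_infStratumUnivEquiv hT) (isSmooth_infStratumUnivEquiv_symm hT)
  refine ⟨g, hg, fun p e => ?_⟩
  rw [hgf]
  exact ⟨rfl, infStratumUnivEquiv_snd hT p e⟩

end Euclidean

/-! ### Limits of configurations in coordinates -/

section Coordinates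

variable {m n : ℕ} {M : Set (Euc m)}

theorem injective_pair_iff {i j : Fin n} : Function.Injective ![i, j] ↔ i ≠ j := by
  refine ⟨fun h e => ?_, fun h a b => ?_⟩
  · exact absurd (h (a₁ := 0) (a₂ := 1) (by simpa using e)) (by simp)
  · fin_cases a <;> fin_cases b <;> simp [h, h.symm]

theorem injective_triple_iff {i j k : Fin n} :
    Function.Injective ![i, j, k] ↔ i ≠ j ∧ i ≠ k ∧ j ≠ k := by
  refine ⟨fun h => ⟨fun e => ?_, fun e => ?_, fun e => ?_⟩, fun h a b => ?_⟩
  · exact absurd (h (a₁ := 0) (a₂ := 1) (by simpa using e)) (by simp)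
  · exact absurd (h (a₁ := 0) (a₂ := 2) (by simpa using e)) (by simp)
  · exact absurd (h (a₁ := 1) (a₂ := 2) (by simpa using e)) (by simp)
  · obtain ⟨h1, h2, h3⟩ := h
    fin_cases a <;> fin_cases b <;> simp [h1, h2, h3, h1.symm, h2.symm, h3.symm]

/-- The direction `u_ij` of a point of `A_n[M]`; zero if `i = j`. -/
noncomputable def dirOf (x : CompactAmbient n M) (i j : Fin n) : Euc m :=
  if h : i ≠ j then (x.2.1 ⟨![i, j], injective_pair_iff.2 h⟩ : Euc m) else 0

/-- The ratio `d_ijk` of a point of `A_n[M]`; one if the indices are not distinct. -/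
noncomputable def ratioOf (x : CompactAmbient n M) (i j k : Fin n) : ENNReal :=
  if h : i ≠ j ∧ i ≠ k ∧ j ≠ k then x.2.2 ⟨![i, j, k], injective_triple_iff.2 h⟩ else 1

theorem exclusionOf_iff {x : CompactAmbient n M} {i j k : Fin n} :
    exclusionOf x i j k ↔ (i ≠ j ∧ i ≠ k ∧ j ≠ k) ∧ ratioOf x i j k = 0 := by
  constructor
  · rintro ⟨h, h'⟩
    have h1 := injective_triple_iff.1 h
    exact ⟨h1, by rw [ratioOf, dif_pos h1, h']⟩
  · rintro ⟨h, h'⟩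
    rw [ratioOf, dif_pos h] at h'
    exact ⟨_, h'⟩

theorem eq_pair (p : Conf (Fin 2) (Fin n)) : p.1 = ![p.1 0, p.1 1] := by
  ext a; fin_cases a <;> rfl

theorem eq_triple (p : Conf (Fin 3) (Fin n)) : p.1 = ![p.1 0, p.1 1, p.1 2] := by
  ext a; fin_cases a <;> rfl

theorem dirOf_conf (x : CompactAmbient n M) (p : Conf (Fin 2) (Fin n)) :
    dirOf x (p.1 0) (p.1 1) = x.2.1 p := by
  have h : p.1 0 ≠ p.1 1 := fun e => zero_ne_one (p.2 e)
  rw [dirOf, dif_pos h]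
  exact congrArg (fun p => (x.2.1 p : Euc m)) (Subtype.ext (eq_pair p).symm)

theorem ratioOf_conf (x : CompactAmbient n M) (p : Conf (Fin 3) (Fin n)) :
    ratioOf x (p.1 0) (p.1 1) (p.1 2) = x.2.2 p := by
  have h := injective_triple_iff.1 (eq_triple p ▸ p.2)
  rw [ratioOf, dif_pos h]
  exact congrArg x.2.2 (Subtype.ext (eq_triple p).symm)

/-- The difference of two points of a configuration. -/
def diff (y : Conf (Fin n) M) (i j : Fin n) : Euc m := (y.1 i : Euc m) - y.1 j

theorem diff_ne_zero (y : Conf (Fin n) M) {i j : Fin n} (h : i ≠ j) : diff y i j ≠ 0 :=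
  sub_ne_zero.2 fun e => h (y.2 (Subtype.ext e))

theorem diff_self (y : Conf (Fin n) M) (i : Fin n) : diff y i i = 0 := sub_self _

theorem diff_sub_diff (y : Conf (Fin n) M) (i j k : Fin n) :
    diff y i j - diff y i k = diff y k j := by
  simp only [diff]; abel

theorem neg_diff (y : Conf (Fin n) M) (i j : Fin n) : -diff y i j = diff y j i := by
  simp only [diff]; abel

theorem edist_div_edist (y : Conf (Fin n) M) {i j k : Fin n} (h : i ≠ k) :
    edist (y.1 i) (y.1 j) / edist (y.1 i) (y.1 k) =
      ENNReal.ofReal (‖diff y i j‖ / ‖diff y i k‖) := by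
  rw [ENNReal.ofReal_div_of_pos (norm_pos_iff.2 (diff_ne_zero y h)), edist_dist, edist_dist,
    Subtype.dist_eq, Subtype.dist_eq, dist_eq_norm, dist_eq_norm]
  rfl

/-- Convergence of configurations in `A_n[M]`, in coordinates. -/
theorem tendsto_confEmbed_iff {α : Type*} {l : Filter α} {y : α → Conf (Fin n) M}
    {x : CompactAmbient n M} : Tendsto (fun t => confEmbed n M (y t)) l (𝓝 x) ↔
      (∀ i, Tendsto (fun t => ((y t).1 i : Euc m)) l (𝓝 (x.1 i))) ∧
      (∀ i j, i ≠ j → Tendsto (fun t => ‖diff (y t) i j‖⁻¹ • diff (y t) i j) l (𝓝 (dirOf x i j))) ∧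
      ∀ i j k, i ≠ j → i ≠ k → j ≠ k →
        Tendsto (fun t => ENNReal.ofReal (‖diff (y t) i j‖ / ‖diff (y t) i k‖)) l
          (𝓝 (ratioOf x i j k)) := by
  rw [Prod.tendsto_iff, Prod.tendsto_iff, tendsto_pi_nhds, tendsto_pi_nhds, tendsto_pi_nhds]
  refine and_congr (forall_congr' fun i => tendsto_subtype_rng) (and_congr ?_ ?_)
  · simp only [tendsto_subtype_rng]
    constructor
    · intro h i j hij
      rw [dirOf, dif_pos hij]
      exact h ⟨![i, j], injective_pair_iff.2 hij⟩
    · intro h p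
      rw [← dirOf_conf]
      exact h _ _ fun e => zero_ne_one (p.2 e)
  · constructor
    · intro h i j k hij hik hjk
      rw [ratioOf, dif_pos ⟨hij, hik, hjk⟩]
      refine (h ⟨![i, j, k], injective_triple_iff.2 ⟨hij, hik, hjk⟩⟩).congr fun t => ?_
      exact edist_div_edist (y t) hik
    · intro h p
      obtain ⟨h1, h2, h3⟩ := injective_triple_iff.1 (eq_triple p ▸ p.2)
      rw [← ratioOf_conf]
      refine (h _ _ _ h1 h2 h3).congr fun t => ?_
      exact (edist_div_edist (y t) h2).symm

section Limit

variable {α : Type*} {l : Filter α} {y : α → Conf (Fin n) M} {x : CompactAmbient n M}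
  (hy : Tendsto (fun t => confEmbed n M (y t)) l (𝓝 x))
include hy

theorem tendsto_point (i : Fin n) : Tendsto (fun t => ((y t).1 i : Euc m)) l (𝓝 (x.1 i)) :=
  (tendsto_confEmbed_iff.1 hy).1 i

theorem tendsto_diff (i j : Fin n) :
    Tendsto (fun t => diff (y t) i j) l (𝓝 ((x.1 i : Euc m) - x.1 j)) :=
  (tendsto_point hy i).sub (tendsto_point hy j)

theorem tendsto_dir (i j : Fin n) :
    Tendsto (fun t => ‖diff (y t) i j‖⁻¹ • diff (y t) i j) l (𝓝 (dirOf x i j)) := by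
  by_cases hij : i = j
  · subst hij
    simpa [dirOf, diff_self] using tendsto_const_nhds
  · exact (tendsto_confEmbed_iff.1 hy).2.1 i j hij

theorem tendsto_ratio {i j k : Fin n} (hij : i ≠ j) (hik : i ≠ k) :
    Tendsto (fun t => ENNReal.ofReal (‖diff (y t) i j‖ / ‖diff (y t) i k‖)) l
      (𝓝 (ratioOf x i j k)) := by
  by_cases hjk : j = k
  · subst hjk
    have h1 : ∀ t, ‖diff (y t) i j‖ ≠ 0 := fun t => norm_ne_zero_iff.2 (diff_ne_zero _ hij)
    simpa [ratioOf, div_self (h1 _)] using tendsto_const_nhds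
  · exact (tendsto_confEmbed_iff.1 hy).2.2 i j k hij hik hjk

theorem tendsto_ratio_toReal {i j k : Fin n} (hij : i ≠ j) (hik : i ≠ k)
    (h : ratioOf x i j k ≠ ⊤) :
    Tendsto (fun t => ‖diff (y t) i j‖ / ‖diff (y t) i k‖) l (𝓝 (ratioOf x i j k).toReal) := by
  refine ((ENNReal.tendsto_toReal h).comp (tendsto_ratio hy hij hik)).congr fun t => ?_
  exact ENNReal.toReal_ofReal (by positivity)

/-- This holds for configurations, and inversion is continuous on `[0, ∞]`. -/
theorem ratioOf_swap [l.NeBot] {i j k : Fin n} (hij : i ≠ j) (hik : i ≠ k) :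
    ratioOf x i k j = (ratioOf x i j k)⁻¹ := by
  refine tendsto_nhds_unique (tendsto_ratio hy hik hij) ?_
  refine ((continuous_inv.tendsto _).comp (tendsto_ratio hy hij hik)).congr fun t => ?_
  have h1 := norm_pos_iff.2 (diff_ne_zero (y t) hij)
  have h2 := norm_pos_iff.2 (diff_ne_zero (y t) hik)
  rw [Function.comp_apply, ← ENNReal.ofReal_inv_of_pos (div_pos h1 h2), inv_div]

theorem isBigO_diff [l.NeBot] {i j k : Fin n} (hij : i ≠ j) (hik : i ≠ k)
    (h : ratioOf x i k j ≠ 0) : (fun t => diff (y t) i j) =O[l] fun t => diff (y t) i k := by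
  have h1 : ratioOf x i j k ≠ ⊤ := by
    rw [ratioOf_swap hy hik hij]
    simpa using h
  refine (Asymptotics.isBigO_of_div_tendsto_nhds (Eventually.of_forall fun t ht => ?_) _
    (tendsto_ratio_toReal hy hij hik h1)).of_norm_norm
  exact absurd ht (norm_ne_zero_iff.2 (diff_ne_zero _ hik))

/-- This translates vanishing ratios into asymptotics along the approximating configurations, where
the combinatorics becomes calculus. -/
theorem ratioOf_eq_zero_iff [l.NeBot] {i j k : Fin n} (hij : i ≠ j) (hik : i ≠ k) :
    ratioOf x i j k = 0 ↔ (fun t => diff (y t) i j) =o[l] fun t => diff (y t) i k := by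
  rw [← Asymptotics.isLittleO_norm_norm, Asymptotics.isLittleO_iff_tendsto fun t ht =>
    absurd ht (norm_ne_zero_iff.2 (diff_ne_zero _ hik))]
  constructor
  · intro h
    simpa [h] using tendsto_ratio_toReal hy hij hik (by simp [h])
  · intro h
    refine tendsto_nhds_unique (tendsto_ratio hy hij hik) ?_
    rw [← ENNReal.ofReal_zero]
    exact (ENNReal.continuous_ofReal.tendsto 0).comp h

theorem exclusionOf_iff_isLittleO [l.NeBot] {i j k : Fin n} : exclusionOf x i j k ↔
    i ≠ j ∧ i ≠ k ∧ (fun t => diff (y t) i j) =o[l] fun t => diff (y t) i k := by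
  rw [exclusionOf_iff]
  constructor
  · rintro ⟨⟨h1, h2, h3⟩, h⟩
    exact ⟨h1, h2, (ratioOf_eq_zero_iff hy h1 h2).1 h⟩
  · rintro ⟨h1, h2, h⟩
    have h3 := (ratioOf_eq_zero_iff hy h1 h2).2 h
    refine ⟨⟨h1, h2, ?_⟩, h3⟩
    rintro rfl
    simp [ratioOf] at h3

theorem isBigO_diff_of_not_exclusionOf [l.NeBot] {i j k : Fin n} (hik : i ≠ k)
    (h : ¬exclusionOf x i k j) : (fun t => diff (y t) i j) =O[l] fun t => diff (y t) i k := by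
  by_cases hij : i = j
  · subst hij
    simpa only [diff_self] using Asymptotics.isBigO_zero _ _
  refine isBigO_diff hy hij hik fun h0 => h ?_
  exact (exclusionOf_iff_isLittleO hy).2 ⟨hik, hij, (ratioOf_eq_zero_iff hy hik hij).1 h0⟩

/-- The axioms are rules for o and O. Besides transitivity they use `hO`: moving the base point from
`i` to a much closer `j` does not shrink the order of the distance to `k`. -/
theorem isExclusion_exclusionOf [l.NeBot] : IsExclusion (exclusionOf x) := by
  have hO : ∀ {i j k}, exclusionOf x i j k →
      (fun t => diff (y t) i k) =O[l] fun t => diff (y t) j k := by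
    intro i j k h
    obtain ⟨-, -, h⟩ := (exclusionOf_iff_isLittleO hy).1 h
    refine h.right_isBigO_sub.congr (fun _ => rfl) fun t => ?_
    exact diff_sub_diff (y t) i k j
  refine ⟨fun h => (exclusionOf_iff.1 h).1, fun {i j k} h => ?_, fun {i j k p} h h' hpj => ?_,
    fun {i j k p} h h' => ?_, fun {i j k p} h h' hpi => ?_⟩
  · obtain ⟨⟨h1, h2, h3⟩, -⟩ := exclusionOf_iff.1 h
    rw [exclusionOf_iff_isLittleO hy]
    refine ⟨h1.symm, h3, ?_⟩
    have := ((exclusionOf_iff_isLittleO hy).1 h).2.2.trans_isBigO (hO h)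
    simpa only [← neg_diff _ i j, Asymptotics.isLittleO_neg_left] using this
  · obtain ⟨⟨-, -, h3⟩, -⟩ := exclusionOf_iff.1 h
    rw [exclusionOf_iff_isLittleO hy]
    refine ⟨hpj.symm, h3, ?_⟩
    have := (((exclusionOf_iff_isLittleO hy).1 h').2.2.sub
      ((exclusionOf_iff_isLittleO hy).1 h).2.2).trans_isBigO (hO h)
    simpa only [diff_sub_diff] using this
  · rw [exclusionOf_iff_isLittleO hy] at h h' ⊢
    exact ⟨h.1, h'.2.1, h.2.2.trans h'.2.2⟩
  · have h1 := isBigO_diff_of_not_exclusionOf hy hpi.symm h'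
    rw [exclusionOf_iff_isLittleO hy] at h ⊢
    exact ⟨h.1, hpi.symm, h.2.2.trans_isBigO h1⟩

theorem exclusionOf_of_eq_of_ne [l.NeBot] {i j k : Fin n} (hik : x.1 i ≠ x.1 k)
    (hij : x.1 i = x.1 j) (hne : i ≠ j) : exclusionOf x i j k := by
  have hik' : i ≠ k := fun e => hik (e ▸ rfl)
  refine (exclusionOf_iff_isLittleO hy).2 ⟨hne, hik', ?_⟩
  have h1 := tendsto_diff hy i j
  rw [hij, sub_self] at h1
  have h2 := tendsto_diff hy i k
  have h3 : (x.1 i : Euc m) - x.1 k ≠ 0 := sub_ne_zero.2 fun e => hik (Subtype.ext e)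
  refine (Asymptotics.isLittleO_of_tendsto (fun t ht => ?_) ?_).of_norm_norm
  · exact absurd ht (norm_ne_zero_iff.2 (diff_ne_zero _ hik'))
  · have h4 := h1.norm.div h2.norm (norm_ne_zero_iff.2 h3)
    rw [norm_zero, zero_div] at h4
    exact h4

/-- The difference of `i` and `j` is negligible against a convergent, hence bounded, quantity, so it
tends to zero. -/
theorem eq_of_exclusionOf [l.NeBot] {i j k : Fin n} (h : exclusionOf x i j k) :
    x.1 i = x.1 j := by
  have h1 := ((exclusionOf_iff_isLittleO hy).1 h).2.2.trans_isBigO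
    ((tendsto_diff hy i k).isBigO_one ℝ)
  have h2 := tendsto_nhds_unique (tendsto_diff hy i j) ((Asymptotics.isLittleO_one_iff ℝ).1 h1)
  exact Subtype.ext (sub_eq_zero.1 h2)

/-- The tree of a limit of configurations, in terms of its coordinates. -/
theorem treeOf_iso_iff_of_tendsto [l.NeBot] {T : RootedGraph n} (hT : T.IsFTree) :
    (treeOf x).Iso T ↔
      (∀ i j k, exclusionOf x i j k ↔ (i ≠ j ∧ i ≠ k ∧ j ≠ k) ∧ T.Near i j k) ∧
      ∀ i j, i ≠ j → (x.1 i = x.1 j ↔ ∃ v, v ≠ T.root ∧ i ∈ T.leafSet v ∧ j ∈ T.leafSet v) :=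
  treeOf_iso_iff hT (isExclusion_exclusionOf hy)
    (fun _ _ _ h h' h'' => exclusionOf_of_eq_of_ne hy h h' h'') fun _ _ _ h => eq_of_exclusionOf hy h

end Limit

/-- The neighbourhood filter pulled back to configurations serves, so no sequences have to be
chosen. -/
theorem exists_tendsto_of_mem_canonicalCompactification {x : CompactAmbient n M}
    (hx : x ∈ canonicalCompactification n M) :
    ∃ l : Filter (Conf (Fin n) M), l.NeBot ∧ Tendsto (confEmbed n M) l (𝓝 x) := by
  refine ⟨comap (confEmbed n M) (𝓝 x), ?_, tendsto_comap⟩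
  rw [comap_neBot_iff]
  intro t ht
  obtain ⟨_, h1, y, rfl⟩ := mem_closure_iff_nhds.1 hx t ht
  exact ⟨y, h1⟩

end Coordinates

/-! ### Data representing elements of `D_T(M)` and their limits -/

section InfData

open RootedGraph SmoothParam

variable {m n : ℕ} {T : RootedGraph n} {M : Set (Euc m)}

namespace InfData

open Classical in
/-- The point or vector at the upper endpoint `c` of an edge. -/
noncomputable def vec (b : InfData T m) (c : T.V) : Euc m :=
  if h : T.Child T.root c then (b ⟨c, h⟩).1
  else if h : ∃ (e : T.EdgesAt T.root) (v : T.InternalOver e), T.Child v.1 c then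
    ((b h.choose).2 h.choose_spec.choose).2 ⟨c, h.choose_spec.choose_spec⟩
  else 0

theorem vec_root (b : InfData T m) (e : T.EdgesAt T.root) : b.vec e.1 = (b e).1 := by
  have hc : T.Child T.root e.1 := e.2
  rw [vec, dif_pos hc]

/-- The choices in `vec` do not matter: a vertex has one parent, and that parent lies over one root
edge. -/
theorem vec_internal (hT : T.IsFTree) (b : InfData T m) (e : T.EdgesAt T.root)
    (v : T.InternalOver e) (c : T.EdgesAt v.1) : b.vec c.1 = ((b e).2 v).2 c := by
  have hc : T.Child v.1 c.1 := c.2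
  have h0 : ¬T.Child T.root c.1 := fun h => v.2.1.1 (hc.parent_unique hT.isTree h)
  have h : ∃ (e : T.EdgesAt T.root) (v : T.InternalOver e), T.Child v.1 c.1 := ⟨e, v, hc⟩
  rw [vec, dif_neg h0, dif_pos h]
  have key : ∀ (e e' : T.EdgesAt T.root) (v : T.InternalOver e) (v' : T.InternalOver e') (c : T.V)
      (h : T.Child v.1 c) (h' : T.Child v'.1 c),
      ((b e).2 v).2 ⟨c, h⟩ = ((b e').2 v').2 ⟨c, h'⟩ := by
    rintro e e' ⟨v, hv⟩ ⟨v', hv'⟩ c h h'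
    obtain rfl : v = v' := h.parent_unique hT.isTree h'
    obtain rfl : e = e' :=
      (rootEdge_eq hT.isTree hv.1.1 hv.2).symm.trans (rootEdge_eq hT.isTree hv.1.1 hv'.2)
    rfl
  exact key _ _ _ _ _ _ _

theorem contDiff_vec (c : T.V) :
    @ContDiff ℝ _ (Param (InfStratum T M)) _ _ (Euc m) _ _ ∞ fun b : InfData T m => b.vec c := by
  by_cases h : T.Child T.root c
  · simp only [vec, dif_pos h]
    exact contDiff_infData_base _
  by_cases h' : ∃ (e : T.EdgesAt T.root) (v : T.InternalOver e), T.Child v.1 c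
  · simp only [vec, dif_neg h, dif_pos h']
    exact contDiff_infData_vec _ _ _
  · simp only [vec, dif_neg h, dif_neg h']
    exact contDiff_const

/-- The difference of the vectors towards the leaves `i` and `j` where these branch. -/
noncomputable def gap (b : InfData T m) (i j : Fin n) : Euc m :=
  b.vec (T.branch i j) - b.vec (T.branch j i)

theorem gap_eq (hT : T.IsFTree) (b : InfData T m) {i j : Fin n} {v c c' : T.V} (hc : T.Child v c)
    (hc' : T.Child v c') (hne : c ≠ c') (hi : T.LiesOver (T.leaf i) c)
    (hj : T.LiesOver (T.leaf j) c') : b.gap i j = b.vec c - b.vec c' := by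
  rw [gap, branch_eq hT hc hc' hne hi hj, branch_eq hT hc' hc hne.symm hj hi]

/-- The data that represent an element of `D_T(M)`. -/
structure IsValid (b : InfData T m) (M : Set (Euc m)) : Prop where
  mem : ∀ e, (b e).1 ∈ M
  base_injective : Function.Injective fun e => (b e).1
  base_eq : ∀ e v, ((b e).2 v).1 = (b e).1
  injective : ∀ e v, Function.Injective ((b e).2 v).2
  mem_tangent : ∀ e v c, ((b e).2 v).2 c ∈ tangentSpaceAt M (b e).1

theorem isValid_of_rep {b : InfData T m} {p : InfStratum T M}
    (h : Rep (X := InfStratum T M) b p) : b.IsValid M := by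
  have h1 : ∀ e, (b e).1 = (p.1 e).1.1 := fun e => (h e).1
  have h2 : ∀ e v, ∃ q : TangentConf M (T.EdgesAt v.1),
      Quotient.mk _ q = (p.1 e).1.2 v ∧ ((b e).2 v).1 = q.1.1 ∧ ∀ c, ((b e).2 v).2 c = q.1.2 c := by
    intro e v
    exact (h e).2 v
  have h3 : ∀ e v (q : TangentConf M (T.EdgesAt v.1)),
      Quotient.mk _ q = (p.1 e).1.2 v → (q.1.1 : Euc m) = (b e).1 := by
    intro e v q hq
    rw [h1, ← (p.1 e).2 v, ← hq]
    rfl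
  refine ⟨fun e => h1 e ▸ (p.1 e).1.1.2, fun e e' he => ?_, fun e v => ?_, fun e v => ?_,
    fun e v c => ?_⟩
  · exact p.2 (Subtype.ext ((h1 e).symm.trans (he.trans (h1 e'))))
  · obtain ⟨q, hq, hq1, hq2⟩ := h2 e v
    exact hq1.trans (h3 e v q hq)
  · obtain ⟨q, hq, hq1, hq2⟩ := h2 e v
    rw [funext hq2]
    exact q.2.1
  · obtain ⟨q, hq, hq1, hq2⟩ := h2 e v
    rw [hq2, ← h3 e v q hq]
    exact q.2.2 c

/-- The element of `D_T(M)` that is represented by given data. -/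
def toInfStratum (b : InfData T m) (hb : b.IsValid M) : InfStratum T M :=
  ⟨fun e => ⟨(⟨(b e).1, hb.mem e⟩, fun v => Quotient.mk (tangentConfSetoid M (T.EdgesAt v.1))
    ⟨(⟨(b e).1, hb.mem e⟩, ((b e).2 v).2), hb.injective e v, hb.mem_tangent e v⟩), fun _ => rfl⟩,
    fun _ _ h => hb.base_injective (Subtype.ext_iff.1 h)⟩

theorem rep_toInfStratum (b : InfData T m) (hb : b.IsValid M) :
    Rep (X := InfStratum T M) b (b.toInfStratum hb) :=
  fun e => ⟨rfl, fun v => ⟨⟨(⟨(b e).1, hb.mem e⟩, ((b e).2 v).2), hb.injective e v,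
    hb.mem_tangent e v⟩, rfl, hb.base_eq e v, fun _ => rfl⟩⟩

/-- Data that represent the same element of `D_T(M)` differ by translations and scalings. -/
theorem toInfStratum_eq_iff {b b' : InfData T m} (hb : b.IsValid M) (hb' : b'.IsValid M) :
    b.toInfStratum hb = b'.toInfStratum hb' ↔ (∀ e, (b e).1 = (b' e).1) ∧
      ∀ e v, ∃ s : ℝ, 0 < s ∧ ∃ w, ∀ c, ((b' e).2 v).2 c = s • ((b e).2 v).2 c + w := by
  constructor
  · intro h
    have h1 : ∀ e, (b e).1 = (b' e).1 := fun e =>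
      congrArg (fun p : InfStratum T M => ((p.1 e).1.1 : Euc m)) h
    refine ⟨h1, fun e v => ?_⟩
    have h2 := Quotient.exact (congrArg (fun p : InfStratum T M => (p.1 e).1.2 v) h)
    obtain ⟨-, s, hs, w, -, hw⟩ := h2
    exact ⟨s, hs, w, hw⟩
  · rintro ⟨h1, h2⟩
    refine Subtype.ext (funext fun e => Subtype.ext (Prod.ext (Subtype.ext (h1 e))
      (funext fun v => Quotient.sound ?_)))
    obtain ⟨s, hs, w, hw⟩ := h2 e v
    refine ⟨Subtype.ext (h1 e), s, hs, ?_⟩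
    -- The translation is tangent as a combination of tangent vectors at any edge. Without edges it
    -- is arbitrary and may be taken to be zero.
    by_cases hI : Nonempty (T.EdgesAt v.1)
    · obtain ⟨c⟩ := hI
      refine ⟨w, ?_, hw⟩
      have h3 := hb'.mem_tangent e v c
      rw [← h1 e] at h3
      have h4 := Submodule.sub_mem _ h3 (Submodule.smul_mem _ s (hb.mem_tangent e v c))
      rwa [hw, add_sub_cancel_left] at h4
    · exact ⟨0, Submodule.zero_mem _, fun c => absurd ⟨c⟩ hI⟩

theorem toInfStratum_of_rep {b : InfData T m} {p : InfStratum T M}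
    (h : Rep (X := InfStratum T M) b p) : b.toInfStratum (isValid_of_rep h) = p :=
  rep_unique (X := InfStratum T M) (rep_toInfStratum b _) h

namespace IsValid

variable {b : InfData T m} (hb : b.IsValid M)
include hb

theorem vec_mem {c : T.V} (hc : T.Child T.root c) : b.vec c ∈ M := by
  rw [vec_root b ⟨c, hc⟩]
  exact hb.mem _

theorem vec_ne (hT : T.IsFTree) {v c c' : T.V} (hc : T.Child v c) (hc' : T.Child v c')
    (hne : c ≠ c') : b.vec c ≠ b.vec c' := by
  rcases hc.root_or_isInternal hT with rfl | hv
  · rw [vec_root b ⟨c, hc⟩, vec_root b ⟨c', hc'⟩]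
    exact fun h => hne (Subtype.ext_iff.1 (hb.base_injective h))
  · have hv' := liesOver_rootEdge hT.isTree hv.1
    rw [vec_internal hT b (rootEdge hT.isTree v hv.1) ⟨v, hv, hv'⟩ ⟨c, hc⟩,
      vec_internal hT b (rootEdge hT.isTree v hv.1) ⟨v, hv, hv'⟩ ⟨c', hc'⟩]
    exact fun h => hne (Subtype.ext_iff.1 (hb.injective _ _ h))

theorem gap_ne_zero (hT : T.IsFTree) {i j : Fin n} (hij : i ≠ j) : b.gap i j ≠ 0 := by
  obtain ⟨v, h1, h2, h3, h4, h5⟩ := exists_branch hT hij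
  exact sub_ne_zero.2 (hb.vec_ne hT h1 h2 h3)

theorem vec_mem_tangent (hT : T.IsFTree) {e v c : T.V} (he : T.Child T.root e)
    (hv : T.IsInternal v) (hve : T.LiesOver v e) (hc : T.Child v c) :
    b.vec c ∈ tangentSpaceAt M (b.vec e) := by
  rw [vec_root b ⟨e, he⟩, vec_internal hT b ⟨e, he⟩ ⟨v, hv, hve⟩ ⟨c, hc⟩]
  exact hb.mem_tangent _ _ _

end IsValid

open Classical in
/-- The ratio `d_ijk` of the point of `C_n[M]` that corresponds to given data. -/
noncomputable def ratio (b : InfData T m) (i j k : Fin n) : ENNReal :=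
  if T.branch i j = T.branch i k then ENNReal.ofReal (‖b.gap i j‖ / ‖b.gap i k‖)
  else if T.Near i j k then 0 else ⊤

/-- The vertex next to the root on the way to a leaf. -/
noncomputable def _root_.RootedGraph.trunk (hT : T.IsFTree) (i : Fin n) : T.V :=
  (rootEdge hT.isTree (T.leaf i) (leaf_ne_root hT i)).1

theorem _root_.RootedGraph.child_trunk (hT : T.IsFTree) (i : Fin n) :
    T.Child T.root (trunk hT i) :=
  (rootEdge hT.isTree (T.leaf i) (leaf_ne_root hT i)).2

theorem _root_.RootedGraph.liesOver_trunk (hT : T.IsFTree) (i : Fin n) :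
    T.LiesOver (T.leaf i) (trunk hT i) :=
  liesOver_rootEdge hT.isTree (leaf_ne_root hT i)

theorem _root_.RootedGraph.trunk_eq (hT : T.IsFTree) {i : Fin n} {c : T.V}
    (hc : T.Child T.root c) (h : T.LiesOver (T.leaf i) c) : trunk hT i = c :=
  (child_trunk hT i).eq_of_liesOver hT.isTree hc (liesOver_trunk hT i) h

/-- The point of `A_n[M]` that corresponds to given data. -/
noncomputable def toAmbient (hT : T.IsFTree) (b : InfData T m) (hb : b.IsValid M) :
    CompactAmbient n M :=
  (fun i => ⟨b.vec (trunk hT i), hb.vec_mem (child_trunk hT i)⟩,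
   fun p => ⟨‖b.gap (p.1 0) (p.1 1)‖⁻¹ • b.gap (p.1 0) (p.1 1), by
    rw [mem_sphere_zero_iff_norm, norm_smul, norm_inv, norm_norm, inv_mul_cancel₀]
    exact norm_ne_zero_iff.2 (hb.gap_ne_zero hT fun e => zero_ne_one (p.2 e))⟩,
   fun q => b.ratio (q.1 0) (q.1 1) (q.1 2))

theorem dirOf_toAmbient (hT : T.IsFTree) {b : InfData T m} (hb : b.IsValid M) {i j : Fin n}
    (hij : i ≠ j) : dirOf (b.toAmbient hT hb) i j = ‖b.gap i j‖⁻¹ • b.gap i j := by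
  rw [dirOf, dif_pos hij]
  rfl

theorem ratioOf_toAmbient (hT : T.IsFTree) {b : InfData T m} (hb : b.IsValid M) {i j k : Fin n}
    (hij : i ≠ j) (hik : i ≠ k) (hjk : j ≠ k) :
    ratioOf (b.toAmbient hT hb) i j k = b.ratio i j k := by
  rw [ratioOf, dif_pos ⟨hij, hik, hjk⟩]
  rfl

/-- Configurations converge to the given data: at each vertex the differences of points over it,
suitably rescaled, converge to the differences of the vectors at the vertex. -/
structure IsLimit (hT : T.IsFTree) (b : InfData T m) {α : Type*} (y : α → Conf (Fin n) M)
    (l : Filter α) : Prop where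
  point : ∀ i, Tendsto (fun t => ((y t).1 i : Euc m)) l (𝓝 (b.vec (trunk hT i)))
  diff : ∀ v, T.IsInternal v → ∃ r : α → ℝ, (∀ᶠ t in l, 0 < r t) ∧
    ∀ c c' i j, T.Child v c → T.Child v c' → T.LiesOver (T.leaf i) c → T.LiesOver (T.leaf j) c' →
      Tendsto (fun t => r t • diff (y t) i j) l (𝓝 (b.vec c - b.vec c'))

/-- At the root no rescaling takes place, so convergence of the points gives the scale one; root and
internal vertices can then be treated alike. -/
theorem IsLimit.exists_scale {hT : T.IsFTree} {b : InfData T m} {α : Type*}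
    {y : α → Conf (Fin n) M} {l : Filter α} (h : b.IsLimit hT y l) {v d : T.V} (hv : T.Child v d) :
    ∃ r : α → ℝ, (∀ᶠ t in l, 0 < r t) ∧
    ∀ c c' i j, T.Child v c → T.Child v c' → T.LiesOver (T.leaf i) c → T.LiesOver (T.leaf j) c' →
      Tendsto (fun t => r t • _root_.diff (y t) i j) l (𝓝 (b.vec c - b.vec c')) := by
  rcases hv.root_or_isInternal hT with rfl | hv
  · refine ⟨fun _ => 1, Eventually.of_forall fun _ => one_pos, fun c c' i j hc hc' hi hj => ?_⟩
    have h1 := h.point i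
    have h2 := h.point j
    rw [trunk_eq hT hc hi] at h1
    rw [trunk_eq hT hc' hj] at h2
    simp only [one_smul]
    exact h1.sub h2
  · exact h.diff v hv

theorem norm_inv_smul_smul {r : ℝ} (hr : 0 < r) (z : Euc m) :
    ‖r • z‖⁻¹ • r • z = ‖z‖⁻¹ • z := by
  rw [norm_smul, Real.norm_of_nonneg hr.le, smul_smul, mul_inv, mul_comm, ← mul_assoc,
    mul_inv_cancel₀ hr.ne', one_mul]

theorem norm_smul_div_norm_smul {r : ℝ} (hr : 0 < r) (z w : Euc m) :
    ‖r • z‖ / ‖r • w‖ = ‖z‖ / ‖w‖ := by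
  rw [norm_smul, norm_smul, mul_div_mul_left _ _ (norm_ne_zero_iff.2 hr.ne')]

/-- Configurations that converge to data converge to the corresponding point of `A_n[M]`. -/
theorem IsLimit.tendsto_confEmbed {hT : T.IsFTree} {b : InfData T m} (hb : b.IsValid M)
    {α : Type*} {y : α → Conf (Fin n) M} {l : Filter α} (h : b.IsLimit hT y l) :
    Tendsto (fun t => confEmbed n M (y t)) l (𝓝 (b.toAmbient hT hb)) := by
  -- At the scale of the branching point of `i` and `k`, the leaves `i` and `j` lie over the same
  -- edge. The numerator tends to zero and the denominator does not.
  have hzero : ∀ {i j k}, i ≠ k → T.Near i j k →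
      Tendsto (fun t => ‖_root_.diff (y t) i j‖ / ‖_root_.diff (y t) i k‖) l (𝓝 0) := by
    intro i j k hik hn
    obtain ⟨v, h1, h2, h3, h4, h5⟩ := exists_branch hT hik
    obtain ⟨r, hr, hlim⟩ := h.exists_scale h1
    have h6 := hlim _ _ i j h1 h1 h4 ((near_iff_liesOver_branch hT hik).1 hn)
    have h7 := hlim _ _ i k h1 h2 h4 h5
    have h8 := h6.norm.div h7.norm (norm_ne_zero_iff.2 (sub_ne_zero.2 (hb.vec_ne hT h1 h2 h3)))
    rw [sub_self, norm_zero, zero_div] at h8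
    refine h8.congr' ?_
    filter_upwards [hr] with t ht using norm_smul_div_norm_smul ht _ _
  refine tendsto_confEmbed_iff.2 ⟨h.point, fun i j hij => ?_, fun i j k hij hik hjk => ?_⟩
  · rw [dirOf_toAmbient hT hb hij]
    obtain ⟨v, h1, h2, h3, h4, h5⟩ := exists_branch hT hij
    obtain ⟨r, hr, hlim⟩ := h.exists_scale h1
    have h6 := hlim _ _ i j h1 h2 h4 h5
    refine ((h6.norm.inv₀ (norm_ne_zero_iff.2 (hb.gap_ne_zero hT hij))).smul h6).congr' ?_
    filter_upwards [hr] with t ht using norm_inv_smul_smul ht _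
  · rw [ratioOf_toAmbient hT hb hij hik hjk]
    by_cases hbr : T.branch i j = T.branch i k
    · rw [ratio, if_pos hbr]
      refine (ENNReal.continuous_ofReal.tendsto _).comp ?_
      obtain ⟨v, h1, h2, h3, h4, h5⟩ := exists_branch hT hij
      obtain ⟨w, g1, g2, g3, g4, g5⟩ := exists_branch hT hik
      obtain rfl : v = w := h1.parent_unique hT.isTree (hbr ▸ g1)
      obtain ⟨r, hr, hlim⟩ := h.exists_scale h1
      have h6 := hlim _ _ i j h1 h2 h4 h5
      have h7 := hlim _ _ i k g1 g2 g4 g5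
      refine (h6.norm.div h7.norm (norm_ne_zero_iff.2 (hb.gap_ne_zero hT hik))).congr' ?_
      filter_upwards [hr] with t ht using norm_smul_div_norm_smul ht _ _
    rw [ratio, if_neg hbr]
    rcases (branch_eq_or_near hT hij hik).resolve_left hbr with hn | hn
    · rw [if_pos hn, ← ENNReal.ofReal_zero]
      exact (ENNReal.continuous_ofReal.tendsto _).comp (hzero hik hn)
    -- The ratio tends to `∞` because the inverse ratio tends to zero.
    · rw [if_neg (hn.not_near hT)]
      have h1 := (ENNReal.continuous_ofReal.tendsto _).comp (hzero hij hn)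
      have h2 := (continuous_inv.tendsto _).comp h1
      rw [ENNReal.ofReal_zero, ENNReal.inv_zero] at h2
      refine h2.congr fun t => ?_
      have h3 := norm_pos_iff.2 (diff_ne_zero (y t) hij)
      have h4 := norm_pos_iff.2 (diff_ne_zero (y t) hik)
      rw [Function.comp_apply, Function.comp_apply, ← ENNReal.ofReal_inv_of_pos (div_pos h4 h3),
        inv_div]

end InfData

end InfData

/-! ### Configurations converging to given data -/

namespace RootedGraph

variable {n : ℕ} {T : RootedGraph n}

/-- The number of vertices on the way from a vertex to the root. -/
noncomputable def depth (T : RootedGraph n) (v : T.V) : ℕ := {w | T.LiesOver v w}.ncard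

theorem depth_lt_depth (hT : T.graph.IsTree) {v w : T.V} (h : T.LiesOver v w) (hne : v ≠ w) :
    T.depth w < T.depth v := by
  refine Set.ncard_lt_ncard ⟨fun u hu => h.trans hT hu, fun hsub => ?_⟩ (Set.toFinite _)
  exact hne (h.antisymm hT (hsub (liesOver_refl hT v)))

theorem depth_pos (hT : T.graph.IsTree) (v : T.V) : 0 < T.depth v :=
  (Set.ncard_pos (Set.toFinite _)).2 ⟨v, liesOver_refl hT v⟩

theorem one_lt_depth (hT : T.graph.IsTree) {v : T.V} (hv : v ≠ T.root) : 1 < T.depth v :=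
  (Nat.succ_le_of_lt (depth_pos hT T.root)).trans_lt (depth_lt_depth hT (liesOver_root hT v) hv)

end RootedGraph

section Curves

open RootedGraph SmoothParam

variable {m n d : ℕ} {T : RootedGraph n} {M : Set (Euc m)}

namespace InfData

open Classical in
/-- The part at the vertex `c` of the displacement of a leaf set over the root edge `e`. -/
noncomputable def displacementAt (b : InfData T m) (e c : T.V) (P : Prop) (ε : ℝ) : Euc m :=
  if T.LiesOver c e ∧ c ≠ e ∧ P then ε ^ T.depth c • b.vec c else 0

open Classical in
/-- The displacement of the leaf `i` over the root edge `e`, from the point of `M` at `e`: the sum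
of the vectors on the way from `e` to `i`, scaled by powers of `ε`. -/
noncomputable def displacement (b : InfData T m) (e : T.V) (i : Fin n) (ε : ℝ) : Euc m :=
  letI := Fintype.ofFinite T.V
  ∑ c, b.displacementAt e c (T.LiesOver (T.leaf i) c) ε

theorem displacement_mem (hT : T.IsFTree) {b : InfData T m} (hb : b.IsValid M) {e : T.V}
    (he : T.Child T.root e) (i : Fin n) (ε : ℝ) :
    b.displacement e i ε ∈ tangentSpaceAt M (b.vec e) := by
  refine Submodule.sum_mem _ fun c _ => ?_
  rw [displacementAt]
  split_ifs with h
  · obtain ⟨h1, h2, -⟩ := h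
    have hc : c ≠ T.root := by
      rintro rfl
      exact h2 (h1.antisymm hT.isTree (liesOver_root hT.isTree e))
    obtain ⟨v, hv⟩ := exists_parent hT.isTree hc
    have hve := ((hv.liesOver_iff hT.isTree).1 h1).resolve_left h2.symm
    have hvi : T.IsInternal v := by
      refine (hv.root_or_isInternal hT).resolve_left ?_
      rintro rfl
      exact he.ne (hve.antisymm hT.isTree (liesOver_root hT.isTree e))
    exact Submodule.smul_mem _ _ (hb.vec_mem_tangent hT he hvi hve hv)
  · exact Submodule.zero_mem _

/-- Only vertices other than the root enter, and their depth is at least two because the root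
already has depth one. This leaves room for the inward push of order `ε`. -/
theorem displacement_isLittleO (hT : T.IsFTree) (b : InfData T m) (e : T.V)
    (i : Fin n) : b.displacement e i =o[𝓝[>] 0] fun ε : ℝ => ε := by
  let _ := Fintype.ofFinite T.V
  have hsum : ∀ c, (fun ε => b.displacementAt e c (T.LiesOver (T.leaf i) c) ε) =o[𝓝[>] 0]
      fun ε : ℝ => ε := by
    intro c
    simp only [displacementAt]
    split_ifs with h
    · have hc : c ≠ T.root := by
        rintro rfl
        exact h.2.1 (h.1.antisymm hT.isTree (liesOver_root hT.isTree e))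
      have h1 : (fun ε : ℝ => ε ^ T.depth c) =o[𝓝[>] 0] fun ε => ε :=
        (Asymptotics.isLittleO_pow_id (one_lt_depth hT.isTree hc)).mono nhdsWithin_le_nhds
      have h2 : (fun _ : ℝ => b.vec c) =O[𝓝[>] 0] fun _ => (1 : ℝ) :=
        Asymptotics.isBigO_const_const _ one_ne_zero _
      simpa using h1.smul_isBigO h2
    · exact Asymptotics.isLittleO_zero _ _
  exact Asymptotics.IsLittleO.fun_sum (s := Finset.univ) fun c _ => hsum c

/-- Children of `v` have depth one more than `v`. In the difference the terms up to `v` cancel,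
those at `c` and `c'` survive the scaling, and those further up have higher order in `ε`. -/
theorem tendsto_displacement (hT : T.IsFTree) (b : InfData T m) {e v c c' : T.V}
    (hve : T.LiesOver v e) (hc : T.Child v c) (hc' : T.Child v c') {i j : Fin n}
    (hi : T.LiesOver (T.leaf i) c) (hj : T.LiesOver (T.leaf j) c') :
    Tendsto (fun ε : ℝ => (ε ^ (T.depth v + 1))⁻¹ • (b.displacement e i ε - b.displacement e j ε))
      (𝓝[>] 0) (𝓝 (b.vec c - b.vec c')) := by
  classical
  let _ := Fintype.ofFinite T.V
  have hT' := hT.isTree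
  -- The part of the displacement up to `v`, which does not depend on the leaf, is subtracted, so
  -- each leaf can be treated by itself.
  have key : ∀ {c i}, T.Child v c → T.LiesOver (T.leaf i) c →
      Tendsto (fun ε : ℝ => (ε ^ (T.depth v + 1))⁻¹ • (b.displacement e i ε -
        ∑ d, b.displacementAt e d (T.LiesOver v d) ε)) (𝓝[>] 0) (𝓝 (b.vec c)) := by
    intro c i hc hi
    have hdepth : T.depth c = T.depth v + 1 := by
      have h1 : {w | T.LiesOver c w} = insert c {w | T.LiesOver v w} := by
        ext w
        exact hc.liesOver_iff hT'
      rw [depth, h1, Set.ncard_insert_of_notMem]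
      · rfl
      · exact fun h => hc.ne (LiesOver.antisymm hT' h hc.2)
    have hterm : ∀ d, Tendsto (fun ε : ℝ => (ε ^ (T.depth v + 1))⁻¹ •
        (b.displacementAt e d (T.LiesOver (T.leaf i) d) ε -
          b.displacementAt e d (T.LiesOver v d) ε)) (𝓝[>] 0) (𝓝 (if d = c then b.vec d else 0)) := by
      intro d
      by_cases hdc : d = c
      · subst hdc
        have h1 : T.LiesOver d e ∧ d ≠ e ∧ T.LiesOver (T.leaf i) d := by
          refine ⟨hc.2.trans hT' hve, ?_, hi⟩
          rintro rfl
          exact hc.ne (hve.antisymm hT' hc.2)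
        have h2 : ¬(T.LiesOver d e ∧ d ≠ e ∧ T.LiesOver v d) := fun h =>
          hc.ne (h.2.2.antisymm hT' hc.2)
        simp only [displacementAt, if_pos h1, if_neg h2, sub_zero, if_true]
        refine tendsto_const_nhds.congr' ?_
        filter_upwards [self_mem_nhdsWithin] with ε hε
        have hε : 0 < ε := hε
        rw [smul_smul, hdepth, inv_mul_cancel₀ (pow_pos hε _).ne', one_smul]
      · rw [if_neg hdc]
        by_cases hvd : T.LiesOver v d
        · have h1 : T.LiesOver (T.leaf i) d := (hi.trans hT' hc.2).trans hT' hvd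
          simp only [displacementAt, h1, hvd, sub_self, smul_zero]
          exact tendsto_const_nhds
        by_cases hcond : T.LiesOver d e ∧ d ≠ e ∧ T.LiesOver (T.leaf i) d
        · have h2 : ¬(T.LiesOver d e ∧ d ≠ e ∧ T.LiesOver v d) := fun h => hvd h.2.2
          have h3 : T.LiesOver d c := by
            refine (hcond.2.2.total hT' hi).resolve_right fun h => ?_
            exact ((hc.liesOver_iff hT').1 h).elim hdc hvd
          have h4 : T.depth v + 1 < T.depth d := hdepth ▸ depth_lt_depth hT' h3 hdc
          obtain ⟨k, hk⟩ := Nat.exists_eq_add_of_lt h4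
          simp only [displacementAt, if_pos hcond, if_neg h2, sub_zero]
          have h5 : Tendsto (fun ε : ℝ => ε ^ (k + 1) • b.vec d) (𝓝[>] 0) (𝓝 0) := by
            have : Continuous fun ε : ℝ => ε ^ (k + 1) • b.vec d := by fun_prop
            simpa using (this.tendsto 0).mono_left nhdsWithin_le_nhds
          refine h5.congr' ?_
          filter_upwards [self_mem_nhdsWithin] with ε hε
          have hε : 0 < ε := hε
          rw [smul_smul, hk, add_assoc (T.depth v + 1), pow_add _ (T.depth v + 1),
            inv_mul_cancel_left₀ (pow_pos hε _).ne']
        · have h2 : ¬(T.LiesOver d e ∧ d ≠ e ∧ T.LiesOver v d) := fun h => hvd h.2.2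
          simp only [displacementAt, if_neg hcond, if_neg h2, sub_self, smul_zero]
          exact tendsto_const_nhds
    have hsum := tendsto_finsetSum Finset.univ fun d _ => hterm d
    rw [Finset.sum_ite_eq' Finset.univ c, if_pos (Finset.mem_univ c)] at hsum
    refine hsum.congr fun ε => ?_
    rw [← Finset.smul_sum, Finset.sum_sub_distrib]
    rfl
  refine ((key hc hi).sub (key hc' hj)).congr fun ε => ?_
  rw [← smul_sub, sub_sub_sub_cancel_right]

/-- Data that represent an element of `D_T(M)` are a limit of configurations. -/
theorem exists_isLimit (hM : IsSmoothSubmanifold d M) (hT : T.IsFTree) {b : InfData T m}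
    (hb : b.IsValid M) : ∃ (α : Type) (l : Filter α) (y : α → Conf (Fin n) M),
      l.NeBot ∧ b.IsLimit hT y l := by
  have hT' := hT.isTree
  choose y hyM hylim hydiff using fun e : T.EdgesAt T.root =>
    hM.exists_curves (hb.vec_mem e.2) (b.displacement e.1) (displacement_mem hT hb e.2)
      (displacement_isLittleO hT b e.1)
  -- Curves are taken separately around the point of each root edge; each leaf follows the one of
  -- its own root edge.
  let E : Fin n → T.EdgesAt T.root := fun i => rootEdge hT' (T.leaf i) (leaf_ne_root hT i)
  let Y : ℝ → Fin n → Euc m := fun ε i => y (E i) i ε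
  have hE : ∀ {v c i} (e : T.EdgesAt T.root), T.LiesOver v e.1 → T.Child v c →
      T.LiesOver (T.leaf i) c → E i = e := fun e hve hc hi =>
    rootEdge_eq hT' _ ((hi.trans hT' hc.2).trans hT' hve)
  have hpoint : ∀ i, Tendsto (fun ε => Y ε i) (𝓝[>] 0) (𝓝 (b.vec (trunk hT i))) := fun i =>
    hylim (E i) i
  have hdiff : ∀ v, T.IsInternal v → ∀ c c' i j, T.Child v c → T.Child v c' →
      T.LiesOver (T.leaf i) c → T.LiesOver (T.leaf j) c' →
      Tendsto (fun ε => (ε ^ (T.depth v + 1))⁻¹ • (Y ε i - Y ε j)) (𝓝[>] 0)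
        (𝓝 (b.vec c - b.vec c')) := by
    intro v hv c c' i j hc hc' hi hj
    have hve := liesOver_rootEdge hT' hv.1
    simp only [Y, hE _ hve hc hi, hE _ hve hc' hj]
    exact hydiff _ i j _ _ (tendsto_displacement hT b hve hc hc' hi hj)
  have hne : ∀ i j, i ≠ j → ∀ᶠ ε in 𝓝[>] 0, Y ε i ≠ Y ε j := by
    intro i j hij
    obtain ⟨v, h1, h2, h3, h4, h5⟩ := exists_branch hT hij
    have h6 := sub_ne_zero.2 (hb.vec_ne hT h1 h2 h3)
    rcases h1.root_or_isInternal hT with rfl | hv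
    · have h7 := (hpoint i).sub (hpoint j)
      rw [trunk_eq hT h1 h4, trunk_eq hT h2 h5] at h7
      filter_upwards [h7.eventually_ne h6] with ε hε using sub_ne_zero.1 hε
    · filter_upwards [(hdiff v hv _ _ i j h1 h2 h4 h5).eventually_ne h6] with ε hε
      rintro h
      rw [h, sub_self, smul_zero] at hε
      exact hε rfl
  have hgood : ∀ᶠ ε in 𝓝[>] (0 : ℝ), (∀ i, Y ε i ∈ M) ∧ Function.Injective (Y ε) := by
    refine (eventually_all.2 fun i => hyM (E i) i).and ?_
    have := eventually_all.2 fun i => eventually_all.2 fun j => eventually_imp_distrib_left.2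
      (hne i j)
    filter_upwards [this] with ε hε i j h
    by_contra hij
    exact hε i j hij h
  -- The points lie in `M` and are distinct only for small `ε`, so the index set is cut down to the
  -- good values, which occur in every set of the filter.
  let α := {ε : ℝ // (∀ i, Y ε i ∈ M) ∧ Function.Injective (Y ε)}
  have hval : Tendsto (Subtype.val : α → ℝ) (comap Subtype.val (𝓝[>] 0)) (𝓝[>] 0) := tendsto_comap
  refine ⟨α, comap Subtype.val (𝓝[>] 0), fun ε => ⟨fun i => ⟨Y ε.1 i, ε.2.1 i⟩,
    fun i j h => ε.2.2 (Subtype.ext_iff.1 h)⟩, ?_, ?_, ?_⟩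
  · rw [comap_neBot_iff]
    intro t ht
    obtain ⟨ε, h1, h2⟩ := (hgood.and ht).exists
    exact ⟨⟨ε, h1⟩, h2⟩
  · exact fun i => (hpoint i).comp hval
  · intro v hv
    refine ⟨fun ε => (ε.1 ^ (T.depth v + 1))⁻¹, ?_, fun c c' i j hc hc' hi hj =>
      (hdiff v hv c c' i j hc hc' hi hj).comp hval⟩
    filter_upwards [hval.eventually self_mem_nhdsWithin] with ε hε
    exact inv_pos.2 (pow_pos hε _)

end InfData

end Curves

/-! ### Data read off the coordinates of a point -/

section DataOf

open RootedGraph SmoothParam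

variable {m n d : ℕ} {T : RootedGraph n} {M : Set (Euc m)}

namespace RootedGraph

/-- A leaf over the upper endpoint of an edge. -/
noncomputable def edgeLeaf (hT : T.IsFTree) {v : T.V} (c : T.EdgesAt v) : Fin n :=
  (exists_leaf_liesOver hT (Child.ne_root hT.isTree c.2)).choose

theorem liesOver_edgeLeaf (hT : T.IsFTree) {v : T.V} (c : T.EdgesAt v) :
    T.LiesOver (T.leaf (edgeLeaf hT c)) c.1 :=
  (exists_leaf_liesOver hT (Child.ne_root hT.isTree c.2)).choose_spec

theorem exists_edges_of_isInternal (hT : T.IsFTree) {v : T.V} (hv : T.IsInternal v) :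
    ∃ p : T.EdgesAt v × T.EdgesAt v, p.1 ≠ p.2 := by
  obtain ⟨c, c', hc, hc', hne⟩ := exists_children_of_isInternal hT hv
  exact ⟨(⟨c, hc⟩, ⟨c', hc'⟩), fun h => hne (Subtype.ext_iff.1 h)⟩

/-- Two edges at an internal vertex. -/
noncomputable def edgePair (hT : T.IsFTree) {v : T.V} (hv : T.IsInternal v) :
    T.EdgesAt v × T.EdgesAt v :=
  (exists_edges_of_isInternal hT hv).choose

theorem edgePair_ne (hT : T.IsFTree) {v : T.V} (hv : T.IsInternal v) :
    (edgePair hT hv).1.1 ≠ (edgePair hT hv).2.1 :=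
  fun h => (exists_edges_of_isInternal hT hv).choose_spec (Subtype.ext h)

/-- The leaf at which the vectors at an internal vertex are based. -/
noncomputable def baseLeaf (hT : T.IsFTree) {v : T.V} (hv : T.IsInternal v) : Fin n :=
  edgeLeaf hT (edgePair hT hv).1

/-- The leaf that determines the scale of the vectors at an internal vertex. -/
noncomputable def scaleLeaf (hT : T.IsFTree) {v : T.V} (hv : T.IsInternal v) : Fin n :=
  edgeLeaf hT (edgePair hT hv).2

theorem ne_of_liesOver (hT : T.IsFTree) {v c c' : T.V} (hc : T.Child v c) (hc' : T.Child v c')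
    (hne : c ≠ c') {i j : Fin n} (hi : T.LiesOver (T.leaf i) c) (hj : T.LiesOver (T.leaf j) c') :
    i ≠ j := by
  rintro rfl
  exact hc.not_liesOver hT hc' hne hi hj

theorem baseLeaf_ne_scaleLeaf (hT : T.IsFTree) {v : T.V} (hv : T.IsInternal v) :
    baseLeaf hT hv ≠ scaleLeaf hT hv :=
  ne_of_liesOver hT (edgePair hT hv).1.2 (edgePair hT hv).2.2 (edgePair_ne hT hv)
    (liesOver_edgeLeaf hT _) (liesOver_edgeLeaf hT _)

end RootedGraph

/-- The data of a point of `C_T(M)`. -/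
noncomputable def dataOf (hT : T.IsFTree) (x : CompactAmbient n M) : InfData T m := fun e =>
  (x.1 (edgeLeaf hT e), fun v => (x.1 (edgeLeaf hT e), fun c =>
    (ratioOf x (baseLeaf hT v.2.1) (edgeLeaf hT c) (scaleLeaf hT v.2.1)).toReal •
      dirOf x (edgeLeaf hT c) (baseLeaf hT v.2.1)))

theorem vec_dataOf (hT : T.IsFTree) (x : CompactAmbient n M) {v : T.V} (hv : T.IsInternal v)
    (c : T.EdgesAt v) : (dataOf hT x).vec c.1 =
      (ratioOf x (baseLeaf hT hv) (edgeLeaf hT c) (scaleLeaf hT hv)).toReal •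
        dirOf x (edgeLeaf hT c) (baseLeaf hT hv) :=
  InfData.vec_internal hT _ (rootEdge hT.isTree v hv.1)
    ⟨v, hv, liesOver_rootEdge hT.isTree hv.1⟩ c

section Limit

variable {α : Type*} {l : Filter α} {y : α → Conf (Fin n) M} {x : CompactAmbient n M}
  (hT : T.IsFTree) (hy : Tendsto (fun t => confEmbed n M (y t)) l (𝓝 x)) [l.NeBot]
  (hx : (treeOf x).Iso T)
include hT hy hx

theorem eq_of_liesOver_rootChild {e : T.V} (he : e ≠ T.root) {i j : Fin n}
    (hi : T.LiesOver (T.leaf i) e) (hj : T.LiesOver (T.leaf j) e) : x.1 i = x.1 j := by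
  by_cases hij : i = j
  · rw [hij]
  · exact (((treeOf_iso_iff_of_tendsto hy hT).1 hx).2 i j hij).2 ⟨e, he, hi, hj⟩

/-- As `i` and `k` branch at `v`, every vertex under both is under `v` and hence under `j`. So `i`
and `k` do not exclude `j`. -/
theorem isBigO_diff_of_child {v c c' c'' : T.V} (hc : T.Child v c) (hc' : T.Child v c')
    (hc'' : T.Child v c'') (hne : c ≠ c'') {i j k : Fin n} (hi : T.LiesOver (T.leaf i) c)
    (hj : T.LiesOver (T.leaf j) c') (hk : T.LiesOver (T.leaf k) c'') :
    (fun t => diff (y t) i j) =O[l] fun t => diff (y t) i k := by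
  refine isBigO_diff_of_not_exclusionOf hy (ne_of_liesOver hT hc hc'' hne hi hk) fun h => ?_
  obtain ⟨w, hwi, hwk, hwj⟩ := ((((treeOf_iso_iff_of_tendsto hy hT).1 hx).1 i k j).1 h).2
  have hkc := hc''.not_liesOver hT hc hne.symm hk
  rcases hwi.total hT.isTree hi with h | h
  · exact hkc (hwk.trans hT.isTree h)
  · rcases (hc.liesOver_iff hT.isTree).1 h with rfl | h
    · exact hkc hwk
    · exact hwj ((hj.trans hT.isTree hc'.2).trans hT.isTree h)

/-- The vertex `c` witnesses that `i` and `j` exclude `k`. -/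
theorem isLittleO_diff_of_child {v c c' : T.V} (hc : T.Child v c) (hc' : T.Child v c')
    (hne : c ≠ c') {i j k : Fin n} (hi : T.LiesOver (T.leaf i) c) (hj : T.LiesOver (T.leaf j) c)
    (hk : T.LiesOver (T.leaf k) c') : (fun t => diff (y t) i j) =o[l] fun t => diff (y t) i k := by
  by_cases hij : i = j
  · subst hij
    simpa only [diff_self] using Asymptotics.isLittleO_zero _ _
  have h := ((((treeOf_iso_iff_of_tendsto hy hT).1 hx).1 i j k).2 ⟨⟨hij,
    ne_of_liesOver hT hc hc' hne hi hk, ne_of_liesOver hT hc hc' hne hj hk⟩, c, hi, hj,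
      hc'.not_liesOver hT hc hne.symm hk⟩)
  exact ((exclusionOf_iff_isLittleO hy).1 h).2.2

/-- An infinite ratio would make the scale negligible against a difference that is bounded by it. -/
theorem ratioOf_baseLeaf_ne_top {v : T.V} (hv : T.IsInternal v) (c : T.EdgesAt v) :
    ratioOf x (baseLeaf hT hv) (edgeLeaf hT c) (scaleLeaf hT hv) ≠ ⊤ := by
  by_cases hc : edgeLeaf hT c = baseLeaf hT hv
  · simp [ratioOf, hc]
  rw [ratioOf_swap hy (baseLeaf_ne_scaleLeaf hT hv) (Ne.symm hc), ENNReal.inv_ne_top, Ne,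
    ratioOf_eq_zero_iff hy (baseLeaf_ne_scaleLeaf hT hv) (Ne.symm hc)]
  intro h
  have h2 := isBigO_diff_of_child hT hy hx (edgePair hT hv).1.2 c.2 (edgePair hT hv).2.2
    (edgePair_ne hT hv) (liesOver_edgeLeaf hT _) (liesOver_edgeLeaf hT c) (liesOver_edgeLeaf hT _)
  exact Asymptotics.isLittleO_irrefl (Eventually.of_forall fun t =>
    diff_ne_zero (y t) (Ne.symm hc)).frequently (h2.trans_isLittleO h)

theorem tendsto_smul_diff_baseLeaf {v : T.V} (hv : T.IsInternal v) (c : T.EdgesAt v) :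
    Tendsto (fun t => ‖diff (y t) (baseLeaf hT hv) (scaleLeaf hT hv)‖⁻¹ •
      diff (y t) (edgeLeaf hT c) (baseLeaf hT hv)) l (𝓝 ((dataOf hT x).vec c.1)) := by
  rw [vec_dataOf]
  -- At the base leaf the ratio has its default value one, but the direction is zero, so the vector
  -- vanishes as it should. At the scale leaf the default value one is the correct ratio.
  by_cases hc : edgeLeaf hT c = baseLeaf hT hv
  · simp [hc, dirOf, diff_self]
  refine ((tendsto_ratio_toReal hy (Ne.symm hc) (baseLeaf_ne_scaleLeaf hT hv)
    (ratioOf_baseLeaf_ne_top hT hy hx hv c)).smul (tendsto_dir hy _ _)).congr fun t => ?_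
  have h3 := norm_ne_zero_iff.2 (diff_ne_zero (y t) hc)
  rw [← neg_diff (y t) (edgeLeaf hT c) (baseLeaf hT hv), norm_neg, smul_smul, div_eq_inv_mul,
    mul_assoc, mul_inv_cancel₀ h3, mul_one]

/-- The leaf representing an edge may be replaced by any other leaf over it: on the scale of `v` the
difference disappears. -/
theorem tendsto_smul_diff_edgeLeaf {v : T.V} (hv : T.IsInternal v) (c : T.EdgesAt v) {i : Fin n}
    (hi : T.LiesOver (T.leaf i) c.1) :
    Tendsto (fun t => ‖diff (y t) (baseLeaf hT hv) (scaleLeaf hT hv)‖⁻¹ •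
      diff (y t) i (edgeLeaf hT c)) l (𝓝 0) := by
  have h1 : (fun t => diff (y t) i (edgeLeaf hT c)) =o[l]
      fun t => diff (y t) (baseLeaf hT hv) (scaleLeaf hT hv) := by
    simp only [← neg_diff _ (edgeLeaf hT c) i]
    refine Asymptotics.IsLittleO.neg_left ?_
    -- Some leaf over a different edge is needed for comparison: the scale leaf for the base edge,
    -- the base leaf otherwise.
    by_cases hc : (edgePair hT hv).1 = c
    · subst hc
      exact isLittleO_diff_of_child hT hy hx (edgePair hT hv).1.2 (edgePair hT hv).2.2
        (edgePair_ne hT hv) (liesOver_edgeLeaf hT _) hi (liesOver_edgeLeaf hT _)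
    · have h2 := isLittleO_diff_of_child hT hy hx c.2 (edgePair hT hv).1.2
        (fun h => hc (Subtype.ext h.symm)) (liesOver_edgeLeaf hT c) hi (liesOver_edgeLeaf hT _)
      have h3 := isBigO_diff_of_child hT hy hx (edgePair hT hv).1.2 c.2 (edgePair hT hv).2.2
        (edgePair_ne hT hv) (liesOver_edgeLeaf hT _) (liesOver_edgeLeaf hT c)
        (liesOver_edgeLeaf hT _)
      exact h2.trans_isBigO (h3.neg_left.congr_left fun t => neg_diff _ _ _)
  exact (h1.norm_right).tendsto_inv_smul_nhds_zero

theorem tendsto_smul_diff {v c c' : T.V} (hv : T.IsInternal v) (hc : T.Child v c)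
    (hc' : T.Child v c') {i j : Fin n} (hi : T.LiesOver (T.leaf i) c)
    (hj : T.LiesOver (T.leaf j) c') :
    Tendsto (fun t => ‖diff (y t) (baseLeaf hT hv) (scaleLeaf hT hv)‖⁻¹ • diff (y t) i j) l
      (𝓝 ((dataOf hT x).vec c - (dataOf hT x).vec c')) := by
  have h1 := (tendsto_smul_diff_edgeLeaf hT hy hx hv ⟨c, hc⟩ hi).add
    (tendsto_smul_diff_baseLeaf hT hy hx hv ⟨c, hc⟩)
  have h2 := (tendsto_smul_diff_edgeLeaf hT hy hx hv ⟨c', hc'⟩ hj).add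
    (tendsto_smul_diff_baseLeaf hT hy hx hv ⟨c', hc'⟩)
  have h3 := h1.sub h2
  rw [zero_add, zero_add] at h3
  refine h3.congr fun t => ?_
  rw [← smul_add, ← smul_add, ← smul_sub]
  simp only [diff]
  congr 1
  abel

theorem isLimit_dataOf : (dataOf hT x).IsLimit hT y l := by
  refine ⟨fun i => ?_, fun v hv => ⟨fun t => ‖diff (y t) (baseLeaf hT hv) (scaleLeaf hT hv)‖⁻¹,
    Eventually.of_forall fun t => inv_pos.2 (norm_pos_iff.2 (diff_ne_zero _
      (baseLeaf_ne_scaleLeaf hT hv))),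
    fun c c' i j hc hc' hi hj => tendsto_smul_diff hT hy hx hv hc hc' hi hj⟩⟩
  have h : (dataOf hT x).vec (trunk hT i) = x.1 i := by
    rw [InfData.vec_root _ ⟨_, child_trunk hT i⟩]
    exact congrArg Subtype.val (eq_of_liesOver_rootChild hT hy hx
      ((child_trunk hT i).ne_root hT.isTree) (liesOver_edgeLeaf hT _) (liesOver_trunk hT i))
  rw [h]
  exact tendsto_point hy i

/-- Equal vectors would make the difference of the two leaves negligible on the scale of `v`. But
these leaves branch at `v`, so the scale is bounded by their difference, which is never zero. -/
theorem vec_dataOf_ne {v : T.V} (hv : T.IsInternal v) {c c' : T.EdgesAt v} (hne : c.1 ≠ c'.1) :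
    (dataOf hT x).vec c.1 ≠ (dataOf hT x).vec c'.1 := by
  intro h
  have h1 := tendsto_smul_diff hT hy hx hv c.2 c'.2 (liesOver_edgeLeaf hT c)
    (liesOver_edgeLeaf hT c')
  rw [h, sub_self] at h1
  have hO := isBigO_diff_of_child hT hy hx (k := edgeLeaf hT c') c.2 (edgePair hT hv).1.2 c'.2 hne
    (liesOver_edgeLeaf hT c) (liesOver_edgeLeaf hT _) (liesOver_edgeLeaf hT c')
  have hO' : (fun t => diff (y t) (baseLeaf hT hv) (scaleLeaf hT hv)) =O[l]
      fun t => diff (y t) (edgeLeaf hT c) (edgeLeaf hT c') := by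
    by_cases hc : (edgePair hT hv).1 = c
    · subst hc
      exact isBigO_diff_of_child hT hy hx (edgePair hT hv).1.2 (edgePair hT hv).2.2 c'.2 hne
        (liesOver_edgeLeaf hT _) (liesOver_edgeLeaf hT _) (liesOver_edgeLeaf hT c')
    · refine (isBigO_diff_of_child hT hy hx (edgePair hT hv).1.2 (edgePair hT hv).2.2 c.2
        (fun h => hc (Subtype.ext h)) (liesOver_edgeLeaf hT _) (liesOver_edgeLeaf hT _)
        (liesOver_edgeLeaf hT c)).trans ?_
      exact hO.neg_left.congr_left fun t => neg_diff _ _ _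
  have ho : (fun t => diff (y t) (edgeLeaf hT c) (edgeLeaf hT c')) =o[l]
      fun t => diff (y t) (baseLeaf hT hv) (scaleLeaf hT hv) := by
    refine (Asymptotics.isLittleO_of_tendsto (fun t ht => absurd ht (norm_ne_zero_iff.2
      (diff_ne_zero _ (baseLeaf_ne_scaleLeaf hT hv)))) ?_).of_norm_norm
    rw [← norm_zero (E := Euc m)]
    refine h1.norm.congr fun t => ?_
    rw [norm_smul, norm_inv, norm_norm, div_eq_inv_mul]
  exact Asymptotics.isLittleO_irrefl (Eventually.of_forall fun t => diff_ne_zero (y t)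
    (ne_of_liesOver hT c.2 c'.2 hne (liesOver_edgeLeaf hT c) (liesOver_edgeLeaf hT c'))).frequently
      (ho.trans_isBigO hO')

/-- Distinct root edges have distinct points by the coordinate form of the tree condition; tangency
holds because the vectors are limits of rescaled secants. -/
theorem isValid_dataOf (hM : IsSmoothSubmanifold d M) : (dataOf hT x).IsValid M := by
  refine ⟨fun e => (x.1 _).2, fun e e' h => ?_, fun e v => rfl, fun e v c c' h => ?_,
    fun e v c => ?_⟩
  · by_contra hne
    have hne' : e.1 ≠ e'.1 := fun h => hne (Subtype.ext h)
    have hij := ne_of_liesOver hT e.2 e'.2 hne' (liesOver_edgeLeaf hT e) (liesOver_edgeLeaf hT e')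
    obtain ⟨v, hv, h1, h2⟩ := (((treeOf_iso_iff_of_tendsto hy hT).1 hx).2 _ _ hij).1
      (Subtype.ext h)
    obtain ⟨c, hc, hvc⟩ := exists_child_of_liesOver hT.isTree (liesOver_root hT.isTree v) hv
    refine hne' ((Child.eq_of_liesOver hT.isTree e.2 hc (liesOver_edgeLeaf hT e)
      (h1.trans hT.isTree hvc)).trans (Child.eq_of_liesOver hT.isTree e'.2 hc (liesOver_edgeLeaf hT e')
      (h2.trans hT.isTree hvc)).symm)
  · by_contra hne
    have := vec_dataOf_ne hT hy hx v.2.1 (c := c) (c' := c') fun h => hne (Subtype.ext h)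
    rw [vec_dataOf hT x v.2.1, vec_dataOf hT x v.2.1] at this
    exact this h
  · have h1 := tendsto_smul_diff_baseLeaf hT hy hx v.2.1 c
    rw [vec_dataOf hT x v.2.1] at h1
    have h2 : ∀ {i : Fin n}, T.LiesOver (T.leaf i) v.1 →
        Tendsto (fun t => ((y t).1 i : Euc m)) l (𝓝 (x.1 (edgeLeaf hT e))) := by
      intro i hi
      rw [← eq_of_liesOver_rootChild hT hy hx (Child.ne_root hT.isTree e.2)
        (hi.trans hT.isTree v.2.2) (liesOver_edgeLeaf hT e)]
      exact tendsto_point hy i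
    exact hM.mem_tangentSpaceAt_of_secant (x.1 (edgeLeaf hT e)).2
      (h2 ((liesOver_edgeLeaf hT c).trans hT.isTree c.2.2))
      (h2 ((liesOver_edgeLeaf hT _).trans hT.isTree (edgePair hT v.2.1).1.2.2))
      (fun t => ((y t).1 _).2) (fun t => ((y t).1 _).2) h1

end Limit

end DataOf

/-! ### The bijection between `C_T(M)` and `D_T(M)` -/

section Bijection

open RootedGraph SmoothParam

variable {m n d : ℕ} {T : RootedGraph n} {M : Set (Euc m)}

namespace InfData

/-- Data that represent the same element of `D_T(M)` are limits of the same configurations. -/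
theorem IsLimit.congr {hT : T.IsFTree} {b b' : InfData T m} {α : Type*} {y : α → Conf (Fin n) M}
    {l : Filter α} (h : b.IsLimit hT y l) (h1 : ∀ e, (b e).1 = (b' e).1)
    (h2 : ∀ e v, ∃ s : ℝ, 0 < s ∧ ∃ w, ∀ c, ((b' e).2 v).2 c = s • ((b e).2 v).2 c + w) :
    b'.IsLimit hT y l := by
  refine ⟨fun i => ?_, fun v hv => ?_⟩
  · rw [vec_root b' ⟨_, child_trunk hT i⟩, ← h1, ← vec_root b ⟨_, child_trunk hT i⟩]
    exact h.point i
  · obtain ⟨r, hr, hlim⟩ := h.diff v hv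
    obtain ⟨s, hs, w, hw⟩ := h2 (rootEdge hT.isTree v hv.1)
      ⟨v, hv, liesOver_rootEdge hT.isTree hv.1⟩
    have hvec : ∀ c, T.Child v c → b'.vec c = s • b.vec c + w := fun c hc => by
      rw [vec_internal hT b' (rootEdge hT.isTree v hv.1)
        ⟨v, hv, liesOver_rootEdge hT.isTree hv.1⟩ ⟨c, hc⟩, hw,
        ← vec_internal hT b (rootEdge hT.isTree v hv.1)]
    refine ⟨fun t => s * r t, hr.mono fun t ht => mul_pos hs ht, fun c c' i j hc hc' hi hj => ?_⟩
    rw [hvec c hc, hvec c' hc', add_sub_add_right_eq_sub, ← smul_sub]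
    refine ((hlim c c' i j hc hc' hi hj).const_smul s).congr fun t => ?_
    rw [smul_smul]

theorem ratio_eq_zero_iff (hT : T.IsFTree) {i j k : Fin n} (hij : i ≠ j) (hik : i ≠ k)
    {b : InfData T m} (hb : b.IsValid M) : b.ratio i j k = 0 ↔ T.Near i j k := by
  rw [ratio]
  split_ifs with h1 h2
  · refine iff_of_false (fun h => ?_) (not_near_of_branch_eq hT hij hik h1)
    rw [ENNReal.ofReal_eq_zero] at h
    have := norm_pos_iff.2 (hb.gap_ne_zero hT hij)
    have := norm_pos_iff.2 (hb.gap_ne_zero hT hik)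
    exact absurd h (not_le.2 (by positivity))
  · simpa using h2
  · simpa using h2

theorem treeOf_toAmbient_iso (hM : IsSmoothSubmanifold d M) (hT : T.IsFTree) {b : InfData T m}
    (hb : b.IsValid M) : (treeOf (b.toAmbient hT hb)).Iso T := by
  obtain ⟨α, l, y, hl, hy⟩ := exists_isLimit hM hT hb
  -- Realizing the data by configurations makes the coordinate form of the tree condition available;
  -- it is then checked on the explicit coordinates.
  refine (treeOf_iso_iff_of_tendsto (hy.tendsto_confEmbed hb) hT).2 ⟨fun i j k => ?_,
    fun i j hij => ?_⟩
  · rw [exclusionOf_iff]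
    refine and_congr_right fun h => ?_
    rw [ratioOf_toAmbient hT hb h.1 h.2.1 h.2.2, ratio_eq_zero_iff hT h.1 h.2.1 hb]
  · constructor
    · intro h
      have h1 : b.vec (trunk hT i) = b.vec (trunk hT j) := Subtype.ext_iff.1 h
      refine ⟨trunk hT i, (child_trunk hT i).ne_root hT.isTree, liesOver_trunk hT i, ?_⟩
      by_cases hne : trunk hT i = trunk hT j
      · rw [hne]
        exact liesOver_trunk hT j
      · exact absurd h1 (hb.vec_ne hT (child_trunk hT i) (child_trunk hT j) hne)
    · rintro ⟨v, hv, hi, hj⟩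
      obtain ⟨c, hc, hvc⟩ := exists_child_of_liesOver hT.isTree (liesOver_root hT.isTree v) hv
      have h1 := trunk_eq hT hc (LiesOver.trans hT.isTree hi hvc)
      have h2 := trunk_eq hT hc (LiesOver.trans hT.isTree hj hvc)
      exact Subtype.ext (congrArg b.vec (h1.trans h2.symm))

theorem toAmbient_mem (hM : IsSmoothSubmanifold d M) (hT : T.IsFTree) {b : InfData T m}
    (hb : b.IsValid M) : b.toAmbient hT hb ∈ canonicalCompactification n M := by
  obtain ⟨α, l, y, hl, hy⟩ := exists_isLimit hM hT hb
  exact mem_closure_of_tendsto (hy.tendsto_confEmbed hb) (Eventually.of_forall fun t => ⟨y t, rfl⟩)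

/-- The point of `C_T(M)` that corresponds to given data. -/
noncomputable def toStratum (hM : IsSmoothSubmanifold d M) (hT : T.IsFTree) (b : InfData T m)
    (hb : b.IsValid M) : Stratum T M :=
  ⟨b.toAmbient hT hb, toAmbient_mem hM hT hb, treeOf_toAmbient_iso hM hT hb⟩

/-- Similar data are limits of the same configurations, which have only one limit in `A_n[M]`. -/
theorem toStratum_congr (hM : IsSmoothSubmanifold d M) (hT : T.IsFTree) {b b' : InfData T m}
    (hb : b.IsValid M) (hb' : b'.IsValid M) (h : b.toInfStratum hb = b'.toInfStratum hb') :
    b.toStratum hM hT hb = b'.toStratum hM hT hb' := by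
  obtain ⟨α, l, y, hl, hy⟩ := exists_isLimit hM hT hb
  obtain ⟨h1, h2⟩ := (toInfStratum_eq_iff hb hb').1 h
  exact Subtype.ext (tendsto_nhds_unique (hy.tendsto_confEmbed hb)
    ((hy.congr h1 h2).tendsto_confEmbed hb'))

end InfData

theorem isValid_dataOf_stratum (hM : IsSmoothSubmanifold d M) (hT : T.IsFTree) (x : Stratum T M) :
    (dataOf hT x.1).IsValid M := by
  obtain ⟨l, hl, hy⟩ := exists_tendsto_of_mem_canonicalCompactification x.2.1
  exact isValid_dataOf hT (y := fun t => t) hy x.2.2 hM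

/-- Configurations approaching `x` converge to its data, hence also to the point built from these
data. -/
theorem toStratum_dataOf (hM : IsSmoothSubmanifold d M) (hT : T.IsFTree) (x : Stratum T M) :
    (dataOf hT x.1).toStratum hM hT (isValid_dataOf_stratum hM hT x) = x := by
  obtain ⟨l, hl, hy⟩ := exists_tendsto_of_mem_canonicalCompactification x.2.1
  exact Subtype.ext (tendsto_nhds_unique
    ((isLimit_dataOf hT (y := fun t => t) hy x.2.2).tendsto_confEmbed
      (isValid_dataOf_stratum hM hT x)) hy)

/-- The same differences converge under the scale `r` and under the normalization by the scale leaf;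
comparing the two yields the similarity between the given and the normalized vectors. -/
theorem vec_dataOf_toAmbient (hM : IsSmoothSubmanifold d M) (hT : T.IsFTree) {b : InfData T m}
    (hb : b.IsValid M) {v : T.V} (hv : T.IsInternal v) (c : T.EdgesAt v) :
    (dataOf hT (b.toAmbient hT hb)).vec c.1 =
      ‖b.gap (baseLeaf hT hv) (scaleLeaf hT hv)‖⁻¹ •
        (b.vec c.1 - b.vec (edgePair hT hv).1.1) := by
  obtain ⟨α, l, y, hl, hy⟩ := InfData.exists_isLimit hM hT hb
  obtain ⟨r, hr, hlim⟩ := hy.diff v hv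
  have h1 := tendsto_smul_diff_baseLeaf hT (hy.tendsto_confEmbed hb)
    (InfData.treeOf_toAmbient_iso hM hT hb) hv c
  have h2 := hlim _ _ _ _ c.2 (edgePair hT hv).1.2 (liesOver_edgeLeaf hT c)
    (liesOver_edgeLeaf hT _)
  have h3 := hlim _ _ _ _ (edgePair hT hv).1.2 (edgePair hT hv).2.2 (liesOver_edgeLeaf hT _)
    (liesOver_edgeLeaf hT _)
  rw [← b.gap_eq hT (edgePair hT hv).1.2 (edgePair hT hv).2.2 (edgePair_ne hT hv)
    (liesOver_edgeLeaf hT _) (liesOver_edgeLeaf hT _)] at h3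
  refine tendsto_nhds_unique h1 (((h3.norm.inv₀ (norm_ne_zero_iff.2
    (hb.gap_ne_zero hT (baseLeaf_ne_scaleLeaf hT hv)))).smul h2).congr' ?_)
  filter_upwards [hr] with t ht
  rw [norm_smul, Real.norm_of_nonneg ht.le, smul_smul, mul_inv, mul_comm, ← mul_assoc,
    mul_inv_cancel₀ ht.ne', one_mul]
  rfl

/-- The data of the point of `C_T(M)` that corresponds to given data represent the same element of
`D_T(M)`. -/
theorem toInfStratum_dataOf (hM : IsSmoothSubmanifold d M) (hT : T.IsFTree) {b : InfData T m}
    (hb : b.IsValid M) : (dataOf hT (b.toStratum hM hT hb).1).toInfStratum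
      (isValid_dataOf_stratum hM hT _) = b.toInfStratum hb := by
  refine ((InfData.toInfStratum_eq_iff hb _).2 ⟨fun e => ?_, fun e v =>
    ⟨‖b.gap (baseLeaf hT v.2.1) (scaleLeaf hT v.2.1)‖⁻¹, inv_pos.2 (norm_pos_iff.2
      (hb.gap_ne_zero hT (baseLeaf_ne_scaleLeaf hT v.2.1))),
      -(‖b.gap (baseLeaf hT v.2.1) (scaleLeaf hT v.2.1)‖⁻¹ •
        b.vec (edgePair hT v.2.1).1.1), fun c => ?_⟩⟩).symm
  · exact (InfData.vec_root b e).symm.trans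
      (congrArg b.vec (trunk_eq hT e.2 (liesOver_edgeLeaf hT e)).symm)
  · have h := vec_dataOf_toAmbient hM hT hb v.2.1 c
    rwa [InfData.vec_internal hT _ e v c, InfData.vec_internal hT _ e v c, smul_sub,
      sub_eq_add_neg] at h

/-- The stratum of a tree and its infinitesimal description. -/
noncomputable def stratumEquiv (hM : IsSmoothSubmanifold d M) (hT : T.IsFTree) :
    Stratum T M ≃ InfStratum T M where
  toFun x := (dataOf hT x.1).toInfStratum (isValid_dataOf_stratum hM hT x)
  invFun p := InfData.toStratum hM hT _ (InfData.isValid_of_rep (rep_exists p).choose_spec)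
  left_inv x := (InfData.toStratum_congr hM hT _ _ (InfData.toInfStratum_of_rep
    (rep_exists (X := InfStratum T M) _).choose_spec)).trans (toStratum_dataOf hM hT x)
  right_inv p := (toInfStratum_dataOf hM hT _).trans (InfData.toInfStratum_of_rep
    (rep_exists p).choose_spec)

/-- The inverse is defined by a chosen representative. Smoothness needs its value in terms of every
nearby parameter. -/
theorem stratumEquiv_symm_of_rep (hM : IsSmoothSubmanifold d M) (hT : T.IsFTree) {b : InfData T m}
    {p : InfStratum T M} (h : Rep (X := InfStratum T M) b p) :
    (stratumEquiv hM hT).symm p = b.toStratum hM hT (InfData.isValid_of_rep h) :=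
  InfData.toStratum_congr hM hT _ _ ((InfData.toInfStratum_of_rep
    (rep_exists p).choose_spec).trans (InfData.toInfStratum_of_rep h).symm)

end Bijection

/-! ### Smoothness in both directions -/

section Smoothness

open RootedGraph SmoothParam

/-- The coordinate `t / (1 + t)` on `[0, ∞]`. -/
noncomputable def ENNReal.birationalCoord (t : ENNReal) : ℝ :=
  (ENNReal.orderIsoUnitIntervalBirational t : ℝ)

theorem ENNReal.birationalCoord_zero : ENNReal.birationalCoord 0 = 0 := by
  simp [ENNReal.birationalCoord, ENNReal.orderIsoUnitIntervalBirational_apply_coe]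

theorem ENNReal.birationalCoord_top : ENNReal.birationalCoord ⊤ = 1 := by
  simp [ENNReal.birationalCoord]

theorem ENNReal.birationalCoord_ofReal_div {s t : ℝ} (hs : 0 < s) (ht : 0 < t) :
    ENNReal.birationalCoord (ENNReal.ofReal (s / t)) = s / (s + t) := by
  rw [ENNReal.birationalCoord, ENNReal.orderIsoUnitIntervalBirational_apply_coe,
    ← ENNReal.ofReal_inv_of_pos (div_pos hs ht), ← ENNReal.ofReal_one,
    ← ENNReal.ofReal_add (by positivity) zero_le_one, ENNReal.toReal_inv,
    ENNReal.toReal_ofReal (by positivity)]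
  field_simp
  ring

/-- At `∞` both sides are zero by convention; the formula is smooth only away from coordinate one.
-/
theorem ENNReal.toReal_eq_birationalCoord (t : ENNReal) :
    t.toReal = t.birationalCoord / (1 - t.birationalCoord) := by
  by_cases ht : t = ⊤
  · simp [ht, ENNReal.birationalCoord_top]
  lift t to NNReal using ht
  rcases eq_or_ne t 0 with rfl | h0
  · simp [ENNReal.birationalCoord_zero]
  have h1 : 0 < (t : ℝ) := NNReal.coe_pos.2 (pos_iff_ne_zero.2 h0)
  have h2 := ENNReal.birationalCoord_ofReal_div h1 one_pos
  rw [div_one, ENNReal.ofReal_coe_nnreal] at h2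
  rw [h2, ENNReal.coe_toReal]
  field_simp
  ring

theorem ENNReal.birationalCoord_ne_one {t : ENNReal} (ht : t ≠ ⊤) : t.birationalCoord ≠ 1 := by
  rw [← ENNReal.birationalCoord_top]
  exact fun h => ht (ENNReal.orderIsoUnitIntervalBirational.injective (Subtype.ext h))

theorem SmoothParam.contDiffOn_param_prod {X Y : Type} [SmoothParam X] [SmoothParam Y] {E : Type*}
    [NormedAddCommGroup E] [NormedSpace ℝ E] {U : Set E} {F : E → Param X} {G : E → Param Y}
    (hF : ContDiffOn ℝ ∞ F U) (hG : ContDiffOn ℝ ∞ G U) :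
    @ContDiffOn ℝ _ E _ _ (Param (X × Y)) _ _ ∞ (fun b => (F b, G b)) U :=
  hF.prodMk hG

variable {m n d : ℕ} {T : RootedGraph n} {M : Set (Euc m)}

/-- The parameters of `A_n[M]`. -/
abbrev AmbientData (n m : ℕ) : Type :=
  (Fin n → Euc m) × (Conf (Fin 2) (Fin n) → Euc m) × (Conf (Fin 3) (Fin n) → ℝ)

namespace AmbientData

/-- The direction `u_ij`; zero if `i = j`. -/
noncomputable def dir (a : AmbientData n m) (i j : Fin n) : Euc m :=
  if h : i ≠ j then a.2.1 ⟨![i, j], injective_pair_iff.2 h⟩ else 0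

/-- The coordinate of the ratio `d_ijk`; that of one if the indices are not distinct. -/
noncomputable def coord (a : AmbientData n m) (i j k : Fin n) : ℝ :=
  if h : i ≠ j ∧ i ≠ k ∧ j ≠ k then a.2.2 ⟨![i, j, k], injective_triple_iff.2 h⟩ else 1 / 2

/-- The data of a point of `C_T(M)` in terms of parameters. -/
noncomputable def toInfData (hT : T.IsFTree) (a : AmbientData n m) : InfData T m := fun e =>
  (a.1 (edgeLeaf hT e), fun v => (a.1 (edgeLeaf hT e), fun c =>
    (a.coord (baseLeaf hT v.2.1) (edgeLeaf hT c) (scaleLeaf hT v.2.1) /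
      (1 - a.coord (baseLeaf hT v.2.1) (edgeLeaf hT c) (scaleLeaf hT v.2.1))) •
      a.dir (edgeLeaf hT c) (baseLeaf hT v.2.1)))

section Rep

variable {a : AmbientData n m} {x : CompactAmbient n M} (h : Rep (X := CompactAmbient n M) a x)
include h

theorem point_of_rep (i : Fin n) : a.1 i = x.1 i := h.1 i

theorem dir_of_rep (i j : Fin n) : a.dir i j = dirOf x i j := by
  rw [dir, dirOf]
  split_ifs with hij
  · exact h.2.1 _
  · rfl

theorem coord_of_rep (i j k : Fin n) : a.coord i j k = (ratioOf x i j k).birationalCoord := by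
  rw [coord, ratioOf]
  split_ifs with hij
  · exact h.2.2 _
  · have h1 := ENNReal.birationalCoord_ofReal_div one_pos one_pos
    rw [div_one, ENNReal.ofReal_one] at h1
    rw [h1]
    norm_num

theorem toInfData_of_rep (hT : T.IsFTree) : a.toInfData hT = dataOf hT x := by
  funext e
  refine Prod.ext (point_of_rep h _) (funext fun v => Prod.ext (point_of_rep h _)
    (funext fun c => ?_))
  simp only [toInfData, dataOf, coord_of_rep h, dir_of_rep h, ENNReal.toReal_eq_birationalCoord]

end Rep

theorem contDiff_point (i : Fin n) :
    @ContDiff ℝ _ (Param (Stratum T M)) _ _ (Euc m) _ _ ∞ fun a : AmbientData n m => a.1 i :=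
  (contDiff_param_apply (X := fun _ : Fin n => M) i).comp (contDiff_param_fst (X := Fin n → M)
    (Y := (Conf (Fin 2) (Fin n) → Metric.sphere (0 : Euc m) 1) × (Conf (Fin 3) (Fin n) → ENNReal)))

theorem contDiff_dir (i j : Fin n) :
    @ContDiff ℝ _ (Param (Stratum T M)) _ _ (Euc m) _ _ ∞ fun a : AmbientData n m => a.dir i j := by
  by_cases h : i ≠ j
  · simp only [dir, dif_pos h]
    exact (contDiff_param_apply (X := fun _ : Conf (Fin 2) (Fin n) => Metric.sphere (0 : Euc m) 1)
      _).comp ((contDiff_param_fst (X := Conf (Fin 2) (Fin n) → Metric.sphere (0 : Euc m) 1)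
      (Y := Conf (Fin 3) (Fin n) → ENNReal)).comp (contDiff_param_snd (X := Fin n → M)
      (Y := (Conf (Fin 2) (Fin n) → Metric.sphere (0 : Euc m) 1) ×
        (Conf (Fin 3) (Fin n) → ENNReal))))
  · simp only [dir, dif_neg h]
    exact contDiff_const

theorem contDiff_coord (i j k : Fin n) :
    @ContDiff ℝ _ (Param (Stratum T M)) _ _ ℝ _ _ ∞ fun a : AmbientData n m => a.coord i j k := by
  by_cases h : i ≠ j ∧ i ≠ k ∧ j ≠ k
  · simp only [coord, dif_pos h]
    exact (contDiff_param_apply (X := fun _ : Conf (Fin 3) (Fin n) => ENNReal)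
      _).comp ((contDiff_param_snd (X := Conf (Fin 2) (Fin n) → Metric.sphere (0 : Euc m) 1)
      (Y := Conf (Fin 3) (Fin n) → ENNReal)).comp (contDiff_param_snd (X := Fin n → M)
      (Y := (Conf (Fin 2) (Fin n) → Metric.sphere (0 : Euc m) 1) ×
        (Conf (Fin 3) (Fin n) → ENNReal))))
  · simp only [coord, dif_neg h]
    exact contDiff_const

end AmbientData

theorem isSmooth_stratumEquiv (hM : IsSmoothSubmanifold d M) (hT : T.IsFTree) :
    IsSmooth (stratumEquiv hM hT) := by
  intro x a ha
  -- The set where the denominators `1 - coord` do not vanish; it contains the parameters of the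
  -- stratum because the normalizing ratios are finite there.
  let U : Set (Param (Stratum T M)) := ⋂ (v : T.Internal) (c : T.EdgesAt v.1),
    {a : Param (Stratum T M) |
      AmbientData.coord a (baseLeaf hT v.2) (edgeLeaf hT c) (scaleLeaf hT v.2) ≠ 1}
  have hU : ∀ b ∈ U, ∀ (v : T.V) (hv : T.IsInternal v) (c : T.EdgesAt v),
      1 - AmbientData.coord b (baseLeaf hT hv) (edgeLeaf hT c) (scaleLeaf hT hv) ≠ 0 := by
    intro b hb v hv c
    have h := Set.mem_iInter.1 (Set.mem_iInter.1 hb ⟨v, hv⟩) c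
    exact fun h0 => h (sub_eq_zero.1 h0).symm
  refine ⟨U, AmbientData.toInfData hT, ?_, ?_, ?_, fun b _ y hy => ?_⟩
  · refine isOpen_iInter_of_finite fun v => isOpen_iInter_of_finite fun c => ?_
    exact isOpen_ne_fun (AmbientData.contDiff_coord _ _ _).continuous continuous_const
  · obtain ⟨l, hl, hy⟩ := exists_tendsto_of_mem_canonicalCompactification x.2.1
    refine Set.mem_iInter.2 fun v => Set.mem_iInter.2 fun c => ?_
    have h := ENNReal.birationalCoord_ne_one
      (ratioOf_baseLeaf_ne_top hT (y := fun t => t) hy x.2.2 v.2 c)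
    rwa [← AmbientData.coord_of_rep ha] at h
  · refine contDiffOn_param_pi (X := fun e => InfConfOver T M e) fun e =>
      contDiffOn_param_prod (X := M) (Y := ∀ v : T.InternalOver e, InfConf M (T.EdgesAt v.1))
        (AmbientData.contDiff_point _).contDiffOn (contDiffOn_param_pi
          (X := fun v : T.InternalOver e => InfConf M (T.EdgesAt v.1)) fun v =>
            contDiffOn_param_prod (X := M) (Y := T.EdgesAt v.1 → Euc m)
              (AmbientData.contDiff_point _).contDiffOn (contDiffOn_param_pi
                (X := fun _ : T.EdgesAt v.1 => Euc m) fun c => ?_))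
    exact ((AmbientData.contDiff_coord _ _ _).contDiffOn.div (contDiff_const.sub
      (AmbientData.contDiff_coord _ _ _)).contDiffOn fun b hb => hU b hb v.1 v.2.1 c).smul
        (AmbientData.contDiff_dir _ _).contDiffOn
  · rw [AmbientData.toInfData_of_rep hy hT]
    exact InfData.rep_toInfStratum _ (isValid_dataOf_stratum hM hT y)

namespace InfData

theorem contDiff_gap (i j : Fin n) :
    @ContDiff ℝ _ (Param (InfStratum T M)) _ _ (Euc m) _ _ ∞ fun b : InfData T m => b.gap i j :=
  (contDiff_vec _).sub (contDiff_vec _)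

open Classical in
/-- The coordinate of the ratio `d_ijk`. -/
noncomputable def ratioCoord (b : InfData T m) (i j k : Fin n) : ℝ :=
  if T.branch i j = T.branch i k then ‖b.gap i j‖ / (‖b.gap i j‖ + ‖b.gap i k‖)
  else if T.Near i j k then 0 else 1

theorem ratioCoord_eq (hT : T.IsFTree) {b : InfData T m} (hb : b.IsValid M) {i j k : Fin n}
    (hij : i ≠ j) (hik : i ≠ k) : b.ratioCoord i j k = (b.ratio i j k).birationalCoord := by
  rw [ratioCoord, ratio]
  split_ifs
  · exact (ENNReal.birationalCoord_ofReal_div (norm_pos_iff.2 (hb.gap_ne_zero hT hij))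
      (norm_pos_iff.2 (hb.gap_ne_zero hT hik))).symm
  · exact ENNReal.birationalCoord_zero.symm
  · exact ENNReal.birationalCoord_top.symm

/-- The parameters of the point of `C_T(M)` that corresponds to given data. -/
noncomputable def toAmbientData (hT : T.IsFTree) (b : InfData T m) : AmbientData n m :=
  (fun i => b.vec (trunk hT i), fun p => ‖b.gap (p.1 0) (p.1 1)‖⁻¹ • b.gap (p.1 0) (p.1 1),
    fun q => b.ratioCoord (q.1 0) (q.1 1) (q.1 2))

theorem rep_toStratum (hM : IsSmoothSubmanifold d M) (hT : T.IsFTree) {b : InfData T m}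
    (hb : b.IsValid M) :
    Rep (X := Stratum T M) (b.toAmbientData hT) (b.toStratum hM hT hb) :=
  ⟨fun _ => rfl, fun _ => rfl, fun q => ratioCoord_eq hT hb
    (fun h => absurd (q.2 h) (by simp)) (fun h => absurd (q.2 h) (by simp))⟩

end InfData

theorem isSmooth_stratumEquiv_symm (hM : IsSmoothSubmanifold d M) (hT : T.IsFTree) :
    IsSmooth (stratumEquiv hM hT).symm := by
  classical
  intro p a ha
  -- The norm is smooth away from zero, and on this set all gaps are nonzero.
  let U : Set (Param (InfStratum T M)) := ⋂ (i : Fin n) (j : Fin n),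
    {b : Param (InfStratum T M) | i ≠ j → InfData.gap b i j ≠ 0}
  have hU : ∀ b ∈ U, ∀ i j : Fin n, i ≠ j → InfData.gap b i j ≠ 0 := fun b hb i j =>
    Set.mem_iInter.1 (Set.mem_iInter.1 hb i) j
  have hnorm : ∀ i j : Fin n, i ≠ j → @ContDiffOn ℝ _ (Param (InfStratum T M)) _ _ ℝ _ _ ∞
      (fun b : InfData T m => ‖b.gap i j‖) U := fun i j hij =>
    (InfData.contDiff_gap i j).contDiffOn.norm ℝ fun b hb => hU b hb i j hij
  refine ⟨U, InfData.toAmbientData hT, ?_, ?_, ?_, fun b _ q hq => ?_⟩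
  · refine isOpen_iInter_of_finite fun i => isOpen_iInter_of_finite fun j => ?_
    by_cases hij : i = j
    · simp [hij]
    · simp only [ne_eq, hij, not_false_eq_true, forall_const]
      exact isOpen_ne_fun (InfData.contDiff_gap _ _).continuous continuous_const
  · exact Set.mem_iInter.2 fun i => Set.mem_iInter.2 fun j hij =>
      (InfData.isValid_of_rep ha).gap_ne_zero hT hij
  · refine contDiffOn_param_prod (X := Fin n → M)
      (Y := (Conf (Fin 2) (Fin n) → Metric.sphere (0 : Euc m) 1) × (Conf (Fin 3) (Fin n) → ENNReal))
      (contDiffOn_param_pi (X := fun _ : Fin n => M) fun i =>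
        (InfData.contDiff_vec _).contDiffOn)
      (contDiffOn_param_prod (X := Conf (Fin 2) (Fin n) → Metric.sphere (0 : Euc m) 1)
        (Y := Conf (Fin 3) (Fin n) → ENNReal)
        (contDiffOn_param_pi (X := fun _ : Conf (Fin 2) (Fin n) => Metric.sphere (0 : Euc m) 1)
          fun p => ?_)
        (contDiffOn_param_pi (X := fun _ : Conf (Fin 3) (Fin n) => ENNReal) fun q => ?_))
    · have hne : p.1 0 ≠ p.1 1 := fun h => absurd (p.2 h) (by simp)
      exact ((hnorm _ _ hne).inv fun b hb => norm_ne_zero_iff.2 (hU b hb _ _ hne)).smul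
        (InfData.contDiff_gap _ _).contDiffOn
    · have h1 : q.1 0 ≠ q.1 1 := fun h => absurd (q.2 h) (by simp)
      have h2 : q.1 0 ≠ q.1 2 := fun h => absurd (q.2 h) (by simp)
      -- The case distinction depends on `T` only: each ratio coordinate is either a quotient of
      -- norms or constantly zero or one.
      by_cases hbr : T.branch (q.1 0) (q.1 1) = T.branch (q.1 0) (q.1 2)
      · have h3 := (hnorm _ _ h1).div ((hnorm _ _ h1).add (hnorm _ _ h2)) fun b hb =>
          (add_pos (norm_pos_iff.2 (hU b hb _ _ h1)) (norm_pos_iff.2 (hU b hb _ _ h2))).ne'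
        refine h3.congr fun b _ => ?_
        exact if_pos hbr
      · refine contDiffOn_const (c := if T.Near (q.1 0) (q.1 1) (q.1 2) then (0 : ℝ) else 1)
          |>.congr fun b _ => ?_
        exact if_neg hbr
  · rw [stratumEquiv_symm_of_rep hM hT hq]
    exact InfData.rep_toStratum hM hT _

/-- A stratum is diffeomorphic to its infinitesimal description. -/
theorem diffeomorphic_stratum (hM : IsSmoothSubmanifold d M) (hT : T.IsFTree) :
    Diffeomorphic (Stratum T M) (InfStratum T M) := by
  have := hM.isTopological_infStratum T
  obtain ⟨g, hg, -⟩ := exists_isDiffeo_of_equiv (stratumEquiv hM hT) (isSmooth_stratumEquiv hM hT)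
    (isSmooth_stratumEquiv_symm hM hT)
  exact ⟨g, hg⟩

end Smoothness

theorem mainTheorem1 (n : ℕ) (T : RootedGraph n) (hT : T.IsFTree) (m : ℕ) :
    (∀ (d : ℕ) (M : Set (Euc m)), IsSmoothSubmanifold d M →
      SmoothParam.Diffeomorphic (Stratum T M) (InfStratum T M)) ∧
    (∃ Φ : InfStratum T (Set.univ : Set (Euc m)) ≃ₜ
        Conf (T.EdgesAt T.root) (Euc m) × (∀ v : T.Internal, ConfModSim m (T.EdgesAt v.1)),
      SmoothParam.IsDiffeo Φ ∧
      ∀ (p : InfStratum T (Set.univ : Set (Euc m))) (e : T.EdgesAt T.root),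
        (Φ p).1.1 e = ((p.1 e).1.1 : Euc m) ∧
        ∀ v : T.InternalOver e, (Φ p).2 ⟨v.1, v.2.1⟩ = ((p.1 e).1.2 v).toConfModSim) := by
  exact ⟨fun _ _ hM => diffeomorphic_stratum hM hT, exists_isDiffeo_infStratum_univ hT m⟩
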